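/- Let $k$ be an artinian local ring (commutative) with maximal ideal $m$, and let $t$ be a variable. **Contou-Carrère symbol.** Each $f\in k((t))^\times$ has a unique presentation $$f=t^{w(f)}\cdot a_0\cdot\prod_{i\ge1}(1-a_{-i}t^{-i})\cdot\prod_{i\ge1}(1-a_it^i)$$ with $w(f)\in\mathbb Z$, $a_0\in k^\times$, $a_i\in k$ and $a_{-i}\in m$ for $i>0$, and $a_{-i}=0$ for all but finitely many $i>0$. The integer $w(f)$ is called the winding number of $f$. If $(a_i)$ and $(b_i)$ are the families attached in this way to $f$ and $g$, put, with $(i,j)=\gcd(i,j)$, $$\langle f,g\rangle=(-1)^{w(f)w(g)}\,\frac{a_0^{w(g)}}{b_0^{w(f)}}\cdot\frac{\prod_{i,j\ge1}\bigl(1-a_i^{j/(i,j)}b_{-j}^{i/(i,j)}\bigr)^{(i,j)}}{\prod_{i,j\ge1}\bigl(1-a_{-i}^{j/(i,j)}b_{j}^{i/(i,j)}\bigr)^{(i,j)}}\in k^\times ;$$ all but finitely many factors are $1$. **The determinant groupoid.** Let $V=k((t))$ and $W=k[[t]]$. Two $k$-submodules $A,B$ of $V$ are commensurable if $(A+B)/(A\cap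 B)$ is finitely generated. For a free $k$-module $M$ of finite rank let $\det M$ be its top exterior power. Let $A,B\subseteq V$ be free submodules commensurable to $W$. For a free submodule $P\subseteq A\cap B$ with $A/P$ and $B/P$ free of finite rank, let $\mathrm{Det}(A,B;P)$ be the set of $k$-linear isomorphisms $\det(A/P)\to\det(B/P)$. If $Q\subseteq P$ are two such submodules, the cancellation rule is the bijection $\mathrm{Det}(A,B;Q)\to\mathrm{Det}(A,B;P)$ that sends $$(\wedge_\ell p_\ell)\wedge(\wedge_i\tilde a_i)\mapsto c\cdot(\wedge_\ell p_\ell)\wedge(\wedge_j\tilde b_j)\quad\text{to}\quad\wedge_i a_i\mapsto c\cdot\wedge_j b_j ,$$ where $(p_\ell)$, $(a_i)$, $(b_j)$ are ordered bases of $P/Q$, $A/P$, $B/P$ and $\tilde a_i$, $\tilde b_j$ are liftings of $a_i$, $b_j$ to $A/Q$, $B/Q$. Let $\mathrm{Det}(A,B)=\varprojlim_P\mathrm{Det}(A,B;P)$. The free submodules of $V$ commensurable to $W$ are the objects, and the sets $\mathrm{Det}(A,B)$ the sets of morphisms $A\to B$, of a groupoid, with composition induced by that of isomorphisms $\det(A/P)\to\det(B/P)\to\det(C/P)$;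 the group $k^\times$ acts on each $\mathrm{Det}(A,B)$ by scalar multiplication. **The central extension.** The restricted general linear group $G=G^{k((t))}_{k[[t]]}$ is the group of $k$-linear automorphisms $\sigma$ of $V$ such that $W$ and $\sigma W$ are commensurable. Each $\sigma\in G$ acts on the groupoid by a functor $\sigma_*$, $A\mapsto\sigma A$, given on morphisms by transport of structure. Let $\tilde G$ be the group of pairs $(\sigma,\Phi)$, where $\sigma\in G$ and $\Phi$ is a natural transformation from the identity functor to $\sigma_*$, that is, a family $\Phi(A)\in\mathrm{Det}(A,\sigma A)$ with $\sigma_*(\alpha)\circ\Phi(A)=\Phi(B)\circ\alpha$ for all $\alpha\in\mathrm{Det}(A,B)$; the group law is $(\sigma,\Phi)(\tau,\Psi)=(\sigma\tau,\;A\mapsto\sigma_*(\Psi(A))\circ\Phi(A))$. Multiplication identifies $k((t))^\times$ with a commutative subgroup of $G$. **Theorem.** 1. Every $f\in k((t))^\times$ has a unique presentation as above, so that $w(f)$ and $\langle f,g\rangle$ are well defined. 2. The maps $x\mapsto(1,\,A\mapsto x\cdot 1_A)$ and $(\sigma,\Phi)\mapsto\sigma$ form a central extension $1\to k^\times\to\tilde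 G\to G\to1$. Hence for commuting $\sigma,\tau\in G$ the commutator $\{\sigma,\tau\}=\tilde\sigma\tilde\tau\tilde\sigma^{-1}\tilde\tau^{-1}\in k^\times$ does not depend on the liftings $\tilde\sigma,\tilde\tau\in\tilde G$ of $\sigma,\tau$. 3. For all $f,g\in k((t))^\times$, $$\langle f,g\rangle^{-1}=(-1)^{w(f)w(g)}\{f,g\}.$$ 4. The Contou-Carrère symbol is bimultiplicative: for all $f,f',g,g'\in k((t))^\times$, $\langle ff',g\rangle=\langle f,g\rangle\langle f',g\rangle$ and $\langle f,gg'\rangle=\langle f,g\rangle\langle f,g'\rangle$. 5. The Contou-Carrère symbol is invariant under reparameterization: for each $\tau\in k((t))^\times$ with $w(\tau)=1$, substitution $f=\sum_n f_nt^n\mapsto f(\tau)=\sum_n f_n\tau^n$ (for each $d$, only finitely many terms contribute to the coefficient of $t^d$) is a ring automorphism of $k((t))$, and $\langle f(\tau),g(\tau)\rangle=\langle f,g\rangle$ for all $f,g\in k((t))^\times$. -/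

import Mathlib

set_option linter.unusedSectionVars false

open Module

namespace CommDet

section LinearAlgebra

variable {k : Type*} [CommRing k]
variable {L M N : Type*} [AddCommGroup L] [Module k L] [AddCommGroup M] [Module k M]
  [AddCommGroup N] [Module k N]

/-- The determinant `det M` of a free `k`-module `M` of finite rank: its maximal exterior power. -/
abbrev DetModule (k M : Type*) [CommRing k] [AddCommGroup M] [Module k M] : Type _ :=
  ⋀[k]^(Module.finrank k M) M

/-- The generator `e₀ ∧ ⋯ ∧ e_{n-1}` of `det M` attached to an ordered basis of `M`. -/
noncomputable def wedge [Nontrivial k] {n : ℕ} (e : Basis (Fin n) k M) : DetModule k M :=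
  exteriorPower.ιMulti k (Module.finrank k M)
    (fun i => e (Fin.cast (by simp [Module.finrank_eq_card_basis e]) i))

/-- For a short exact sequence `0 → L → M → N → 0` and ordered bases `p` of `L` and `a` of `N`, an
ordered basis `e` of `M` is adapted if it consists of the images of the members of `p` followed by
liftings of the members of `a`. Then `wedge e` is the element `(∧ p_ℓ) ∧ (∧ ã_i)` of `det M`. -/
structure IsAdapted (i : L →ₗ[k] M) (π : M →ₗ[k] N) {r n : ℕ} (p : Basis (Fin r) k L)
    (a : Basis (Fin n) k N) (e : Basis (Fin (r + n)) k M) : Prop where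
  left : ∀ l, e (Fin.castAdd n l) = i (p l)
  right : ∀ j, π (e (Fin.natAdd r j)) = a j

/-- Short exact sequences, unbundled. -/
structure IsShortExact (i : L →ₗ[k] M) (π : M →ₗ[k] N) : Prop where
  inj : Function.Injective i
  exact : ∀ x, π x = 0 ↔ ∃ y, i y = x
  surj : Function.Surjective π

theorem alternating_eq {n : ℕ} (e : Basis (Fin n) k M) (F : M [⋀^Fin n]→ₗ[k] N) (v : Fin n → M) :
    F v = e.det v • F e := by
  have key : F = (LinearMap.toSpanSingleton k N (F e)).compAlternatingMap e.det := by
    refine Basis.ext_alternating e fun v hv => ?_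
    let σ : Equiv.Perm (Fin n) := Equiv.ofBijective v (Finite.injective_iff_bijective.1 hv)
    change F (e ∘ σ) = (LinearMap.toSpanSingleton k N (F e)).compAlternatingMap e.det (e ∘ σ)
    simp [AlternatingMap.map_perm, Basis.det_self]
  have h := congrArg (fun G => G v) key
  simpa using h

theorem wedge_eq [Nontrivial k] {n : ℕ} (e e' : Basis (Fin n) k M) :
    wedge e' = e.det e' • wedge e := by
  have hn : n = Module.finrank k M := by simp [Module.finrank_eq_card_basis e]
  subst hn
  exact alternating_eq e (exteriorPower.ιMulti k (M := M) (Module.finrank k M)) e'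

theorem wedge_cast [Nontrivial k] {n n' : ℕ} (h : n = n') (e : Basis (Fin n) k M) :
    wedge (e.reindex (finCongr h)) = wedge e := by
  subst h
  simp [wedge]

/-- The coordinate on `det M` defined by an ordered basis of `M`. -/
noncomputable def detEquiv [Nontrivial k] {n : ℕ} (e : Basis (Fin n) k M) :
    DetModule k M ≃ₗ[k] k := by
  have hn : n = Module.finrank k M := by simp [Module.finrank_eq_card_basis e]
  subst hn
  refine LinearEquiv.ofLinearMap (exteriorPower.alternatingMapLinearEquiv e.det)
    (LinearMap.toSpanSingleton k _ (wedge e)) ?_ ?_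
  · ext
    simp [wedge, Basis.det_self]
  · ext v : 2
    simp only [LinearMap.compAlternatingMap_apply, LinearMap.comp_apply,
      exteriorPower.alternatingMapLinearEquiv_apply_ιMulti, LinearMap.toSpanSingleton_apply,
      LinearMap.id_apply]
    exact (alternating_eq e (exteriorPower.ιMulti k (M := M) (Module.finrank k M)) v).symm

theorem detEquiv_wedge [Nontrivial k] {n : ℕ} (e : Basis (Fin n) k M) :
    detEquiv e (wedge e) = 1 := by
  have hn : n = Module.finrank k M := by simp [Module.finrank_eq_card_basis e]
  subst hn
  simp [detEquiv, wedge, Basis.det_self]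

theorem eq_smul_wedge [Nontrivial k] {n : ℕ} (e : Basis (Fin n) k M) (x : DetModule k M) :
    x = detEquiv e x • wedge e := by
  apply (detEquiv e).injective
  simp [detEquiv_wedge]

theorem exists_adapted {i : L →ₗ[k] M} {π : M →ₗ[k] N} (h : IsShortExact i π) {r n : ℕ}
    (p : Basis (Fin r) k L) (a : Basis (Fin n) k N) (v : Fin n → M) (hv : ∀ j, π (v j) = a j) :
    ∃ e : Basis (Fin (r + n)) k M, IsAdapted i π p a e ∧ ∀ j, e (Fin.natAdd r j) = v j := by
  have hπi : ∀ y, π (i y) = 0 := fun y => (h.exact _).2 ⟨y, rfl⟩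
  let u : Fin (r + n) → M := Fin.append (fun l => i (p l)) v
  have hli : LinearIndependent k u := by
    rw [Fintype.linearIndependent_iff]
    intro c hc
    rw [Fin.sum_univ_add] at hc
    simp only [u, Fin.append_left, Fin.append_right] at hc
    have h1 := congrArg π hc
    simp only [map_add, map_sum, map_smul, hπi, hv, smul_zero, Finset.sum_const_zero, zero_add,
      map_zero] at h1
    have h2 := Fintype.linearIndependent_iff.1 a.linearIndependent _ h1
    simp only [h2, zero_smul, Finset.sum_const_zero, add_zero] at hc
    have h3 : i (∑ l, c (Fin.castAdd n l) • p l) = i 0 := by simpa using hc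
    have h4 := Fintype.linearIndependent_iff.1 p.linearIndependent _ (h.inj h3)
    intro x
    exact Fin.addCases h4 h2 x
  have hsp : ⊤ ≤ Submodule.span k (Set.range u) := by
    intro x _
    have h0 : π (x - ∑ j, a.repr (π x) j • v j) = 0 := by
      simp only [map_sub, map_sum, map_smul, hv, a.sum_repr, sub_self]
    obtain ⟨y, hy⟩ := (h.exact _).1 h0
    have h1 : x = i y + ∑ j, a.repr (π x) j • v j := by rw [hy]; abel
    rw [h1, ← p.sum_repr y, map_sum]
    refine add_mem (sum_mem fun l _ => ?_) (sum_mem fun j _ => ?_)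
    · rw [map_smul]
      exact Submodule.smul_mem _ _ (Submodule.subset_span ⟨Fin.castAdd n l, by simp [u]⟩)
    · exact Submodule.smul_mem _ _ (Submodule.subset_span ⟨Fin.natAdd r j, by simp [u]⟩)
  refine ⟨Basis.mk hli hsp, ⟨fun l => by simp [u], fun j => by simp [u, hv]⟩, fun j => by simp [u]⟩

theorem exists_adapted' {i : L →ₗ[k] M} {π : M →ₗ[k] N} (h : IsShortExact i π) {r n : ℕ}
    (p : Basis (Fin r) k L) (a : Basis (Fin n) k N) :
    ∃ e : Basis (Fin (r + n)) k M, IsAdapted i π p a e := by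
  obtain ⟨e, he, -⟩ := exists_adapted h p a (fun j => (h.surj (a j)).choose)
    (fun j => (h.surj (a j)).choose_spec)
  exact ⟨e, he⟩

theorem IsAdapted.det {i : L →ₗ[k] M} {π : M →ₗ[k] N} (h : IsShortExact i π) {r n : ℕ}
    {p p' : Basis (Fin r) k L} {a a' : Basis (Fin n) k N} {e e' : Basis (Fin (r + n)) k M}
    (he : IsAdapted i π p a e) (he' : IsAdapted i π p' a' e') :
    e'.det e = p'.det p * a'.det a := by
  have hπi : ∀ y, π (i y) = 0 := fun y => (h.exact _).2 ⟨y, rfl⟩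
  have h1 : ∀ y : L, e'.repr (i y) = Finsupp.mapDomain (Fin.castAdd n) (p'.repr y) := by
    intro y
    have : e'.repr.toLinearMap ∘ₗ i =
        Finsupp.lmapDomain k k (Fin.castAdd n) ∘ₗ p'.repr.toLinearMap := by
      refine p'.ext fun l => ?_
      simp [← he'.left l, Finsupp.mapDomain_single]
    exact congrArg (fun F => F y) this
  have h2 : ∀ (x : M) (j : Fin n), e'.repr x (Fin.natAdd r j) = a'.repr (π x) j := by
    intro x j
    have : (Finsupp.lapply (Fin.natAdd r j)) ∘ₗ e'.repr.toLinearMap =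
        (Finsupp.lapply j) ∘ₗ a'.repr.toLinearMap ∘ₗ π := by
      refine e'.ext fun l => ?_
      refine Fin.addCases (fun l => ?_) (fun l => ?_) l
      · simp [he'.left, hπi, h1]
        rw [Finsupp.single_eq_of_ne]
        intro hx
        have := congrArg Fin.val hx
        simp at this
        omega
      · simp [he'.right, Finsupp.single_apply]
    exact congrArg (fun F => F x) this
  rw [Basis.det_apply, Basis.det_apply, Basis.det_apply,
    ← Matrix.det_reindex_self finSumFinEquiv.symm (e'.toMatrix e)]
  have h3 : Matrix.reindex finSumFinEquiv.symm finSumFinEquiv.symm (e'.toMatrix e) =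
      Matrix.fromBlocks (p'.toMatrix p)
        (Matrix.of fun l j => e'.repr (e (Fin.natAdd r j)) (Fin.castAdd n l)) 0
        (a'.toMatrix a) := by
    ext x y
    rcases x with x | x <;> rcases y with y | y
    · simp [Basis.toMatrix_apply, he.left, h1,
        Finsupp.mapDomain_apply (Fin.castAdd_injective r n)]
    · simp [Basis.toMatrix_apply]
    · simp [Basis.toMatrix_apply, he.left, h2, hπi]
    · simp [Basis.toMatrix_apply, h2, he.right]
  rw [h3, Matrix.det_fromBlocks_zero₂₁]

theorem IsAdapted.map {L₁ M₁ N₁ : Type*} [AddCommGroup L₁] [Module k L₁] [AddCommGroup M₁]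
    [Module k M₁] [AddCommGroup N₁] [Module k N₁]
    {i : L →ₗ[k] M} {π : M →ₗ[k] N} {i₁ : L₁ →ₗ[k] M₁} {π₁ : M₁ →ₗ[k] N₁} (fL : L ≃ₗ[k] L₁)
    (fM : M ≃ₗ[k] M₁) (fN : N ≃ₗ[k] N₁) (hi : ∀ x, i₁ (fL x) = fM (i x))
    (hπ : ∀ x, π₁ (fM x) = fN (π x)) {r n : ℕ} {p : Basis (Fin r) k L} {a : Basis (Fin n) k N}
    {e : Basis (Fin (r + n)) k M} (h : IsAdapted i π p a e) :
    IsAdapted i₁ π₁ (p.map fL) (a.map fN) (e.map fM) :=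
  ⟨fun l => by simp [h.left, hi], fun j => by simp [h.right, hπ]⟩

end LinearAlgebra

section Cancellation

variable {k : Type*} [CommRing k] [Nontrivial k]
variable {L M N M' N' : Type*} [AddCommGroup L] [Module k L] [AddCommGroup M] [Module k M]
  [AddCommGroup N] [Module k N] [AddCommGroup M'] [Module k M'] [AddCommGroup N'] [Module k N']

/-- The cancellation rule, for short exact sequences `0 → L → M → N → 0` and
`0 → L → M' → N' → 0` of free modules of finite rank: an isomorphism `det M ≅ det M'` corresponds to
the isomorphism `det N ≅ det N'` such that, whenever the former is given by
`(∧ p_ℓ) ∧ (∧ ã_i) ↦ c • (∧ p_ℓ) ∧ (∧ b̃_j)`, the latter is given by `∧ a_i ↦ c • ∧ b_j`,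
for all ordered bases `p`, `a`, `b` of `L`, `N`, `N'` and all liftings `ã`, `b̃` of `a`, `b`. -/
def Cancels (i : L →ₗ[k] M) (π : M →ₗ[k] N) (i' : L →ₗ[k] M') (π' : M' →ₗ[k] N')
    (α : DetModule k M ≃ₗ[k] DetModule k M') (β : DetModule k N ≃ₗ[k] DetModule k N') : Prop :=
  ∀ (r n n' : ℕ) (p : Basis (Fin r) k L) (a : Basis (Fin n) k N) (b : Basis (Fin n') k N')
    (e : Basis (Fin (r + n)) k M) (e' : Basis (Fin (r + n')) k M'),
    IsAdapted i π p a e → IsAdapted i' π' p b e' →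
      ∃ c : k, α (wedge e) = c • wedge e' ∧ β (wedge a) = c • wedge b

/-- `E` is the isomorphism `det N ≅ det M` given by `x ↦ (∧ p_ℓ) ∧ x̃`. -/
def IsExt (i : L →ₗ[k] M) (π : M →ₗ[k] N) {r : ℕ} (p : Basis (Fin r) k L)
    (E : DetModule k N ≃ₗ[k] DetModule k M) : Prop :=
  ∀ (n : ℕ) (a : Basis (Fin n) k N) (e : Basis (Fin (r + n)) k M), IsAdapted i π p a e →
    E (wedge a) = wedge e

theorem basis_card {n n' : ℕ} (a : Basis (Fin n) k N) (a' : Basis (Fin n') k N) : n = n' := by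
  have h := Module.finrank_eq_card_basis a
  rw [Module.finrank_eq_card_basis a'] at h
  simpa using h.symm

theorem exists_isExt {i : L →ₗ[k] M} {π : M →ₗ[k] N} (h : IsShortExact i π) [Module.Free k N]
    [Module.Finite k N] {r : ℕ} (p : Basis (Fin r) k L) :
    ∃ E : DetModule k N ≃ₗ[k] DetModule k M, IsExt i π p E := by
  obtain ⟨e₀, he₀⟩ := exists_adapted' h p (Module.finBasis k N)
  refine ⟨(detEquiv (Module.finBasis k N)).trans (detEquiv e₀).symm, fun n a e he => ?_⟩
  obtain rfl := basis_card a (Module.finBasis k N)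
  rw [LinearEquiv.trans_apply, LinearEquiv.symm_apply_eq, wedge_eq (Module.finBasis k N) a,
    wedge_eq e₀ e, he.det h he₀]
  simp [detEquiv_wedge, Basis.det_self]

theorem IsExt.cancels_iff {i : L →ₗ[k] M} {π : M →ₗ[k] N} {i' : L →ₗ[k] M'} {π' : M' →ₗ[k] N'}
    (h : IsShortExact i π) (h' : IsShortExact i' π') [Module.Free k N] [Module.Finite k N]
    [Module.Free k N'] [Module.Finite k N'] {r : ℕ} {p : Basis (Fin r) k L}
    {E : DetModule k N ≃ₗ[k] DetModule k M} {E' : DetModule k N' ≃ₗ[k] DetModule k M'}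
    (hE : IsExt i π p E) (hE' : IsExt i' π' p E')
    {α : DetModule k M ≃ₗ[k] DetModule k M'} {β : DetModule k N ≃ₗ[k] DetModule k N'} :
    Cancels i π i' π' α β ↔ ∀ x, α (E x) = E' (β x) := by
  constructor
  · intro H x
    obtain ⟨e, he⟩ := exists_adapted' h p (Module.finBasis k N)
    obtain ⟨e', he'⟩ := exists_adapted' h' p (Module.finBasis k N')
    obtain ⟨c, hc, hc'⟩ := H _ _ _ _ _ _ _ _ he he'
    rw [eq_smul_wedge (Module.finBasis k N) x]
    simp only [map_smul]
    rw [hE _ _ _ he, hc, hc', map_smul, hE' _ _ _ he']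
  · intro H r' n n' q a b e e' he he'
    obtain rfl := basis_card q p
    obtain ⟨e₁, he₁⟩ := exists_adapted' h p a
    obtain ⟨e₁', he₁'⟩ := exists_adapted' h' p b
    refine ⟨detEquiv b (β (wedge a)), ?_, eq_smul_wedge b _⟩
    rw [wedge_eq e₁ e, wedge_eq e₁' e', he.det h he₁, he'.det h' he₁', map_smul,
      ← hE _ _ _ he₁, H, ← hE' _ _ _ he₁']
    conv_lhs => rw [eq_smul_wedge b (β (wedge a))]
    simp only [map_smul, Basis.det_self, mul_one]
    rw [smul_comm]

theorem Cancels.symm {i : L →ₗ[k] M} {π : M →ₗ[k] N} {i' : L →ₗ[k] M'} {π' : M' →ₗ[k] N'}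
    (h : IsShortExact i π) (h' : IsShortExact i' π') [Module.Free k N] [Module.Finite k N]
    [Module.Free k N'] [Module.Finite k N'] [Module.Free k L] [Module.Finite k L]
    {α : DetModule k M ≃ₗ[k] DetModule k M'} {β : DetModule k N ≃ₗ[k] DetModule k N'}
    (H : Cancels i π i' π' α β) : Cancels i' π' i π α.symm β.symm := by
  obtain ⟨E, hE⟩ := exists_isExt h (Module.finBasis k L)
  obtain ⟨E', hE'⟩ := exists_isExt h' (Module.finBasis k L)
  rw [hE'.cancels_iff h' h hE]
  rw [hE.cancels_iff h h' hE'] at H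
  intro x
  rw [LinearEquiv.symm_apply_eq, H]
  simp

theorem Cancels.trans {M'' N'' : Type*} [AddCommGroup M''] [Module k M''] [AddCommGroup N'']
    [Module k N''] {i : L →ₗ[k] M} {π : M →ₗ[k] N} {i' : L →ₗ[k] M'} {π' : M' →ₗ[k] N'}
    {i'' : L →ₗ[k] M''} {π'' : M'' →ₗ[k] N''}
    (h : IsShortExact i π) (h' : IsShortExact i' π') (h'' : IsShortExact i'' π'')
    [Module.Free k N] [Module.Finite k N]
    [Module.Free k N'] [Module.Finite k N'] [Module.Free k N''] [Module.Finite k N'']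
    [Module.Free k L] [Module.Finite k L]
    {α : DetModule k M ≃ₗ[k] DetModule k M'} {β : DetModule k N ≃ₗ[k] DetModule k N'}
    {α' : DetModule k M' ≃ₗ[k] DetModule k M''} {β' : DetModule k N' ≃ₗ[k] DetModule k N''}
    (H : Cancels i π i' π' α β) (H' : Cancels i' π' i'' π'' α' β') :
    Cancels i π i'' π'' (α.trans α') (β.trans β') := by
  obtain ⟨E, hE⟩ := exists_isExt h (Module.finBasis k L)
  obtain ⟨E', hE'⟩ := exists_isExt h' (Module.finBasis k L)
  obtain ⟨E'', hE''⟩ := exists_isExt h'' (Module.finBasis k L)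
  rw [hE.cancels_iff h h' hE'] at H
  rw [hE'.cancels_iff h' h'' hE''] at H'
  rw [hE.cancels_iff h h'' hE'']
  intro x
  simp [H, H']

theorem Cancels.refl {i : L →ₗ[k] M} {π : M →ₗ[k] N} (h : IsShortExact i π)
    [Module.Free k N] [Module.Finite k N] [Module.Free k L] [Module.Finite k L] :
    Cancels i π i π (LinearEquiv.refl k _) (LinearEquiv.refl k _) := by
  obtain ⟨E, hE⟩ := exists_isExt h (Module.finBasis k L)
  rw [hE.cancels_iff h h hE]
  intro x
  rfl

theorem Cancels.existsUnique_right {i : L →ₗ[k] M} {π : M →ₗ[k] N} {i' : L →ₗ[k] M'}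
    {π' : M' →ₗ[k] N'} (h : IsShortExact i π) (h' : IsShortExact i' π')
    [Module.Free k N] [Module.Finite k N] [Module.Free k N'] [Module.Finite k N']
    [Module.Free k L] [Module.Finite k L] (α : DetModule k M ≃ₗ[k] DetModule k M') :
    ∃! β : DetModule k N ≃ₗ[k] DetModule k N', Cancels i π i' π' α β := by
  obtain ⟨E, hE⟩ := exists_isExt h (Module.finBasis k L)
  obtain ⟨E', hE'⟩ := exists_isExt h' (Module.finBasis k L)
  refine ⟨(E.trans α).trans E'.symm, ?_, fun β hβ => ?_⟩
  · simp only [hE.cancels_iff h h' hE']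
    intro x
    simp
  · replace hβ := (hE.cancels_iff h h' hE').1 hβ
    ext1 x
    simp [hβ]

theorem Cancels.existsUnique_left {i : L →ₗ[k] M} {π : M →ₗ[k] N} {i' : L →ₗ[k] M'}
    {π' : M' →ₗ[k] N'} (h : IsShortExact i π) (h' : IsShortExact i' π')
    [Module.Free k N] [Module.Finite k N] [Module.Free k N'] [Module.Finite k N']
    [Module.Free k L] [Module.Finite k L] (β : DetModule k N ≃ₗ[k] DetModule k N') :
    ∃! α : DetModule k M ≃ₗ[k] DetModule k M', Cancels i π i' π' α β := by
  obtain ⟨E, hE⟩ := exists_isExt h (Module.finBasis k L)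
  obtain ⟨E', hE'⟩ := exists_isExt h' (Module.finBasis k L)
  refine ⟨(E.symm.trans β).trans E', ?_, fun α hα => ?_⟩
  · simp only [hE.cancels_iff h h' hE']
    intro x
    simp
  · replace hα := (hE.cancels_iff h h' hE').1 hα
    apply LinearEquiv.ext
    intro x
    obtain ⟨y, rfl⟩ := E.surjective x
    simp [hα]

theorem Cancels.smul {i : L →ₗ[k] M} {π : M →ₗ[k] N} {i' : L →ₗ[k] M'} {π' : M' →ₗ[k] N'}
    {α : DetModule k M ≃ₗ[k] DetModule k M'} {β : DetModule k N ≃ₗ[k] DetModule k N'}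
    (H : Cancels i π i' π' α β) (x : kˣ) : Cancels i π i' π' (x • α) (x • β) := by
  intro r n n' p a b e e' he he'
  obtain ⟨c, hc, hc'⟩ := H r n n' p a b e e' he he'
  refine ⟨x * c, ?_, ?_⟩
  · simp [hc, mul_smul]
  · simp [hc', mul_smul]

/-- The isomorphism `⋀ⁿ M ≅ ⋀ⁿ N` induced by an isomorphism `M ≅ N`. -/
noncomputable def powCongr (n : ℕ) (f : M ≃ₗ[k] N) : (⋀[k]^n M) ≃ₗ[k] (⋀[k]^n N) :=
  LinearEquiv.ofLinearMap (exteriorPower.map n f.toLinearMap)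
    (exteriorPower.map n f.symm.toLinearMap)
    (by rw [← exteriorPower.map_comp]; simp) (by rw [← exteriorPower.map_comp]; simp)

/-- The isomorphism `det M ≅ det N` induced by an isomorphism `M ≅ N`. -/
noncomputable def detCongr (f : M ≃ₗ[k] N) : DetModule k M ≃ₗ[k] DetModule k N :=
  (powCongr (Module.finrank k M) f).trans
    (LinearEquiv.ofEq (⋀[k]^(Module.finrank k M) N) (⋀[k]^(Module.finrank k N) N)
      (by rw [f.finrank_eq]))

theorem detCongr_coe (f : M ≃ₗ[k] N) (x : DetModule k M) :
    (detCongr f x : ExteriorAlgebra k N) =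
      (exteriorPower.map (Module.finrank k M) f.toLinearMap x : ⋀[k]^(Module.finrank k M) N) :=
  rfl

theorem detCongr_wedge (f : M ≃ₗ[k] N) {n : ℕ} (e : Basis (Fin n) k M) :
    detCongr f (wedge e) = wedge (e.map f) := by
  have key : ∀ (m m' : ℕ) (h : m = m') (v : Fin m' → N),
      ExteriorAlgebra.ιMulti k m (fun i => v (Fin.cast h i)) = ExteriorAlgebra.ιMulti k m' v := by
    rintro m m' rfl v
    rfl
  have hn : n = Module.finrank k M := by simp [Module.finrank_eq_card_basis e]
  subst hn
  ext
  rw [detCongr_coe]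
  simp only [wedge, exteriorPower.map_apply_ιMulti, exteriorPower.ιMulti_apply_coe]
  rw [← key _ _ f.finrank_eq]
  rfl

/-- Transport of an isomorphism of determinants along isomorphisms of modules. -/
noncomputable def conj (f : M ≃ₗ[k] N) (g : M' ≃ₗ[k] N') (α : DetModule k M ≃ₗ[k] DetModule k M') :
    DetModule k N ≃ₗ[k] DetModule k N' :=
  (detCongr f).symm.trans (α.trans (detCongr g))

theorem IsExt.comp {L₁ L₂ L₃ T : Type*} [AddCommGroup L₁] [Module k L₁] [AddCommGroup L₂]
    [Module k L₂] [AddCommGroup L₃] [Module k L₃] [AddCommGroup T] [Module k T]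
    {i₁ : L₁ →ₗ[k] M} {π₁ : M →ₗ[k] N} {i₂ : L₂ →ₗ[k] M} {π₂ : M →ₗ[k] T}
    {i₃ : L₃ →ₗ[k] N} {π₃ : N →ₗ[k] T} {j : L₁ →ₗ[k] L₂} {ρ : L₂ →ₗ[k] L₃}
    (h₃ : IsShortExact i₃ π₃)
    (h12 : ∀ x, i₂ (j x) = i₁ x) (h23 : ∀ x, π₁ (i₂ x) = i₃ (ρ x)) (h13 : ∀ x, π₃ (π₁ x) = π₂ x)
    {l r : ℕ} {q : Basis (Fin l) k L₁} {p : Basis (Fin r) k L₃} {s : Basis (Fin (l + r)) k L₂}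
    (hs : IsAdapted j ρ q p s) [Module.Free k T] [Module.Finite k T]
    {E₁ : DetModule k N ≃ₗ[k] DetModule k M} {E₃ : DetModule k T ≃ₗ[k] DetModule k N}
    (hE₁ : IsExt i₁ π₁ q E₁) (hE₃ : IsExt i₃ π₃ p E₃) :
    IsExt i₂ π₂ s (E₃.trans E₁) := by
  intro n a f hf
  obtain ⟨e, he, he'⟩ := exists_adapted h₃ p a (fun x => π₁ (f (Fin.natAdd (l + r) x)))
    (fun x => by rw [h13, hf.right])
  rw [LinearEquiv.trans_apply, hE₃ _ _ _ he, ← wedge_cast (Nat.add_assoc l r n) f]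
  refine hE₁ _ _ _ ⟨fun x => ?_, fun x => ?_⟩
  · rw [← h12, ← hs.left, ← hf.left]
    simp only [Basis.reindex_apply]
    rfl
  · refine Fin.addCases (fun x => ?_) (fun x => ?_) x
    · rw [he.left, ← hs.right, ← h23, ← hf.left]
      simp only [Basis.reindex_apply]
      rfl
    · rw [he']
      simp only [Basis.reindex_apply]
      congr 2
      ext
      simp [Nat.add_assoc]

theorem Cancels.conj {L₁ M₁ N₁ M₁' N₁' : Type*} [AddCommGroup L₁] [Module k L₁] [AddCommGroup M₁]
    [Module k M₁] [AddCommGroup N₁] [Module k N₁] [AddCommGroup M₁'] [Module k M₁']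
    [AddCommGroup N₁'] [Module k N₁']
    {i : L →ₗ[k] M} {π : M →ₗ[k] N} {i' : L →ₗ[k] M'} {π' : M' →ₗ[k] N'}
    {i₁ : L₁ →ₗ[k] M₁} {π₁ : M₁ →ₗ[k] N₁} {i₁' : L₁ →ₗ[k] M₁'} {π₁' : M₁' →ₗ[k] N₁'}
    (fL : L ≃ₗ[k] L₁) (fM : M ≃ₗ[k] M₁) (fN : N ≃ₗ[k] N₁) (fM' : M' ≃ₗ[k] M₁')
    (fN' : N' ≃ₗ[k] N₁')
    (hi : ∀ x, i₁ (fL x) = fM (i x)) (hπ : ∀ x, π₁ (fM x) = fN (π x))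
    (hi' : ∀ x, i₁' (fL x) = fM' (i' x)) (hπ' : ∀ x, π₁' (fM' x) = fN' (π' x))
    {α : DetModule k M ≃ₗ[k] DetModule k M'} {β : DetModule k N ≃ₗ[k] DetModule k N'}
    (H : Cancels i π i' π' α β) :
    Cancels i₁ π₁ i₁' π₁' (CommDet.conj fM fM' α) (CommDet.conj fN fN' β) := by
  intro r n n' p a b e e' he he'
  have h1 : IsAdapted i π (p.map fL.symm) (a.map fN.symm) (e.map fM.symm) :=
    he.map fL.symm fM.symm fN.symm
      (fun x => fM.injective (by rw [← hi]; simp)) (fun x => fN.injective (by rw [← hπ]; simp))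
  have h2 : IsAdapted i' π' (p.map fL.symm) (b.map fN'.symm) (e'.map fM'.symm) :=
    he'.map fL.symm fM'.symm fN'.symm
      (fun x => fM'.injective (by rw [← hi']; simp))
      (fun x => fN'.injective (by rw [← hπ']; simp))
  obtain ⟨c, hc, hc'⟩ := H _ _ _ _ _ _ _ _ h1 h2
  refine ⟨c, ?_, ?_⟩
  · simp only [CommDet.conj, LinearEquiv.trans_apply]
    rw [(LinearEquiv.symm_apply_eq (detCongr fM) (x := wedge e) (y := wedge (e.map fM.symm))).2]
    · rw [hc, map_smul, detCongr_wedge]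
      congr 2
      ext
      simp
    · rw [detCongr_wedge]
      congr 1
      ext
      simp
  · simp only [CommDet.conj, LinearEquiv.trans_apply]
    rw [(LinearEquiv.symm_apply_eq (detCongr fN) (x := wedge a) (y := wedge (a.map fN.symm))).2]
    · rw [hc', map_smul, detCongr_wedge]
      congr 2
      ext
      simp
    · rw [detCongr_wedge]
      congr 1
      ext
      simp

end Cancellation

section Commensurability

variable {k : Type*} [CommRing k] {V : Type*} [AddCommGroup V] [Module k V]

/-- The quotient `A / P` of submodules `P ≤ A` of `V` (in general, `A / (P ∩ A)`). -/
abbrev RelQuot (A P : Submodule k V) : Type _ := ↥A ⧸ P.submoduleOf A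

theorem mem_submoduleOf {A P : Submodule k V} {x : A} : x ∈ P.submoduleOf A ↔ (x : V) ∈ P :=
  Iff.rfl

theorem relIncl_le {P A : Submodule k V} (h : P ≤ A) (Q : Submodule k V) :
    Q.submoduleOf P ≤ (Q.submoduleOf A).comap (Submodule.inclusion h) :=
  fun _ hx => hx

theorem relProj_le {Q P : Submodule k V} (h : Q ≤ P) (A : Submodule k V) :
    Q.submoduleOf A ≤ (P.submoduleOf A).comap LinearMap.id :=
  fun _ hx => h hx

/-- The inclusion `P / Q → A / Q`, for `Q ≤ P ≤ A`. -/
def relIncl {P A : Submodule k V} (h : P ≤ A) (Q : Submodule k V) : RelQuot P Q →ₗ[k] RelQuot A Q :=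
  Submodule.mapQ _ _ (Submodule.inclusion h) (relIncl_le h Q)

/-- The projection `A / Q → A / P`, for `Q ≤ P ≤ A`. -/
def relProj {Q P : Submodule k V} (h : Q ≤ P) (A : Submodule k V) : RelQuot A Q →ₗ[k] RelQuot A P :=
  Submodule.mapQ _ _ LinearMap.id (relProj_le h A)

theorem relIncl_mk {P A : Submodule k V} (h : P ≤ A) (Q : Submodule k V) (x : P) :
    relIncl h Q (Submodule.Quotient.mk x) = Submodule.Quotient.mk (Submodule.inclusion h x) :=
  rfl

theorem relProj_mk {Q P : Submodule k V} (h : Q ≤ P) (A : Submodule k V) (x : A) :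
    relProj h A (Submodule.Quotient.mk x) = Submodule.Quotient.mk x :=
  rfl

/-- Commensurability of submodules: `(A + B) / (A ∩ B)` is finitely generated. -/
def Commensurable (A B : Submodule k V) : Prop :=
  Module.Finite k (RelQuot (A ⊔ B) (A ⊓ B))

/-- `P` is a free submodule of `A` such that `A / P` is free of finite rank. -/
structure IsCofree (P A : Submodule k V) : Prop where
  le : P ≤ A
  free : Module.Free k P
  quot_free : Module.Free k (RelQuot A P)
  quot_finite : Module.Finite k (RelQuot A P)

theorem isShortExact_rel {Q P A : Submodule k V} (hQP : Q ≤ P) (hPA : P ≤ A) :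
    IsShortExact (relIncl hPA Q) (relProj hQP A) where
  inj := by
    rw [injective_iff_map_eq_zero]
    intro x hx
    obtain ⟨x, rfl⟩ := Submodule.Quotient.mk_surjective _ x
    rw [relIncl_mk, Submodule.Quotient.mk_eq_zero] at hx
    rw [Submodule.Quotient.mk_eq_zero]
    exact hx
  exact := by
    intro x
    obtain ⟨x, rfl⟩ := Submodule.Quotient.mk_surjective _ x
    constructor
    · intro hx
      rw [relProj_mk, Submodule.Quotient.mk_eq_zero, mem_submoduleOf] at hx
      exact ⟨Submodule.Quotient.mk ⟨x, hx⟩, rfl⟩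
    · rintro ⟨y, hy⟩
      obtain ⟨y, rfl⟩ := Submodule.Quotient.mk_surjective _ y
      rw [← hy, relIncl_mk, relProj_mk, Submodule.Quotient.mk_eq_zero, mem_submoduleOf]
      exact y.2
  surj := by
    intro x
    obtain ⟨x, rfl⟩ := Submodule.Quotient.mk_surjective _ x
    exact ⟨Submodule.Quotient.mk x, rfl⟩

theorem relQuot_finite_iff [IsNoetherianRing k] (A P : Submodule k V) :
    Module.Finite k (RelQuot A P) ↔ ∃ F : Submodule k V, F.FG ∧ A ≤ P ⊔ F := by
  constructor
  · intro h
    obtain ⟨s, hs⟩ := h.fg_top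
    refine ⟨(Submodule.span k (Quotient.out '' (s : Set (RelQuot A P)))).map A.subtype, ?_, ?_⟩
    · exact (Submodule.fg_span (s.finite_toSet.image _)).map _
    · intro x hx
      have h1 : (Submodule.span k (Quotient.out '' (s : Set (RelQuot A P)))).map
          (P.submoduleOf A).mkQ = ⊤ := by
        rw [Submodule.map_span, ← hs, Set.image_image]
        congr 1
        convert! Set.image_id _
        simp
      have h2 : (P.submoduleOf A).mkQ ⟨x, hx⟩ ∈ (⊤ : Submodule k (RelQuot A P)) := trivial
      rw [← h1] at h2
      obtain ⟨y, hy, hxy⟩ := h2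
      rw [Submodule.mkQ_apply, Submodule.mkQ_apply, Submodule.Quotient.eq] at hxy
      have h3 : (y : V) - x ∈ P := hxy
      rw [Submodule.mem_sup]
      exact ⟨-((y : V) - x), neg_mem h3, y, ⟨y, hy, rfl⟩, by abel⟩
  · rintro ⟨F, hF, hA⟩
    have h1 : (F.map P.mkQ).FG := hF.map _
    have h2 : IsNoetherian k (F.map P.mkQ) := isNoetherian_of_fg_of_noetherian _ h1
    let f : A →ₗ[k] F.map P.mkQ := LinearMap.codRestrict _ (P.mkQ ∘ₗ A.subtype) (by
      rintro ⟨x, hx⟩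
      obtain ⟨p, hp, y, hy, rfl⟩ := Submodule.mem_sup.1 (hA hx)
      refine ⟨y, hy, ?_⟩
      simp [(Submodule.Quotient.mk_eq_zero P).2 hp])
    have hf : LinearMap.ker f = P.submoduleOf A := by
      ext x
      simp [f, LinearMap.ker_codRestrict, mem_submoduleOf]
    let g : RelQuot A P →ₗ[k] F.map P.mkQ := (P.submoduleOf A).liftQ f hf.ge
    have hg : Function.Injective g := by
      rw [← LinearMap.ker_eq_bot]
      exact Submodule.ker_liftQ_eq_bot _ _ _ hf.le
    exact Module.Finite.of_injective g hg

theorem commensurable_iff [IsNoetherianRing k] (A B : Submodule k V) :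
    Commensurable A B ↔ (∃ F : Submodule k V, F.FG ∧ A ≤ B ⊔ F) ∧
      ∃ F : Submodule k V, F.FG ∧ B ≤ A ⊔ F := by
  unfold Commensurable
  constructor
  · rw [relQuot_finite_iff]
    rintro ⟨F, hF, h⟩
    exact ⟨⟨F, hF, le_sup_left.trans (h.trans (sup_le_sup_right inf_le_right F))⟩,
      ⟨F, hF, le_sup_right.trans (h.trans (sup_le_sup_right inf_le_left F))⟩⟩
  · rintro ⟨h1, h2⟩
    have key : ∀ C D : Submodule k V, (∃ F : Submodule k V, F.FG ∧ C ≤ D ⊔ F) →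
        ∃ F : Submodule k V, F.FG ∧ C ≤ C ⊓ D ⊔ F := by
      intro C D h
      rw [← relQuot_finite_iff] at h ⊢
      have : (C ⊓ D).submoduleOf C = D.submoduleOf C := by
        ext x
        simp [mem_submoduleOf]
      unfold RelQuot
      rw [this]
      exact h
    obtain ⟨F, hF, h⟩ := key A B h1
    obtain ⟨F', hF', h'⟩ := key B A h2
    rw [relQuot_finite_iff]
    refine ⟨F ⊔ F', hF.sup hF', sup_le ?_ ?_⟩
    · exact h.trans (sup_le_sup_left le_sup_left _)
    · rw [inf_comm] at h'
      exact h'.trans (sup_le_sup_left le_sup_right _)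

theorem Commensurable.refl (A : Submodule k V) [IsNoetherianRing k] : Commensurable A A :=
  (commensurable_iff A A).2 ⟨⟨⊥, Submodule.fg_bot, by simp⟩, ⟨⊥, Submodule.fg_bot, by simp⟩⟩

theorem Commensurable.symm [IsNoetherianRing k] {A B : Submodule k V} (h : Commensurable A B) :
    Commensurable B A :=
  (commensurable_iff B A).2 ((commensurable_iff A B).1 h).symm

theorem Commensurable.trans [IsNoetherianRing k] {A B C : Submodule k V} (h : Commensurable A B)
    (h' : Commensurable B C) : Commensurable A C := by
  have key : ∀ {A B C : Submodule k V}, (∃ F : Submodule k V, F.FG ∧ A ≤ B ⊔ F) →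
      (∃ F : Submodule k V, F.FG ∧ B ≤ C ⊔ F) → ∃ F : Submodule k V, F.FG ∧ A ≤ C ⊔ F := by
    rintro A B C ⟨F, hF, h⟩ ⟨F', hF', h'⟩
    refine ⟨F' ⊔ F, hF'.sup hF, h.trans ?_⟩
    rw [← sup_assoc]
    exact sup_le_sup_right h' _
  rw [commensurable_iff] at *
  exact ⟨key h.1 h'.1, key h'.2 h.2⟩

theorem Commensurable.map [IsNoetherianRing k] {A B : Submodule k V} (h : Commensurable A B)
    (σ : V ≃ₗ[k] V) :
    Commensurable (A.map σ.toLinearMap) (B.map σ.toLinearMap) := by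
  have key : ∀ {A B : Submodule k V}, (∃ F : Submodule k V, F.FG ∧ A ≤ B ⊔ F) →
      (∃ F : Submodule k V, F.FG ∧ A.map σ.toLinearMap ≤ B.map σ.toLinearMap ⊔ F) := by
    rintro A B ⟨F, hF, h⟩
    refine ⟨F.map σ.toLinearMap, hF.map _, ?_⟩
    rw [← Submodule.map_sup]
    exact Submodule.map_mono h
  rw [commensurable_iff] at *
  exact ⟨key h.1, key h.2⟩

theorem IsCofree.commensurable [IsNoetherianRing k] {P A : Submodule k V} (h : IsCofree P A) :
    Commensurable P A := by
  rw [commensurable_iff]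
  refine ⟨⟨⊥, Submodule.fg_bot, by simpa using h.le⟩, ?_⟩
  rw [← relQuot_finite_iff]
  exact h.quot_finite

theorem IsCofree.trans [Nontrivial k] {R P A : Submodule k V} (h : IsCofree R P)
    (h' : IsCofree P A) : IsCofree R A := by
  have := h.quot_free
  have := h.quot_finite
  have := h'.quot_free
  have := h'.quot_finite
  obtain ⟨e, -⟩ := exists_adapted' (isShortExact_rel h.le h'.le)
    (Module.finBasis k (RelQuot P R)) (Module.finBasis k (RelQuot A P))
  exact ⟨h.le.trans h'.le, h.free, Module.Free.of_basis e, Module.Finite.of_basis e⟩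

/-- A linear map from a free module to a finitely generated module over a noetherian ring kills a
free submodule with free quotient of finite rank. -/
theorem exists_cofree_ker [IsNoetherianRing k] {W M : Type*} [AddCommGroup W] [Module k W]
    [Module.Free k W] [AddCommGroup M] [Module k M] [Module.Finite k M] (f : W →ₗ[k] M) :
    ∃ U : Submodule k W, U ≤ LinearMap.ker f ∧ Module.Free k U ∧ Module.Free k (W ⧸ U) ∧
      Module.Finite k (W ⧸ U) := by
  classical
  let I := Module.Free.ChooseBasisIndex k W
  let b : Basis I k W := Module.Free.chooseBasis k W
  have hfg : (Submodule.span k (Set.range fun i => f (b i))).FG := IsNoetherian.noetherian _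
  obtain ⟨s, hs, hspan⟩ := (Submodule.fg_span_iff_fg_span_finset_subset _).1 hfg
  choose g hg using fun x (hx : x ∈ (s : Set M)) => hs hx
  let J : Finset I := s.attach.image fun x => g x.1 x.2
  have hJ : ∀ i, f (b i) ∈ Submodule.span k (Set.range fun j : J => f (b j)) := by
    intro i
    have h1 : f (b i) ∈ Submodule.span k (Set.range fun i => f (b i)) :=
      Submodule.subset_span ⟨i, rfl⟩
    rw [hspan] at h1
    refine Submodule.span_mono ?_ h1
    intro x hx
    exact ⟨⟨g x hx, Finset.mem_image.2 ⟨⟨x, hx⟩, Finset.mem_attach _ _, rfl⟩⟩, hg x hx⟩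
  have hc : ∀ i, ∃ c : J → k, ∑ j, c j • f (b j) = f (b i) := by
    intro i
    exact (Submodule.mem_span_range_iff_exists_fun k).1 (hJ i)
  choose c hc using hc
  let ρ : W →ₗ[k] (J → k) :=
    b.constr k fun i => if h : i ∈ J then Pi.single ⟨i, h⟩ 1 else c i
  let F : (J → k) →ₗ[k] M := Fintype.linearCombination k (fun j : J => f (b j))
  let S : (J → k) →ₗ[k] W := Fintype.linearCombination k (fun j : J => b j)
  have hρJ : ∀ j : J, ρ (b j) = Pi.single j 1 := by
    intro j
    simp [ρ, b.constr_basis]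
  have hρS : ∀ y, ρ (S y) = y := by
    intro y
    simp only [S, Fintype.linearCombination_apply, map_sum, map_smul, hρJ]
    ext j
    simp [Finset.sum_apply, Pi.single_apply]
  have hF : f = F ∘ₗ ρ := by
    refine b.ext fun i => ?_
    by_cases h : i ∈ J
    · have := hρJ ⟨i, h⟩
      simp only at this
      simp [F, this, Fintype.linearCombination_apply, Pi.single_apply]
    · simp [F, ρ, b.constr_basis, h, Fintype.linearCombination_apply]
      exact (hc i).symm
  have hsurj : Function.Surjective ρ := fun y => ⟨S y, hρS y⟩
  let e : (W ⧸ LinearMap.ker ρ) ≃ₗ[k] (J → k) := ρ.quotKerEquivOfSurjective hsurj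
  refine ⟨LinearMap.ker ρ, ?_, ?_, Module.Free.of_equiv e.symm, Module.Finite.equiv e.symm⟩
  · intro x hx
    rw [LinearMap.mem_ker] at hx ⊢
    rw [hF, LinearMap.comp_apply, hx, map_zero]
  · let T : LinearMap.ker ρ →ₗ[k] ({i // i ∉ J} →₀ k) :=
      Finsupp.lsubtypeDomain {i | i ∉ J} ∘ₗ b.repr.toLinearMap ∘ₗ (LinearMap.ker ρ).subtype
    have hT : ∀ (x : LinearMap.ker ρ) (i : {i // i ∉ J}), T x i = b.repr x i := fun _ _ => rfl
    have hSJ : ∀ (y : J → k) (i : I), i ∉ J → b.repr (S y) i = 0 := by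
      intro y i hi
      simp only [S, Fintype.linearCombination_apply, map_sum, map_smul, Basis.repr_self,
        Finsupp.coe_finsetSum, Finset.sum_apply, Finsupp.smul_apply]
      refine Finset.sum_eq_zero fun j _ => ?_
      rw [Finsupp.single_eq_of_ne, smul_zero]
      rintro rfl
      exact hi j.2
    have hbij : Function.Bijective T := by
      constructor
      · rw [injective_iff_map_eq_zero]
        intro x hx
        have h0 : ∀ i, i ∉ J → b.repr x i = 0 := by
          intro i hi
          rw [← hT x ⟨i, hi⟩, hx]
          rfl
        have h1 : (x : W) = S (fun j => b.repr x j) := by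
          apply b.repr.injective
          ext i
          by_cases hi : i ∈ J
          · simp only [S, Fintype.linearCombination_apply, map_sum, map_smul, Basis.repr_self,
              Finsupp.coe_finsetSum, Finset.sum_apply, Finsupp.smul_apply]
            rw [Finset.sum_eq_single (⟨i, hi⟩ : J)]
            · simp
            · intro j _ hj
              rw [Finsupp.single_eq_of_ne, smul_zero]
              rintro rfl
              exact hj rfl
            · simp
          · rw [h0 i hi, hSJ _ i hi]
        have h2 : (fun j : J => b.repr (x : W) j) = 0 := by
          rw [← hρS (fun j : J => b.repr (x : W) j), ← h1]
          exact x.2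
        ext
        rw [h1, h2, map_zero]
        rfl
      · intro y
        let x₀ : W := b.repr.symm (Finsupp.embDomain (Function.Embedding.subtype _) y)
        refine ⟨⟨x₀ - S (ρ x₀), ?_⟩, ?_⟩
        · rw [LinearMap.mem_ker, map_sub, hρS, sub_self]
        · ext i
          rw [hT]
          simp only [map_sub, Finsupp.sub_apply, hSJ _ _ i.2, sub_zero, x₀,
            LinearEquiv.apply_symm_apply]
          exact Finsupp.embDomain_apply_self (Function.Embedding.subtype _) y i
    exact Module.Free.of_equiv (LinearEquiv.ofBijective T hbij).symm

theorem exists_socle (k : Type*) [CommRing k] [IsArtinianRing k] [IsLocalRing k] :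
    ∃ t : k, t ≠ 0 ∧ ∀ x ∈ IsLocalRing.maximalIdeal k, t * x = 0 := by
  classical
  have h : ∃ n, IsLocalRing.maximalIdeal k ^ n = ⊥ := by
    rw [← IsLocalRing.jacobson_eq_maximalIdeal (⊥ : Ideal k) bot_ne_top]
    exact IsArtinianRing.isNilpotent_jacobson_bot
  have hn := Nat.find_spec h
  obtain ⟨n, hn'⟩ : ∃ n, Nat.find h = n + 1 := by
    refine Nat.exists_eq_succ_of_ne_zero fun h0 => ?_
    rw [h0, pow_zero, Ideal.one_eq_top] at hn
    exact top_ne_bot hn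
  have hlt : IsLocalRing.maximalIdeal k ^ n ≠ ⊥ := Nat.find_min h (by omega)
  obtain ⟨t, ht, ht0⟩ := Submodule.exists_mem_ne_zero_of_ne_bot hlt
  refine ⟨t, ht0, fun x hx => ?_⟩
  have : t * x ∈ IsLocalRing.maximalIdeal k ^ (n + 1) := by
    rw [pow_succ]
    exact Ideal.mul_mem_mul ht hx
  rw [← hn', hn] at this
  simpa using this

/-- A free submodule `P` satisfies `P ∩ m W = m P`. -/
theorem mem_smul_top_of_free [IsArtinianRing k] [IsLocalRing k] (P : Submodule k V)
    [Module.Free k P] (x : P)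
    (hx : (x : V) ∈ IsLocalRing.maximalIdeal k • (⊤ : Submodule k V)) :
    x ∈ IsLocalRing.maximalIdeal k • (⊤ : Submodule k P) := by
  obtain ⟨t, ht0, ht⟩ := exists_socle k
  have h1 : ∀ y ∈ IsLocalRing.maximalIdeal k • (⊤ : Submodule k V), t • y = 0 := by
    intro y hy
    refine Submodule.smul_induction_on hy (fun r hr n _ => ?_) (fun y z hy hz => ?_)
    · rw [smul_smul, ht r hr, zero_smul]
    · rw [smul_add, hy, hz, add_zero]
  have h2 : t • x = 0 := Subtype.ext (h1 _ hx)
  let b := Module.Free.chooseBasis k P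
  have h3 : ∀ i, b.repr x i ∈ IsLocalRing.maximalIdeal k := by
    intro i
    by_contra hi
    have hu : IsUnit (b.repr x i) := by simpa using hi
    have h4 : t * b.repr x i = 0 := by
      have := congrArg (fun z => b.repr z i) h2
      simpa using this
    exact ht0 ((hu.mul_left_eq_zero).1 h4)
  rw [← b.linearCombination_repr x, Finsupp.linearCombination_apply]
  exact Submodule.sum_mem _ fun i _ => Submodule.smul_mem_smul (h3 i) trivial

/-- A finitely generated quotient of a free module by a free submodule is free. -/
theorem free_quot_of_finite [IsArtinianRing k] [IsLocalRing k] [Module.Free k V]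
    (P : Submodule k V) [Module.Free k P] [Module.Finite k (V ⧸ P)] : Module.Free k (V ⧸ P) := by
  obtain ⟨U, hU, -, hU1, hU2⟩ := exists_cofree_ker P.mkQ
  rw [Submodule.ker_mkQ] at hU
  let W : Submodule k (V ⧸ U) := P.map U.mkQ
  let g : (V ⧸ U) →ₗ[k] (V ⧸ P) := Submodule.factor hU
  have hg : Function.Surjective g := Submodule.factor_surjective hU
  have hex : Function.Exact W.subtype g := by
    intro y
    obtain ⟨y, rfl⟩ := Submodule.Quotient.mk_surjective _ y
    change (Submodule.Quotient.mk y : V ⧸ P) = 0 ↔ _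
    rw [Submodule.Quotient.mk_eq_zero]
    constructor
    · intro hy
      exact ⟨⟨_, ⟨y, hy, rfl⟩⟩, rfl⟩
    · rintro ⟨⟨_, z, hz, rfl⟩, h⟩
      have h1 : (Submodule.Quotient.mk z : V ⧸ U) = Submodule.Quotient.mk y := h
      rw [Submodule.Quotient.eq] at h1
      have h2 := sub_mem hz (hU h1)
      simpa using h2
  have hW : ∀ w : W, (w : V ⧸ U) ∈ IsLocalRing.maximalIdeal k • (⊤ : Submodule k (V ⧸ U)) →
      w ∈ IsLocalRing.maximalIdeal k • (⊤ : Submodule k W) := by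
    rintro ⟨_, z, hz, rfl⟩ hw
    have h1 : IsLocalRing.maximalIdeal k • (⊤ : Submodule k (V ⧸ U)) =
        (IsLocalRing.maximalIdeal k • (⊤ : Submodule k V)).map U.mkQ := by
      rw [Submodule.map_smul'', Submodule.map_top, Submodule.range_mkQ]
    simp only at hw
    rw [h1] at hw
    obtain ⟨y, hy, hyz⟩ := hw
    rw [Submodule.mkQ_apply, Submodule.mkQ_apply, Submodule.Quotient.eq] at hyz
    have hyP : y ∈ P := by
      have := add_mem (hU hyz) hz
      simpa using this
    have h2 := mem_smul_top_of_free P ⟨y, hyP⟩ hy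
    let q : P →ₗ[k] W := U.mkQ.submoduleMap P
    have h3 : q ⟨y, hyP⟩ ∈ (IsLocalRing.maximalIdeal k • (⊤ : Submodule k P)).map q :=
      Submodule.mem_map_of_mem h2
    rw [Submodule.map_smul''] at h3
    have h4 := Submodule.smul_mono (le_refl (IsLocalRing.maximalIdeal k))
      (le_top : (⊤ : Submodule k P).map q ≤ ⊤) h3
    convert h4 using 1
    apply Subtype.ext
    exact ((Submodule.Quotient.eq U).2 hyz).symm
  refine Module.free_of_lTensor_residueField_injective W.subtype g hg hex ?_
  rw [injective_iff_map_eq_zero]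
  intro x hx
  obtain ⟨w, rfl⟩ := TensorProduct.mk_surjective k W (IsLocalRing.ResidueField k)
    Ideal.Quotient.mk_surjective x
  have h1 : TensorProduct.mk k (IsLocalRing.ResidueField k) (V ⧸ U) 1 (w : V ⧸ U) = 0 := hx
  rw [← LinearMap.mem_ker] at h1 ⊢
  erw [LinearMap.ker_tensorProductMk] at h1 ⊢
  exact hW w h1

theorem exists_isCofree [IsArtinianRing k] [IsLocalRing k] {A B : Submodule k V}
    (hA : Module.Free k A) (hB : Module.Free k B) (h : Commensurable A B) :
    ∃ P : Submodule k V, IsCofree P A ∧ IsCofree P B := by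
  have hfin : Module.Finite k (RelQuot B A) :=
    (relQuot_finite_iff B A).2 ((commensurable_iff A B).1 h).2
  obtain ⟨U, hU, hU1, hU2, hU3⟩ := exists_cofree_ker (A.submoduleOf B).mkQ
  rw [Submodule.ker_mkQ] at hU
  have hPB : U.map B.subtype ≤ B := Submodule.map_subtype_le B U
  have hPA : U.map B.subtype ≤ A := by
    rintro _ ⟨x, hx, rfl⟩
    exact hU hx
  have hP : Module.Free k (U.map B.subtype) :=
    Module.Free.of_equiv (U.equivMapOfInjective B.subtype B.subtype_injective)
  have hUP : (U.map B.subtype).submoduleOf B = U :=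
    Submodule.comap_map_eq_of_injective B.subtype_injective U
  have hcB : IsCofree (U.map B.subtype) B := by
    refine ⟨hPB, hP, ?_, ?_⟩
    · unfold RelQuot
      rw [hUP]
      exact hU2
    · unfold RelQuot
      rw [hUP]
      exact hU3
  refine ⟨U.map B.subtype, ?_, hcB⟩
  have hfinA : Module.Finite k (RelQuot A (U.map B.subtype)) :=
    (relQuot_finite_iff _ _).2 ((commensurable_iff _ _).1 (hcB.commensurable.trans h.symm)).2
  have hfree : Module.Free k ((U.map B.subtype).submoduleOf A) :=
    Module.Free.of_equiv (Submodule.submoduleOfEquivOfLe hPA).symm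
  exact ⟨hPA, hP, free_quot_of_finite _, hfinA⟩

end Commensurability

section Groupoid

variable {k : Type*} [CommRing k] [IsArtinianRing k] [IsLocalRing k]
  {V : Type*} [AddCommGroup V] [Module k V]

/-- The free submodules `P ≤ A ∩ B` such that `A / P` and `B / P` are free of finite rank. -/
structure Index (A B : Submodule k V) where
  sub : Submodule k V
  left : IsCofree sub A
  right : IsCofree sub B

/-- The set `Det(A, B; P)` of isomorphisms `det (A / P) ≅ det (B / P)`. -/
abbrev DetAt (A B P : Submodule k V) : Type _ :=
  DetModule k (RelQuot A P) ≃ₗ[k] DetModule k (RelQuot B P)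

/-- `β ∈ Det(A, B; P)` is the image of `α ∈ Det(A, B; Q)` under the cancellation rule. -/
def CancelsTo {A B Q P : Submodule k V} (hQP : Q ≤ P) (hPA : P ≤ A) (hPB : P ≤ B)
    (α : DetAt A B Q) (β : DetAt A B P) : Prop :=
  Cancels (relIncl hPA Q) (relProj hQP A) (relIncl hPB Q) (relProj hQP B) α β

/-- The set `Det(A, B)`, the limit of the inverse system of the sets `Det(A, B; P)` with respect to
the cancellation rule. -/
@[ext]
structure Det (A B : Submodule k V) where
  app : ∀ P : Index A B, DetAt A B P.sub
  compat : ∀ (P Q : Index A B) (h : Q.sub ≤ P.sub),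
    CancelsTo h P.left.le P.right.le (app Q) (app P)

theorem IsCofree.of_le {Q P A : Submodule k V} (hQ : IsCofree Q A) (hP : IsCofree P A)
    (h : Q ≤ P) : IsCofree Q P := by
  have := hP.free
  have h1 : Module.Free k (Q.submoduleOf P) :=
    have := hQ.free
    Module.Free.of_equiv (Submodule.submoduleOfEquivOfLe h).symm
  have h2 : Module.Finite k (RelQuot P Q) :=
    (relQuot_finite_iff _ _).2
      ((commensurable_iff _ _).1 (hP.commensurable.trans hQ.commensurable.symm)).1
  exact ⟨h, hQ.free, free_quot_of_finite _, h2⟩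

theorem exists_common {A B P Q : Submodule k V} (h : Commensurable A B) (hP : IsCofree P A)
    (hQ : IsCofree Q B) : ∃ R, IsCofree R P ∧ IsCofree R Q :=
  exists_isCofree hP.free hQ.free
    ((hP.commensurable.trans h).trans hQ.commensurable.symm)

theorem CancelsTo.existsUnique_right {A B : Submodule k V} (P Q : Index A B) (h : Q.sub ≤ P.sub)
    (α : DetAt A B Q.sub) : ∃! β, CancelsTo h P.left.le P.right.le α β := by
  have h1 := Q.left.of_le P.left h
  have := h1.quot_free
  have := h1.quot_finite
  have := P.left.quot_free
  have := P.left.quot_finite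
  have := P.right.quot_free
  have := P.right.quot_finite
  exact Cancels.existsUnique_right (isShortExact_rel _ _) (isShortExact_rel _ _) α

theorem CancelsTo.existsUnique_left {A B : Submodule k V} (P Q : Index A B) (h : Q.sub ≤ P.sub)
    (β : DetAt A B P.sub) : ∃! α, CancelsTo h P.left.le P.right.le α β := by
  have h1 := Q.left.of_le P.left h
  have := h1.quot_free
  have := h1.quot_finite
  have := P.left.quot_free
  have := P.left.quot_finite
  have := P.right.quot_free
  have := P.right.quot_finite
  exact Cancels.existsUnique_left (isShortExact_rel _ _) (isShortExact_rel _ _) β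

theorem CancelsTo.tower {A B : Submodule k V} (P Q R : Index A B) (hQP : Q.sub ≤ P.sub)
    (hRQ : R.sub ≤ Q.sub) {α : DetAt A B R.sub} {β : DetAt A B Q.sub} {γ : DetAt A B P.sub}
    (h : CancelsTo hRQ Q.left.le Q.right.le α β) (h' : CancelsTo hQP P.left.le P.right.le β γ) :
    CancelsTo (hRQ.trans hQP) P.left.le P.right.le α γ := by
  have h1 := Q.left.of_le P.left hQP
  have h2 := R.left.of_le Q.left hRQ
  have h3 := R.left.of_le P.left (hRQ.trans hQP)
  have := h1.quot_free
  have := h1.quot_finite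
  have := h2.quot_free
  have := h2.quot_finite
  have := P.left.quot_free
  have := P.left.quot_finite
  have := P.right.quot_free
  have := P.right.quot_finite
  have := Q.left.quot_free
  have := Q.left.quot_finite
  have := Q.right.quot_free
  have := Q.right.quot_finite
  let q := Module.finBasis k (RelQuot Q.sub R.sub)
  let p := Module.finBasis k (RelQuot P.sub Q.sub)
  obtain ⟨s, hs⟩ := exists_adapted' (isShortExact_rel hRQ hQP) q p
  obtain ⟨E₁, hE₁⟩ := exists_isExt (isShortExact_rel hRQ Q.left.le) q
  obtain ⟨E₁', hE₁'⟩ := exists_isExt (isShortExact_rel hRQ Q.right.le) q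
  obtain ⟨E₃, hE₃⟩ := exists_isExt (isShortExact_rel hQP P.left.le) p
  obtain ⟨E₃', hE₃'⟩ := exists_isExt (isShortExact_rel hQP P.right.le) p
  have key : ∀ {C : Submodule k V} (hQC : Q.sub ≤ C) (hPC : P.sub ≤ C),
      (∀ x, relIncl hPC R.sub (relIncl hQP R.sub x) = relIncl hQC R.sub x) ∧
      (∀ x, relProj hRQ C (relIncl hPC R.sub x) = relIncl hPC Q.sub (relProj hRQ P.sub x)) ∧
      (∀ x, relProj hQP C (relProj hRQ C x) = relProj (hRQ.trans hQP) C x) := by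
    intro C hQC hPC
    refine ⟨fun x => ?_, fun x => ?_, fun x => ?_⟩ <;>
    · obtain ⟨x, rfl⟩ := Submodule.Quotient.mk_surjective _ x
      rfl
  obtain ⟨k1, k2, k3⟩ := key Q.left.le P.left.le
  obtain ⟨k1', k2', k3'⟩ := key Q.right.le P.right.le
  have hE := IsExt.comp (isShortExact_rel hQP P.left.le) k1 k2 k3 hs hE₁ hE₃
  have hE' := IsExt.comp (isShortExact_rel hQP P.right.le) k1' k2' k3' hs hE₁' hE₃'
  refine (hE.cancels_iff (isShortExact_rel _ _) (isShortExact_rel _ _) hE').2 fun x => ?_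
  have h4 := (hE₁.cancels_iff (isShortExact_rel _ _) (isShortExact_rel _ _) hE₁').1 h
  have h5 := (hE₃.cancels_iff (isShortExact_rel _ _) (isShortExact_rel _ _) hE₃').1 h'
  simp only [LinearEquiv.trans_apply]
  rw [h4, h5]

theorem Index.directed {A B : Submodule k V} (P Q : Index A B) :
    ∃ R : Index A B, R.sub ≤ P.sub ∧ R.sub ≤ Q.sub := by
  obtain ⟨R, h1, h2⟩ := exists_common (Commensurable.refl A) P.left Q.left
  exact ⟨⟨R, h1.trans P.left, h1.trans P.right⟩, h1.le, h2.le⟩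

theorem Det.eq_of_app {A B : Submodule k V} {α β : Det A B} (P : Index A B)
    (h : α.app P = β.app P) : α = β := by
  ext1
  funext Q
  obtain ⟨R, hP, hQ⟩ := P.directed Q
  have h1 : α.app R = β.app R := by
    refine (CancelsTo.existsUnique_left P R hP (α.app P)).unique (α.compat P R hP) ?_
    rw [h]
    exact β.compat P R hP
  refine (CancelsTo.existsUnique_right Q R hQ (α.app R)).unique (α.compat Q R hQ) ?_
  rw [h1]
  exact β.compat Q R hQ

theorem Det.exists_app {A B : Submodule k V} (P : Index A B) (α : DetAt A B P.sub) :
    ∃ D : Det A B, D.app P = α := by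
  have h1 : ∀ Q : Index A B, ∃ β : DetAt A B Q.sub, ∃ (R : Index A B) (hP : R.sub ≤ P.sub)
      (hQ : R.sub ≤ Q.sub) (γ : DetAt A B R.sub), CancelsTo hP P.left.le P.right.le γ α ∧
        CancelsTo hQ Q.left.le Q.right.le γ β := by
    intro Q
    obtain ⟨R, hP, hQ⟩ := P.directed Q
    obtain ⟨γ, hγ, -⟩ := CancelsTo.existsUnique_left P R hP α
    obtain ⟨β, hβ, -⟩ := CancelsTo.existsUnique_right Q R hQ γ
    exact ⟨β, R, hP, hQ, γ, hγ, hβ⟩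
  choose F hF using h1
  have h2 : ∀ (Q S : Index A B) (hP : S.sub ≤ P.sub) (hQ : S.sub ≤ Q.sub) (γ : DetAt A B S.sub),
      CancelsTo hP P.left.le P.right.le γ α → CancelsTo hQ Q.left.le Q.right.le γ (F Q) := by
    intro Q S hP hQ γ hγ
    obtain ⟨R, hRP, hRQ, δ, hδ, hδ'⟩ := hF Q
    obtain ⟨T, hTS, hTR⟩ := S.directed R
    obtain ⟨ε, hε, -⟩ := CancelsTo.existsUnique_left S T hTS γ
    obtain ⟨ε', hε', -⟩ := CancelsTo.existsUnique_left R T hTR δ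
    have h3 : ε = ε' := (CancelsTo.existsUnique_left P T (hTS.trans hP) α).unique
      (CancelsTo.tower P S T hP hTS hε hγ) (CancelsTo.tower P R T hRP hTR hε' hδ)
    subst h3
    obtain ⟨ζ, hζ, -⟩ := CancelsTo.existsUnique_right Q S hQ γ
    have h4 : ζ = F Q := (CancelsTo.existsUnique_right Q T (hTS.trans hQ) ε).unique
      (CancelsTo.tower Q S T hQ hTS hε hζ) (CancelsTo.tower Q R T hRQ hTR hε' hδ')
    rw [← h4]
    exact hζ
  refine ⟨⟨F, fun Q S h => ?_⟩, ?_⟩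
  · obtain ⟨R, hRP, hRS, γ, hγ, hγ'⟩ := hF S
    have h3 := h2 Q R hRP (hRS.trans h) γ hγ
    obtain ⟨ζ, hζ, -⟩ := CancelsTo.existsUnique_right Q S h (F S)
    have h4 : ζ = F Q := (CancelsTo.existsUnique_right Q R (hRS.trans h) γ).unique
      (CancelsTo.tower Q S R h hRS hγ' hζ) h3
    rw [← h4]
    exact hζ
  · obtain ⟨R, hRP, hRP', γ, hγ, hγ'⟩ := hF P
    exact (CancelsTo.existsUnique_right P R hRP γ).unique hγ' hγ

/-- The identity of `A` in `Det(A, A)`. -/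
noncomputable def Det.id (A : Submodule k V) : Det A A where
  app _ := LinearEquiv.refl k _
  compat P Q h := by
    have h1 := Q.left.of_le P.left h
    have := h1.quot_free
    have := h1.quot_finite
    have := P.left.quot_free
    have := P.left.quot_finite
    exact Cancels.refl (isShortExact_rel _ _)

/-- Scalar multiplication on `Det(A, B)`. -/
noncomputable instance {A B : Submodule k V} : SMul kˣ (Det A B) where
  smul x α :=
    { app := fun P => x • α.app P
      compat := fun P Q h => Cancels.smul (α.compat P Q h) x }

theorem Det.smul_app {A B : Submodule k V} (x : kˣ) (α : Det A B) (P : Index A B) :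
    (x • α).app P = x • α.app P :=
  rfl

theorem Det.exists_comp {A B C : Submodule k V} (hA : Module.Free k A) (hB : Module.Free k B)
    (hC : Module.Free k C) (hAB : Commensurable A B)
    (hBC : Commensurable B C) (α : Det A B) (β : Det B C) :
    ∃ γ : Det A C, ∀ (P : Submodule k V) (h₁ : IsCofree P A) (h₂ : IsCofree P B)
      (h₃ : IsCofree P C), γ.app ⟨P, h₁, h₃⟩ = (α.app ⟨P, h₁, h₂⟩).trans (β.app ⟨P, h₂, h₃⟩) := by
  have hex : ∃ R, IsCofree R A ∧ IsCofree R B ∧ IsCofree R C := by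
    obtain ⟨P, h1, h2⟩ := exists_isCofree hA hB hAB
    obtain ⟨R, h3, h4⟩ := exists_isCofree h1.free hC (h2.commensurable.trans hBC)
    exact ⟨R, h3.trans h1, h3.trans h2, h4⟩
  obtain ⟨R, hRA, hRB, hRC⟩ := hex
  obtain ⟨γ, hγ⟩ := Det.exists_app ⟨R, hRA, hRC⟩
    ((α.app ⟨R, hRA, hRB⟩).trans (β.app ⟨R, hRB, hRC⟩))
  have key : ∀ (S P : Submodule k V) (hSA : IsCofree S A) (hSB : IsCofree S B)
      (hSC : IsCofree S C) (hPA : IsCofree P A) (hPB : IsCofree P B) (hPC : IsCofree P C)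
      (h : S ≤ P), CancelsTo h hPA.le hPC.le
        ((α.app ⟨S, hSA, hSB⟩).trans (β.app ⟨S, hSB, hSC⟩))
        ((α.app ⟨P, hPA, hPB⟩).trans (β.app ⟨P, hPB, hPC⟩)) := by
    intro S P hSA hSB hSC hPA hPB hPC h
    have h1 := hSA.of_le hPA h
    have := h1.quot_free
    have := h1.quot_finite
    have := hPA.quot_free
    have := hPA.quot_finite
    have := hPB.quot_free
    have := hPB.quot_finite
    have := hPC.quot_free
    have := hPC.quot_finite
    exact Cancels.trans (isShortExact_rel _ _) (isShortExact_rel h hPB.le) (isShortExact_rel _ _)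
      (α.compat ⟨P, hPA, hPB⟩ ⟨S, hSA, hSB⟩ h) (β.compat ⟨P, hPB, hPC⟩ ⟨S, hSB, hSC⟩ h)
  refine ⟨γ, fun P h₁ h₂ h₃ => ?_⟩
  obtain ⟨S, hSR, hSP⟩ := exists_common (Commensurable.refl A) hRA h₁
  have h4 := key S R (hSR.trans hRA) (hSR.trans hRB) (hSR.trans hRC) hRA hRB hRC hSR.le
  have h5 := key S P (hSR.trans hRA) (hSR.trans hRB) (hSR.trans hRC) h₁ h₂ h₃ hSP.le
  have h6 : γ.app ⟨S, hSR.trans hRA, hSR.trans hRC⟩ = _ :=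
    (CancelsTo.existsUnique_left ⟨R, hRA, hRC⟩ ⟨S, hSR.trans hRA, hSR.trans hRC⟩ hSR.le
      (γ.app ⟨R, hRA, hRC⟩)).unique (γ.compat _ _ _) (by rw [hγ]; exact h4)
  refine (CancelsTo.existsUnique_right ⟨P, h₁, h₃⟩ ⟨S, hSR.trans hRA, hSR.trans hRC⟩ hSP.le
    (γ.app ⟨S, hSR.trans hRA, hSR.trans hRC⟩)).unique (γ.compat _ _ _) ?_
  rw [h6]
  exact h5

end Groupoid

section Objects

variable {k : Type*} [CommRing k] [IsArtinianRing k] [IsLocalRing k]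
  {V : Type*} [AddCommGroup V] [Module k V]

/-- The objects of the determinant groupoid: the free submodules of `V` commensurable to `W`. -/
@[ext]
structure Obj (W : Submodule k V) where
  carrier : Submodule k V
  free : Module.Free k carrier
  comm : Commensurable W carrier

variable {W : Submodule k V}

theorem Obj.commensurable (A B : Obj W) : Commensurable A.carrier B.carrier :=
  A.comm.symm.trans B.comm

theorem Obj.exists_cofree (l : List (Obj W)) (A : Obj W) :
    ∃ P : Submodule k V, IsCofree P A.carrier ∧ ∀ B ∈ l, IsCofree P B.carrier := by
  induction l with
  | nil =>
    obtain ⟨P, h, -⟩ := exists_isCofree A.free A.free (A.commensurable A)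
    exact ⟨P, h, by simp⟩
  | cons B l ih =>
    obtain ⟨P, h1, h2⟩ := ih
    obtain ⟨R, h3, h4⟩ := exists_isCofree h1.free B.free
      (h1.commensurable.trans (A.commensurable B))
    refine ⟨R, h3.trans h1, fun C hC => ?_⟩
    rcases List.mem_cons.1 hC with rfl | hC
    · exact h4
    · exact h3.trans (h2 C hC)

/-- The composition law `Det(A, B) × Det(B, C) → Det(A, C)`, `(α, β) ↦ β ∘ α`: it is determined by
the composition of isomorphisms `det (A / P) ≅ det (B / P) ≅ det (C / P)`, see `comp_app`. -/
noncomputable def comp {A B C : Obj W} (α : Det A.carrier B.carrier)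
    (β : Det B.carrier C.carrier) : Det A.carrier C.carrier :=
  (Det.exists_comp A.free B.free C.free (A.commensurable B) (B.commensurable C) α β).choose

theorem comp_app {A B C : Obj W} (α : Det A.carrier B.carrier) (β : Det B.carrier C.carrier)
    (P : Submodule k V) (h₁ : IsCofree P A.carrier) (h₂ : IsCofree P B.carrier)
    (h₃ : IsCofree P C.carrier) :
    (comp α β).app ⟨P, h₁, h₃⟩ = (α.app ⟨P, h₁, h₂⟩).trans (β.app ⟨P, h₂, h₃⟩) :=
  (Det.exists_comp A.free B.free C.free (A.commensurable B) (B.commensurable C) α β).choose_spec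
    P h₁ h₂ h₃

/-- The inverse of a morphism. -/
noncomputable def Det.inv {A B : Submodule k V} (α : Det A B) : Det B A where
  app P := (α.app ⟨P.sub, P.right, P.left⟩).symm
  compat P Q h := by
    have h1 := Q.left.of_le P.left h
    have := h1.quot_free
    have := h1.quot_finite
    have := P.left.quot_free
    have := P.left.quot_finite
    have := P.right.quot_free
    have := P.right.quot_finite
    exact Cancels.symm (isShortExact_rel _ _) (isShortExact_rel _ _)
      (α.compat ⟨P.sub, P.right, P.left⟩ ⟨Q.sub, Q.right, Q.left⟩ h)

theorem comp_assoc {A B C D : Obj W} (α : Det A.carrier B.carrier) (β : Det B.carrier C.carrier)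
    (γ : Det C.carrier D.carrier) : comp (comp α β) γ = comp α (comp β γ) := by
  obtain ⟨P, hA, h⟩ := Obj.exists_cofree [B, C, D] A
  have hB := h B (by simp)
  have hC := h C (by simp)
  have hD := h D (by simp)
  refine Det.eq_of_app ⟨P, hA, hD⟩ ?_
  rw [comp_app _ _ P hA hC hD, comp_app _ _ P hA hB hC, comp_app _ _ P hA hB hD,
    comp_app _ _ P hB hC hD]
  rfl

theorem id_comp {A B : Obj W} (α : Det A.carrier B.carrier) :
    comp (Det.id A.carrier) α = α := by
  obtain ⟨P, hA, h⟩ := Obj.exists_cofree [B] A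
  have hB := h B (by simp)
  refine Det.eq_of_app ⟨P, hA, hB⟩ ?_
  rw [comp_app _ _ P hA hA hB]
  rfl

theorem comp_id {A B : Obj W} (α : Det A.carrier B.carrier) :
    comp α (Det.id B.carrier) = α := by
  obtain ⟨P, hA, h⟩ := Obj.exists_cofree [B] A
  have hB := h B (by simp)
  refine Det.eq_of_app ⟨P, hA, hB⟩ ?_
  rw [comp_app _ _ P hA hB hB]
  rfl

theorem inv_comp {A B : Obj W} (α : Det A.carrier B.carrier) :
    comp α.inv α = Det.id B.carrier := by
  obtain ⟨P, hA, h⟩ := Obj.exists_cofree [B] A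
  have hB := h B (by simp)
  refine Det.eq_of_app ⟨P, hB, hB⟩ ?_
  rw [comp_app _ _ P hB hA hB]
  exact LinearEquiv.symm_trans_self _

theorem comp_inv {A B : Obj W} (α : Det A.carrier B.carrier) :
    comp α α.inv = Det.id A.carrier := by
  obtain ⟨P, hA, h⟩ := Obj.exists_cofree [B] A
  have hB := h B (by simp)
  refine Det.eq_of_app ⟨P, hA, hA⟩ ?_
  rw [comp_app _ _ P hA hB hA]
  exact LinearEquiv.self_trans_symm _

theorem smul_comp {A B C : Obj W} (x : kˣ) (α : Det A.carrier B.carrier)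
    (β : Det B.carrier C.carrier) : comp (x • α) β = x • comp α β := by
  obtain ⟨P, hA, h⟩ := Obj.exists_cofree [B, C] A
  have hB := h B (by simp)
  have hC := h C (by simp)
  refine Det.eq_of_app ⟨P, hA, hC⟩ ?_
  rw [comp_app _ _ P hA hB hC, Det.smul_app, Det.smul_app, comp_app _ _ P hA hB hC]
  ext1 y
  simp

theorem comp_smul {A B C : Obj W} (x : kˣ) (α : Det A.carrier B.carrier)
    (β : Det B.carrier C.carrier) : comp α (x • β) = x • comp α β := by
  obtain ⟨P, hA, h⟩ := Obj.exists_cofree [B, C] A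
  have hB := h B (by simp)
  have hC := h C (by simp)
  refine Det.eq_of_app ⟨P, hA, hC⟩ ?_
  rw [comp_app _ _ P hA hB hC, Det.smul_app, Det.smul_app, comp_app _ _ P hA hB hC]
  ext1 y
  simp

/-- The isomorphism `A / P ≅ σA / σP` induced by `σ`. -/
noncomputable def relEquiv (σ : V ≃ₗ[k] V) {A A' P P' : Submodule k V}
    (hA : A' = A.map σ.toLinearMap) (hP : P' = P.map σ.toLinearMap) :
    RelQuot A P ≃ₗ[k] RelQuot A' P' :=
  Submodule.Quotient.equiv _ _ (σ.ofSubmodules A A' hA.symm) (by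
    subst hA hP
    ext ⟨y, hy⟩
    constructor
    · rintro ⟨x, hx, hxy⟩
      rw [mem_submoduleOf]
      exact ⟨x, hx, congrArg Subtype.val hxy⟩
    · rintro ⟨x, hx, hxy⟩
      obtain ⟨z, hz, hzy⟩ := hy
      have hxz : x = z := σ.injective (hxy.trans hzy.symm)
      subst hxz
      exact ⟨⟨x, hz⟩, hx, Subtype.ext hxy⟩)

theorem relEquiv_mk (σ : V ≃ₗ[k] V) {A A' P P' : Submodule k V}
    (hA : A' = A.map σ.toLinearMap) (hP : P' = P.map σ.toLinearMap) (x : A) :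
    relEquiv σ hA hP (Submodule.Quotient.mk x) =
      Submodule.Quotient.mk (σ.ofSubmodules A A' hA.symm x) :=
  rfl

theorem IsCofree.map (σ : V ≃ₗ[k] V) {A A' P P' : Submodule k V}
    (hA : A' = A.map σ.toLinearMap) (hP : P' = P.map σ.toLinearMap) (h : IsCofree P A) :
    IsCofree P' A' := by
  have := h.free
  have := h.quot_free
  have := h.quot_finite
  refine ⟨?_, ?_, Module.Free.of_equiv (relEquiv σ hA hP), Module.Finite.equiv (relEquiv σ hA hP)⟩
  · rw [hA, hP]
    exact Submodule.map_mono h.le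
  · exact Module.Free.of_equiv (σ.ofSubmodules P P' hP.symm)

theorem eq_map_map_symm (σ : V ≃ₗ[k] V) (A : Submodule k V) :
    A = (A.map σ.symm.toLinearMap).map σ.toLinearMap := by
  rw [← Submodule.map_comp]
  simp

theorem eq_map_symm_map (σ : V ≃ₗ[k] V) (A : Submodule k V) :
    A = (A.map σ.toLinearMap).map σ.symm.toLinearMap :=
  eq_map_map_symm σ.symm A

/-- The preimage under `σ` of a member of the index set of `(σA, σB)`. -/
def Index.pull (σ : V ≃ₗ[k] V) {A B A' B' : Submodule k V} (hA : A' = A.map σ.toLinearMap)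
    (hB : B' = B.map σ.toLinearMap) (P : Index A' B') : Index A B where
  sub := P.sub.map σ.symm.toLinearMap
  left := P.left.map σ.symm (by rw [hA]; exact eq_map_symm_map σ A) rfl
  right := P.right.map σ.symm (by rw [hB]; exact eq_map_symm_map σ B) rfl

/-- The map `σ_* : Det(A, B) → Det(σA, σB)`, `α ↦ σ ∘ α ∘ σ⁻¹`. -/
noncomputable def push (σ : V ≃ₗ[k] V) {A B A' B' : Submodule k V}
    (hA : A' = A.map σ.toLinearMap) (hB : B' = B.map σ.toLinearMap) (α : Det A B) : Det A' B' where
  app P := conj (relEquiv σ hA (eq_map_map_symm σ P.sub)) (relEquiv σ hB (eq_map_map_symm σ P.sub))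
    (α.app (P.pull σ hA hB))
  compat P Q h := by
    refine Cancels.conj (relEquiv σ (eq_map_map_symm σ P.sub) (eq_map_map_symm σ Q.sub))
      _ _ _ _ ?_ ?_ ?_ ?_ (α.compat (P.pull σ hA hB) (Q.pull σ hA hB) (Submodule.map_mono h)) <;>
    · intro x
      obtain ⟨x, rfl⟩ := Submodule.Quotient.mk_surjective _ x
      rfl

theorem push_app (σ : V ≃ₗ[k] V) {A B A' B' : Submodule k V}
    (hA : A' = A.map σ.toLinearMap) (hB : B' = B.map σ.toLinearMap) (α : Det A B)
    (P : Index A B) (P' : Index A' B') (hP : P'.sub = P.sub.map σ.toLinearMap) :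
    (push σ hA hB α).app P' = conj (relEquiv σ hA hP) (relEquiv σ hB hP) (α.app P) := by
  have h : P'.pull σ hA hB = P := by
    obtain ⟨Q, _, _⟩ := P
    have : P'.sub.map σ.symm.toLinearMap = Q := by
      rw [hP]
      exact (eq_map_symm_map σ Q).symm
    subst this
    rfl
  subst h
  rfl

end Objects

section PushLemmas

variable {k : Type*} [CommRing k] [IsArtinianRing k] [IsLocalRing k]
  {V : Type*} [AddCommGroup V] [Module k V]

theorem map_coe {M N : Type*} [AddCommGroup M] [Module k M] [AddCommGroup N] [Module k N]
    (n : ℕ) (f : M →ₗ[k] N) (x : ⋀[k]^n M) :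
    (exteriorPower.map n f x : ExteriorAlgebra k N) = ExteriorAlgebra.map f x := by
  have h : (⋀[k]^n N).subtype ∘ₗ exteriorPower.map n f =
      (ExteriorAlgebra.map f).toLinearMap ∘ₗ (⋀[k]^n M).subtype := by
    apply exteriorPower.linearMap_ext
    ext v
    simp
  exact congrArg (fun F => F x) h

theorem detCongr_coe' {M N : Type*} [AddCommGroup M] [Module k M] [AddCommGroup N] [Module k N]
    (f : M ≃ₗ[k] N) (x : DetModule k M) :
    (detCongr f x : ExteriorAlgebra k N) = ExteriorAlgebra.map f.toLinearMap x :=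
  (detCongr_coe f x).trans (map_coe _ _ _)

theorem detCongr_trans {M N T : Type*} [AddCommGroup M] [Module k M] [AddCommGroup N] [Module k N]
    [AddCommGroup T] [Module k T] (f : M ≃ₗ[k] N) (g : N ≃ₗ[k] T) (x : DetModule k M) :
    detCongr (f.trans g) x = detCongr g (detCongr f x) := by
  apply Subtype.ext
  rw [detCongr_coe', detCongr_coe', detCongr_coe', LinearEquiv.coe_trans,
    ← ExteriorAlgebra.map_comp_map]
  rfl

theorem detCongr_refl {M : Type*} [AddCommGroup M] [Module k M] (x : DetModule k M) :
    detCongr (LinearEquiv.refl k M) x = x := by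
  apply Subtype.ext
  rw [detCongr_coe', LinearEquiv.refl_toLinearMap, ExteriorAlgebra.map_id]
  rfl

theorem conj_conj {M N T M' N' T' : Type*} [AddCommGroup M] [Module k M] [AddCommGroup N]
    [Module k N] [AddCommGroup T] [Module k T] [AddCommGroup M'] [Module k M'] [AddCommGroup N']
    [Module k N'] [AddCommGroup T'] [Module k T'] (f : M ≃ₗ[k] N) (g : N ≃ₗ[k] T)
    (f' : M' ≃ₗ[k] N') (g' : N' ≃ₗ[k] T') (α : DetModule k M ≃ₗ[k] DetModule k M') :
    conj g g' (conj f f' α) = conj (f.trans g) (f'.trans g') α := by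
  apply LinearEquiv.ext
  intro x
  obtain ⟨y, rfl⟩ := (detCongr (f.trans g)).surjective x
  simp only [conj, LinearEquiv.trans_apply, LinearEquiv.symm_apply_apply]
  rw [detCongr_trans f' g']
  congr 3
  rw [LinearEquiv.symm_apply_eq, LinearEquiv.symm_apply_eq, detCongr_trans]

theorem conj_trans {M N M' N' M'' N'' : Type*} [AddCommGroup M] [Module k M] [AddCommGroup N]
    [Module k N] [AddCommGroup M'] [Module k M'] [AddCommGroup N'] [Module k N'] [AddCommGroup M'']
    [Module k M''] [AddCommGroup N''] [Module k N''] (f : M ≃ₗ[k] N) (f' : M' ≃ₗ[k] N')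
    (f'' : M'' ≃ₗ[k] N'') (α : DetModule k M ≃ₗ[k] DetModule k M')
    (β : DetModule k M' ≃ₗ[k] DetModule k M'') :
    conj f f'' (α.trans β) = (conj f f' α).trans (conj f' f'' β) := by
  apply LinearEquiv.ext
  intro x
  simp [conj]

theorem push_push (σ τ ρ : V ≃ₗ[k] V) (hρ : ρ = σ * τ) {A B A' B' A'' B'' : Submodule k V}
    (hA : A' = A.map τ.toLinearMap) (hB : B' = B.map τ.toLinearMap)
    (hA' : A'' = A'.map σ.toLinearMap) (hB' : B'' = B'.map σ.toLinearMap)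
    (hA'' : A'' = A.map ρ.toLinearMap) (hB'' : B'' = B.map ρ.toLinearMap) (α : Det A B) :
    push σ hA' hB' (push τ hA hB α) = push ρ hA'' hB'' α := by
  ext1
  funext P
  subst hρ
  have h1 : P.sub = (P.sub.map σ.symm.toLinearMap).map σ.toLinearMap := eq_map_map_symm σ _
  have h2 : (P.pull σ hA' hB').sub = ((P.pull σ hA' hB').pull τ hA hB).sub.map τ.toLinearMap :=
    eq_map_map_symm τ _
  have h3 : P.sub = ((P.pull σ hA' hB').pull τ hA hB).sub.map (σ * τ).toLinearMap := by
    have : (σ * τ).toLinearMap = σ.toLinearMap ∘ₗ τ.toLinearMap := rfl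
    rw [this, Submodule.map_comp, ← h2]
    exact h1
  rw [push_app σ hA' hB' _ (P.pull σ hA' hB') P h1, push_app τ hA hB _ _ _ h2,
    push_app (σ * τ) hA'' hB'' _ _ _ h3, conj_conj]
  congr 1 <;>
  · apply LinearEquiv.ext
    intro x
    obtain ⟨x, rfl⟩ := Submodule.Quotient.mk_surjective _ x
    rfl

theorem eq_map_one (A : Submodule k V) : A = A.map (1 : V ≃ₗ[k] V).toLinearMap :=
  (Submodule.map_id A).symm

theorem push_refl (σ : V ≃ₗ[k] V) (hσ : σ = 1) {A B : Submodule k V} (hA : A = A.map σ.toLinearMap)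
    (hB : B = B.map σ.toLinearMap) (α : Det A B) : push σ hA hB α = α := by
  subst hσ
  ext1
  funext P
  have h : P.sub = P.sub.map (1 : V ≃ₗ[k] V).toLinearMap := (Submodule.map_id _).symm
  rw [push_app 1 hA hB α P P h]
  have h1 : ∀ {C : Submodule k V} (hC : C = C.map (1 : V ≃ₗ[k] V).toLinearMap),
      relEquiv 1 hC h = LinearEquiv.refl k _ := by
    intro C hC
    apply LinearEquiv.ext
    intro x
    obtain ⟨x, rfl⟩ := Submodule.Quotient.mk_surjective _ x
    rfl
  rw [h1 hA, h1 hB]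
  apply LinearEquiv.ext
  intro x
  simp only [conj, LinearEquiv.trans_apply]
  rw [detCongr_refl]
  congr 1
  rw [LinearEquiv.symm_apply_eq, detCongr_refl]

theorem push_id (σ : V ≃ₗ[k] V) {A A' : Submodule k V} (hA : A' = A.map σ.toLinearMap) :
    push σ hA hA (Det.id A) = Det.id A' := by
  ext1
  funext P
  apply LinearEquiv.ext
  intro x
  exact LinearEquiv.apply_symm_apply (detCongr _) x

theorem push_smul (σ : V ≃ₗ[k] V) {A B A' B' : Submodule k V} (hA : A' = A.map σ.toLinearMap)
    (hB : B' = B.map σ.toLinearMap) (x : kˣ) (α : Det A B) :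
    push σ hA hB (x • α) = x • push σ hA hB α := by
  ext1
  funext P
  apply LinearEquiv.ext
  intro y
  exact (detCongr (relEquiv σ hB (eq_map_map_symm σ P.sub))).map_smul (x : k) _

theorem push_comp {W : Submodule k V} (σ : V ≃ₗ[k] V) {A B C A' B' C' : Obj W}
    (hA : A'.carrier = A.carrier.map σ.toLinearMap) (hB : B'.carrier = B.carrier.map σ.toLinearMap)
    (hC : C'.carrier = C.carrier.map σ.toLinearMap) (α : Det A.carrier B.carrier)
    (β : Det B.carrier C.carrier) :
    push σ hA hC (comp α β) = comp (push σ hA hB α) (push σ hB hC β) := by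
  obtain ⟨P, h1, h⟩ := Obj.exists_cofree [B, C] A
  have h2 := h B (by simp)
  have h3 := h C (by simp)
  have k1 : IsCofree (P.map σ.toLinearMap) A'.carrier := h1.map σ hA rfl
  have k2 : IsCofree (P.map σ.toLinearMap) B'.carrier := h2.map σ hB rfl
  have k3 : IsCofree (P.map σ.toLinearMap) C'.carrier := h3.map σ hC rfl
  refine Det.eq_of_app ⟨P.map σ.toLinearMap, k1, k3⟩ ?_
  rw [comp_app _ _ _ k1 k2 k3, push_app σ hA hC _ ⟨P, h1, h3⟩ ⟨_, k1, k3⟩ rfl,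
    push_app σ hA hB _ ⟨P, h1, h2⟩ ⟨_, k1, k2⟩ rfl, push_app σ hB hC _ ⟨P, h2, h3⟩ ⟨_, k2, k3⟩ rfl,
    comp_app _ _ _ h1 h2 h3]
  exact conj_trans _ _ _ _ _

end PushLemmas

section Extension

variable {k : Type*} [CommRing k] [IsArtinianRing k] [IsLocalRing k]
  {V : Type*} [AddCommGroup V] [Module k V]

/-- The restricted general linear group `G^V_W`: the `k`-linear automorphisms `σ` of `V` such that
`W` and `σW` are commensurable. -/
def restrictedGL (W : Submodule k V) : Subgroup (V ≃ₗ[k] V) where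
  carrier := {σ | Commensurable W (W.map σ.toLinearMap)}
  one_mem' := by
    change Commensurable W (W.map LinearMap.id)
    rw [Submodule.map_id]
    exact Commensurable.refl W
  mul_mem' := by
    intro σ τ hσ hτ
    change Commensurable W (W.map (σ.toLinearMap ∘ₗ τ.toLinearMap))
    rw [Submodule.map_comp]
    exact Commensurable.trans hσ (Commensurable.map hτ σ)
  inv_mem' := by
    intro σ hσ
    have h := Commensurable.map hσ σ.symm
    rw [← eq_map_symm_map] at h
    exact h.symm

variable {W : Submodule k V}

/-- The action of the restricted general linear group on the objects of the groupoid. -/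
instance : MulAction (restrictedGL W) (Obj W) where
  smul σ A :=
    { carrier := A.carrier.map σ.1.toLinearMap
      free := by
        have := A.free
        exact Module.Free.of_equiv (σ.1.submoduleMap A.carrier)
      comm := Commensurable.trans σ.2 (Commensurable.map A.comm σ.1) }
  one_smul A := Obj.ext (Submodule.map_id _)
  mul_smul σ τ A := Obj.ext (Submodule.map_comp τ.1.toLinearMap σ.1.toLinearMap A.carrier)

theorem smul_carrier (σ : restrictedGL W) (A : Obj W) :
    (σ • A).carrier = A.carrier.map σ.1.toLinearMap :=
  rfl

theorem mul_smul_carrier (σ τ : restrictedGL W) (A : Obj W) :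
    ((σ * τ) • A).carrier = (τ • A).carrier.map σ.1.toLinearMap :=
  congrArg Obj.carrier (mul_smul σ τ A)

theorem inv_smul_carrier (σ : restrictedGL W) (A : Obj W) :
    A.carrier = (σ • A).carrier.map (σ⁻¹).1.toLinearMap :=
  congrArg Obj.carrier (inv_smul_smul σ A).symm

/-- The identity of `A`, as an element of `Det(A, B)`, when `A = B`. -/
noncomputable def ofEq {A B : Obj W} (h : A = B) : Det A.carrier B.carrier :=
  h ▸ Det.id A.carrier

theorem ofEq_rfl (A : Obj W) : ofEq (rfl : A = A) = Det.id A.carrier :=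
  rfl

/-- The set `G̃^V_W` of pairs `(σ, Φ)`, where `σ` belongs to the restricted general linear group and
`Φ` is a natural transformation from the identity functor of the determinant groupoid to the functor
`σ_*`: a family of morphisms `Φ(A) ∈ Det(A, σA)` such that `σ_*(α) ∘ Φ(A) = Φ(B) ∘ α` for all
`α ∈ Det(A, B)`. -/
structure CentralExt (W : Submodule k V) where
  base : restrictedGL W
  app : ∀ A : Obj W, Det A.carrier (base • A).carrier
  natural : ∀ (A B : Obj W) (α : Det A.carrier B.carrier),
    comp (app A) (push base.1 (smul_carrier base A) (smul_carrier base B) α) = comp α (app B)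

namespace CentralExt

theorem ext' {x y : CentralExt W} (h : x.base = y.base)
    (h' : ∀ A, comp (x.app A) (ofEq (congrArg (· • A) h)) = y.app A) : x = y := by
  obtain ⟨σ, Φ, hΦ⟩ := x
  obtain ⟨τ, Ψ, hΨ⟩ := y
  obtain rfl : σ = τ := h
  have : Φ = Ψ := by
    funext A
    rw [← comp_id (Φ A)]
    exact h' A
  subst this
  rfl

theorem comp_ofEq_push (σ : V ≃ₗ[k] V) (hσ : σ = 1) {A B A' B' : Obj W} (hA : A = A') (hB : B = B')
    (h : A'.carrier = A.carrier.map σ.toLinearMap) (h' : B'.carrier = B.carrier.map σ.toLinearMap)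
    (α : Det A.carrier B.carrier) : comp (ofEq hA) (push σ h h' α) = comp α (ofEq hB) := by
  subst hA hB
  rw [ofEq_rfl, ofEq_rfl, id_comp, comp_id, push_refl σ hσ]

theorem push_comp_ofEq (σ : V ≃ₗ[k] V) {A B A' B' C' : Obj W}
    (hA : A'.carrier = A.carrier.map σ.toLinearMap) (hB : B'.carrier = B.carrier.map σ.toLinearMap)
    (h : B' = C') (hC : C'.carrier = B.carrier.map σ.toLinearMap) (α : Det A.carrier B.carrier) :
    comp (push σ hA hB α) (ofEq h) = push σ hA hC α := by
  subst h
  rw [ofEq_rfl, comp_id]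

theorem push_id_eq_ofEq (σ : V ≃ₗ[k] V) {A A' B' : Obj W} (h : A' = B')
    (hA : A'.carrier = A.carrier.map σ.toLinearMap) (hB : B'.carrier = A.carrier.map σ.toLinearMap) :
    push σ hA hB (Det.id A.carrier) = ofEq h := by
  subst h
  exact push_id σ hA

theorem ofEq_comp_ofEq {A B C : Obj W} (h : A = B) (h' : B = C) :
    comp (ofEq h) (ofEq h') = ofEq (h.trans h') := by
  subst h h'
  exact id_comp _

/-- `(σ, Φ)(τ, Ψ) = (στ, A ↦ σ_*(Ψ(A)) ∘ Φ(A))`. -/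
noncomputable instance : Mul (CentralExt W) where
  mul x y :=
    { base := x.base * y.base
      app := fun A => comp (x.app A)
        (push x.base.1 (smul_carrier x.base A) (mul_smul_carrier x.base y.base A) (y.app A))
      natural := by
        intro A B α
        rw [comp_assoc, ← push_push x.base.1 y.base.1 (x.base * y.base).1 rfl
          (smul_carrier y.base A) (smul_carrier y.base B) (mul_smul_carrier x.base y.base A)
          (mul_smul_carrier x.base y.base B), ← push_comp, y.natural,
          push_comp x.base.1 _ (smul_carrier x.base B), ← comp_assoc, x.natural, comp_assoc] }

/-- The unit `(1, A ↦ 1_A)`. -/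
noncomputable instance : One (CentralExt W) where
  one :=
    { base := 1
      app := fun A => ofEq (one_smul _ A).symm
      natural := fun _ _ α => comp_ofEq_push 1 rfl _ _ _ _ α }

/-- `(σ, Φ)⁻¹ = (σ⁻¹, A ↦ (σ⁻¹)_*(Φ(A)⁻¹))`. -/
noncomputable instance : Inv (CentralExt W) where
  inv x :=
    { base := x.base⁻¹
      app := fun A => push (x.base⁻¹).1 (inv_smul_carrier x.base A) (smul_carrier x.base⁻¹ A)
        (x.app A).inv
      natural := by
        intro A B α
        have h1 : push (x.base⁻¹).1 (inv_smul_carrier x.base A) (inv_smul_carrier x.base B)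
            (push x.base.1 (smul_carrier x.base A) (smul_carrier x.base B) α) = α := by
          rw [push_push (x.base⁻¹).1 x.base.1 1 (by simp) _ _ _ _ (eq_map_one _) (eq_map_one _),
            push_refl 1 rfl]
        have h2 : comp (x.app A).inv α =
            comp (push x.base.1 (smul_carrier x.base A) (smul_carrier x.base B) α)
              (x.app B).inv := by
          rw [← comp_id (comp (x.app A).inv α), ← comp_inv (x.app B), comp_assoc, ← comp_assoc α,
            ← x.natural, comp_assoc, ← comp_assoc, inv_comp, id_comp]
        rw [← push_comp, h2, push_comp (x.base⁻¹).1 (B' := B) _ (inv_smul_carrier x.base B), h1] }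

@[simp] theorem base_mul (x y : CentralExt W) : (x * y).base = x.base * y.base :=
  rfl

@[simp] theorem base_one : (1 : CentralExt W).base = 1 :=
  rfl

theorem app_mul (x y : CentralExt W) (A : Obj W) :
    (x * y).app A = comp (x.app A)
      (push x.base.1 (smul_carrier x.base A) (mul_smul_carrier x.base y.base A) (y.app A)) :=
  rfl

theorem app_one (A : Obj W) : (1 : CentralExt W).app A = ofEq (one_smul _ A).symm :=
  rfl

noncomputable instance : Group (CentralExt W) :=
  Group.ofLeftAxioms
    (by
      intro x y z
      refine ext' (mul_assoc _ _ _) fun A => ?_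
      have h1 := mul_smul_carrier x.base (y.base * z.base) A
      have h2 : (((x.base * y.base) * z.base) • A).carrier =
          ((y.base * z.base) • A).carrier.map x.base.1.toLinearMap := by
        rw [mul_assoc]
        exact h1
      rw [app_mul, app_mul, app_mul x (y * z), app_mul y z, comp_assoc, comp_assoc,
        push_comp_ofEq _ _ _ _ (by
          change ((x.base * (y.base * z.base)) • A).carrier =
            (z.base • A).carrier.map (x.base * y.base).1.toLinearMap
          rw [← mul_assoc]
          exact mul_smul_carrier (x.base * y.base) z.base A),
        push_comp x.base.1 (B' := (x.base * y.base) • A) _ (mul_smul_carrier x.base y.base A),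
        push_push x.base.1 y.base.1 (x.base * y.base).1 rfl]
      rfl)
    (by
      intro x
      refine ext' (one_mul _) fun A => ?_
      rw [app_mul, app_one]
      have h : x.base • A = (1 * x.base) • A := by rw [one_mul]
      have h1 := comp_ofEq_push (1 : V ≃ₗ[k] V) rfl (one_smul (restrictedGL W) A).symm h
        (smul_carrier 1 A) (mul_smul_carrier 1 x.base A) (x.app A)
      refine (congrArg (fun β => comp β _) h1).trans ?_
      rw [comp_assoc, ofEq_comp_ofEq]
      exact comp_id _)
    (by
      intro x
      refine ext' (inv_mul_cancel _) fun A => ?_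
      rw [app_mul, app_one]
      change comp (comp (push (x.base⁻¹).1 (inv_smul_carrier x.base A) (smul_carrier x.base⁻¹ A)
        (x.app A).inv) (push (x.base⁻¹).1 (smul_carrier (x.base⁻¹) A)
          (mul_smul_carrier (x.base⁻¹) x.base A) (x.app A))) _ = _
      rw [← push_comp, inv_comp, push_id_eq_ofEq _ (A' := A)
        (by rw [inv_mul_cancel, one_smul]), ofEq_comp_ofEq])

/-- The projection `G̃ → G`, `(σ, Φ) ↦ σ`. -/
noncomputable def proj (W : Submodule k V) : CentralExt W →* restrictedGL W where
  toFun := base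
  map_one' := rfl
  map_mul' _ _ := rfl

theorem mul_smul_det {A B : Submodule k V} (x y : kˣ) (α : Det A B) :
    (x * y) • α = x • y • α := by
  ext1
  funext P
  apply LinearEquiv.ext
  intro z
  exact mul_smul (x : k) (y : k) (α.app P z)

theorem one_smul_det {A B : Submodule k V} (α : Det A B) : (1 : kˣ) • α = α := by
  ext1
  funext P
  apply LinearEquiv.ext
  intro z
  exact one_smul k (α.app P z)

/-- The map `kˣ → G̃`, `x ↦ (1, A ↦ x • 1_A)`. -/
noncomputable def scalar (W : Submodule k V) : kˣ →* CentralExt W where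
  toFun x :=
    { base := 1
      app := fun A => x • ofEq (one_smul _ A).symm
      natural := fun A B α => by
        rw [smul_comp, comp_smul]
        exact congrArg (x • ·) (comp_ofEq_push 1 rfl _ _ _ _ α) }
  map_one' := by
    refine ext' rfl fun A => ?_
    exact (comp_id _).trans (one_smul_det _)
  map_mul' x y := by
    refine ext' (one_mul _).symm fun A => ?_
    have h : (1 : restrictedGL W) • A = (1 * 1 : restrictedGL W) • A := by rw [one_mul]
    have h1 := (comp_ofEq_push (1 : V ≃ₗ[k] V) rfl (one_smul (restrictedGL W) A).symm h
      (smul_carrier 1 A) (mul_smul_carrier 1 1 A) (ofEq (one_smul (restrictedGL W) A).symm)).trans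
      (ofEq_comp_ofEq _ _)
    have h2 : comp (x • ofEq (one_smul (restrictedGL W) A).symm)
        (push (1 : V ≃ₗ[k] V) (smul_carrier 1 A) (mul_smul_carrier 1 1 A)
          (y • ofEq (one_smul (restrictedGL W) A).symm)) =
        (x * y) • ofEq ((one_smul (restrictedGL W) A).symm.trans h) := by
      rw [push_smul, smul_comp, comp_smul, mul_smul_det, h1]
    have h3 : comp ((x * y) • ofEq (one_smul (restrictedGL W) A).symm) (ofEq h) =
        (x * y) • ofEq ((one_smul (restrictedGL W) A).symm.trans h) := by
      rw [smul_comp, ofEq_comp_ofEq]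
    exact h3.trans h2.symm

end CentralExt

end Extension

section Symbol

variable {k : Type*} [CommRing k] [IsArtinianRing k] [IsLocalRing k]
  {V : Type*} [AddCommGroup V] [Module k V]

/-- The symbol `{σ, τ}^V_W ∈ kˣ` of commuting elements of the restricted general linear group: the
commutator `s t s⁻¹ t⁻¹` of any liftings `s`, `t` of `σ`, `τ` to the central extension, viewed as an
element of `kˣ`. -/
noncomputable def commSymbol (W : Submodule k V) (σ τ : restrictedGL W) : kˣ :=
  Classical.epsilon fun x => ∀ s t : CentralExt W, CentralExt.proj W s = σ →
    CentralExt.proj W t = τ → s * t * s⁻¹ * t⁻¹ = CentralExt.scalar W x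

end Symbol

section Laurent

variable {k : Type*} [CommRing k]

/-- The submodule `k[[t]]` of `k((t))`. -/
def powerSeriesSubmodule (k : Type*) [CommRing k] : Submodule k (LaurentSeries k) where
  carrier := {f | ∀ n < 0, f.coeff n = 0}
  add_mem' := by
    intro f g hf hg n hn
    simp [hf n hn, hg n hn]
  zero_mem' := by
    intro n _
    simp
  smul_mem' := by
    intro c f hf n hn
    simp [hf n hn]

/-- Multiplication by a unit of `k((t))`, as a `k`-linear automorphism of `k((t))`. -/
noncomputable def mulAut (k : Type*) [CommRing k] :
    (LaurentSeries k)ˣ →* (LaurentSeries k ≃ₗ[k] LaurentSeries k) where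
  toFun f :=
    { toFun := fun x => (f : LaurentSeries k) * x
      map_add' := fun x y => mul_add _ x y
      map_smul' := fun c x => by
        simp only [← HahnSeries.C_mul_eq_smul, RingHom.id_apply, mul_left_comm]
      invFun := fun x => ((f⁻¹ : (LaurentSeries k)ˣ) : LaurentSeries k) * x
      left_inv := fun x => Units.inv_mul_cancel_left f x
      right_inv := fun x => Units.mul_inv_cancel_left f x }
  map_one' := LinearEquiv.ext fun x => one_mul x
  map_mul' f g := LinearEquiv.ext fun x => mul_assoc (f : LaurentSeries k) g x

theorem mulAut_apply (f : (LaurentSeries k)ˣ) (x : LaurentSeries k) :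
    mulAut k f x = (f : LaurentSeries k) * x :=
  rfl

theorem exists_powerSeries {x : LaurentSeries k} (hx : x ∈ powerSeriesSubmodule k) :
    ∃ q : PowerSeries k, HahnSeries.ofPowerSeries ℤ k q = x := by
  refine ⟨PowerSeries.mk fun n => x.coeff n, ?_⟩
  ext n
  rw [PowerSeries.coeff_coe]
  split_ifs with h
  · exact (hx n h).symm
  · rw [PowerSeries.coeff_mk]
    congr 1
    omega

theorem exists_fg_map_le (f : LaurentSeries k) : ∃ F : Submodule k (LaurentSeries k), F.FG ∧
    ∀ x ∈ powerSeriesSubmodule k, f * x ∈ powerSeriesSubmodule k ⊔ F := by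
  classical
  refine ⟨Submodule.span k ((Finset.Ico f.order 0).image fun n => HahnSeries.single n (1 : k)),
    ⟨_, rfl⟩, fun x hx => ?_⟩
  obtain ⟨q, rfl⟩ := exists_powerSeries hx
  have h1 : ∀ n < f.order, (f * HahnSeries.ofPowerSeries ℤ k q).coeff n = 0 := by
    intro n hn
    rw [← LaurentSeries.single_order_mul_powerSeriesPart f, mul_assoc, ← map_mul]
    have h2 : n = (n - f.order) + f.order := by ring
    rw [h2, HahnSeries.coeff_single_mul_add, PowerSeries.coeff_coe, if_pos (by omega), mul_zero]
  set g := f * HahnSeries.ofPowerSeries ℤ k q with hg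
  have h3 : g = (g - ∑ n ∈ Finset.Ico f.order 0, g.coeff n • HahnSeries.single n (1 : k)) +
      ∑ n ∈ Finset.Ico f.order 0, g.coeff n • HahnSeries.single n (1 : k) := by abel
  rw [h3]
  refine Submodule.add_mem_sup ?_ (Submodule.sum_mem _ fun n hn => Submodule.smul_mem _ _
    (Submodule.subset_span (Finset.mem_coe.2 (Finset.mem_image_of_mem _ hn))))
  intro n hn
  rw [HahnSeries.coeff_sub, HahnSeries.coeff_sum]
  by_cases h : f.order ≤ n
  · rw [Finset.sum_eq_single n]
    · simp
    · intro m _ hm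
      simp [HahnSeries.coeff_single_of_ne hm.symm]
    · intro h'
      exact absurd (Finset.mem_Ico.2 ⟨h, hn⟩) h'
  · rw [h1 n (by omega), Finset.sum_eq_zero, sub_zero]
    intro m hm
    have : n ≠ m := by
      rintro rfl
      exact h (Finset.mem_Ico.1 hm).1
    simp [HahnSeries.coeff_single_of_ne this]

theorem mulAut_mem [IsArtinianRing k] [IsLocalRing k] (f : (LaurentSeries k)ˣ) :
    mulAut k f ∈ restrictedGL (powerSeriesSubmodule k) := by
  change Commensurable _ _
  rw [commensurable_iff]
  constructor
  · obtain ⟨F, hF, h⟩ := exists_fg_map_le (↑f⁻¹ : LaurentSeries k)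
    refine ⟨F.map (mulAut k f).toLinearMap, hF.map _, fun x hx => ?_⟩
    rw [← Submodule.map_sup]
    exact ⟨_, h x hx, by simp [mulAut_apply]⟩
  · obtain ⟨F, hF, h⟩ := exists_fg_map_le (f : LaurentSeries k)
    refine ⟨F, hF, ?_⟩
    rintro _ ⟨x, hx, rfl⟩
    exact h x hx

/-- The embedding of `k((t))ˣ` in the restricted general linear group of `k((t))` and `k[[t]]`:
a unit acts on `k((t))` by multiplication. -/
noncomputable def laurentGL (k : Type*) [CommRing k] [IsArtinianRing k] [IsLocalRing k] :
    (LaurentSeries k)ˣ →* restrictedGL (powerSeriesSubmodule k) :=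
  (mulAut k).codRestrict _ mulAut_mem

variable [IsLocalRing k]

/-- A winding number `w` and a family of Witt parameters `(a_i)`, `i ∈ ℤ`: here `a_0 ∈ kˣ` is
`const`, the `a_i ∈ k` with `i > 0` are `pos i`, and the `a_{-i} ∈ m` with `i > 0`, all but finitely
many of which vanish, are `neg i`. -/
structure WittParams (k : Type*) [CommRing k] [IsLocalRing k] where
  winding : ℤ
  const : kˣ
  pos : ℕ+ → k
  neg : ℕ+ →₀ IsLocalRing.maximalIdeal k

instance : Nonempty (WittParams k) :=
  ⟨⟨0, 1, 0, 0⟩⟩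

/-- The infinite product `∏_{i ≥ 1} (1 - a_i t^i)` in `k[[t]]`: its coefficient of `t^n` is that of
the product of the factors with `i ≤ n`. -/
noncomputable def posProduct (a : ℕ+ → k) : PowerSeries k :=
  PowerSeries.mk fun n => PowerSeries.coeff n
    (∏ i ∈ Finset.range n, (1 - PowerSeries.C (a i.succPNat) * PowerSeries.X ^ (i + 1)))

/-- The Laurent series `t^w · a_0 · ∏_{i ≥ 1} (1 - a_{-i} t^{-i}) · ∏_{i ≥ 1} (1 - a_i t^i)`. -/
noncomputable def WittParams.toLaurent (p : WittParams k) : LaurentSeries k :=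
  HahnSeries.single p.winding (p.const : k) *
    (p.neg.prod fun i a => 1 - HahnSeries.single (-(i : ℤ)) (a : k)) *
    HahnSeries.ofPowerSeries ℤ k (posProduct p.pos)

/-- The winding number and the Witt parameters of a unit of `k((t))`. -/
noncomputable def wittParams (f : (LaurentSeries k)ˣ) : WittParams k :=
  Classical.epsilon fun p => p.toLaurent = f

/-- The winding number `w(f)`. -/
noncomputable def winding (f : (LaurentSeries k)ˣ) : ℤ :=
  (wittParams f).winding

/-- The unit `1 - a^{j/(i,j)} b^{i/(i,j)}` of `k`, for `a ∈ k` and `b ∈ m`. -/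
noncomputable def ccUnit (a : k) (b : IsLocalRing.maximalIdeal k) (i j : ℕ+) : kˣ :=
  (IsLocalRing.isUnit_one_sub_self_of_mem_nonunits
    (a ^ ((j : ℕ) / Nat.gcd i j) * (b : k) ^ ((i : ℕ) / Nat.gcd i j)) (by
      rw [← IsLocalRing.mem_maximalIdeal]
      refine Ideal.mul_mem_left _ _ (Ideal.pow_mem_of_mem _ b.2 _ ?_)
      exact Nat.div_pos (Nat.gcd_le_left _ i.pos) (Nat.gcd_pos_of_pos_left _ i.pos))).unit

/-- The product `∏_{i ≥ 1} ∏_{j ≥ 1} (1 - a_i^{j/(i,j)} b_j^{i/(i,j)})^{(i,j)}`, all but finitely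
many factors of which are `1`, see `ccProduct_finite`. -/
noncomputable def ccProduct (a : ℕ+ → k) (b : ℕ+ →₀ IsLocalRing.maximalIdeal k) : kˣ :=
  ∏ᶠ p : ℕ+ × ℕ+, ccUnit (a p.1) (b p.2) p.1 p.2 ^ Nat.gcd p.1 p.2

theorem ccProduct_finite [IsArtinianRing k] (a : ℕ+ → k) (b : ℕ+ →₀ IsLocalRing.maximalIdeal k) :
    (Function.mulSupport fun p : ℕ+ × ℕ+ =>
      ccUnit (a p.1) (b p.2) p.1 p.2 ^ Nat.gcd p.1 p.2).Finite := by
  obtain ⟨N, hN⟩ : ∃ n, IsLocalRing.maximalIdeal k ^ n = ⊥ := by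
    rw [← IsLocalRing.jacobson_eq_maximalIdeal (⊥ : Ideal k) bot_ne_top]
    exact IsArtinianRing.isNilpotent_jacobson_bot
  have h1 : ∀ p : ℕ+ × ℕ+, (b p.2 : k) ^ ((p.1 : ℕ) / Nat.gcd p.1 p.2) = 0 →
      ccUnit (a p.1) (b p.2) p.1 p.2 ^ Nat.gcd p.1 p.2 = 1 := by
    intro p hp
    have : ccUnit (a p.1) (b p.2) p.1 p.2 = 1 := by
      ext
      simp [ccUnit, hp]
    rw [this, one_pow]
  refine Set.Finite.subset (s := ⋃ j ∈ b.support, (fun i => (i, j)) '' {i : ℕ+ | (i : ℕ) < N * j})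
    ?_ ?_
  · refine Set.Finite.biUnion b.support.finite_toSet fun j _ => Set.Finite.image _ ?_
    exact Set.Finite.preimage (PNat.coe_injective.injOn) (Set.finite_lt_nat (N * j))
  · intro p hp
    have h2 : ¬ (b p.2 : k) ^ ((p.1 : ℕ) / Nat.gcd p.1 p.2) = 0 := fun h => hp (h1 p h)
    simp only [Set.mem_iUnion, Set.mem_image, Set.mem_ofPred_eq]
    refine ⟨p.2, ?_, p.1, ?_, rfl⟩
    · rw [Finsupp.mem_support_iff]
      intro h
      apply h2
      rw [h]
      refine zero_pow (Nat.ne_of_gt ?_)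
      exact Nat.div_pos (Nat.gcd_le_left _ p.1.pos) (Nat.gcd_pos_of_pos_left _ p.1.pos)
    · by_contra h3
      apply h2
      have h4 : N ≤ (p.1 : ℕ) / Nat.gcd p.1 p.2 := by
        rw [Nat.le_div_iff_mul_le (Nat.gcd_pos_of_pos_left _ p.1.pos)]
        exact (Nat.mul_le_mul_left N (Nat.gcd_le_right _ p.2.pos)).trans (not_lt.1 h3)
      have h5 := Ideal.pow_le_pow_right h4 (Ideal.pow_mem_pow (b p.2).2 _)
      rw [hN] at h5
      simpa using h5

/-- The Contou-Carrère symbol `⟨f, g⟩`. -/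
noncomputable def contouCarrere (f g : (LaurentSeries k)ˣ) : kˣ :=
  (-1) ^ (winding f * winding g) *
    ((wittParams f).const ^ winding g / (wittParams g).const ^ winding f) *
    (ccProduct (wittParams f).pos (wittParams g).neg /
      ccProduct (wittParams g).pos (wittParams f).neg)

/-- `h` is the Laurent series `f(τ)` obtained from `f = ∑ f_n t^n` by substituting `τ` for `t`:
`h = ∑ f_n τ^n`, where the sum of the coefficients of `t^d` is finite for every `d`. -/
def IsSubstitution (τ : (LaurentSeries k)ˣ) (f h : LaurentSeries k) : Prop :=
  ∀ d : ℤ, (Function.support fun n : ℤ =>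
      f.coeff n * ((τ ^ n : (LaurentSeries k)ˣ) : LaurentSeries k).coeff d).Finite ∧
    h.coeff d = ∑ᶠ n : ℤ, f.coeff n * ((τ ^ n : (LaurentSeries k)ˣ) : LaurentSeries k).coeff d

end Laurent

end CommDet

/-!
Let `K = k((t))` and `{f, g}` the commutator symbol of the multiplication operators by `f, g ∈ Kˣ`.

*The central extension.* Any two morphisms `A → B` of the determinant groupoid differ by a unique
scalar of `kˣ`, and the groupoid is connected. Hence an element of the extension over `σ` is the
same as one morphism `A → σA` for a single object `A`: morphisms out of `A` transport it to all
other objects. This gives exactness, centrality and the existence of liftings. An object exists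
because `k[[t]]` is free: it is flat, being a power of a noetherian ring, and flat modules over an
artinian local ring are free. The commutator symbol is then well defined, bimultiplicative,
alternating and invariant under conjugation, and `{σ, τ}` can be read off from the two composites
`A → σA → στA` and `A → τA → τσA`.

*Computation of the symbol.* Weierstrass preparation writes a unit of `K` as a product of a power
of `t`, a distinguished polynomial and a unit of `k[[t]]`. Three cases determine `{f, g}`.
* Two units of `k[[t]]` fix the object `k[[t]]` and have trivial symbol.
* If `q` is a distinguished polynomial and `u` a unit of `k[[t]]`, then `{q, u}` is the determinant
  of `u` on `k[[t]] / (q) = k[X] / (q)`, that is, the norm of `u` (`symbol_psUnit_right`). For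
  `q = X ^ j - c` and `u = 1 - a X ^ i` the norm is a resultant, which the euclidean algorithm on
  `(i, j)` evaluates to `(1 - a ^ (j / (i, j)) * c ^ (i / (i, j))) ^ (i, j)`
  (`norm_one_sub_mul_X_pow`).
* Two distinguished polynomials `q`, `r` have trivial symbol (`symbol_distinguished`): the bases of
  `k[[t]] / (q r)` adapted to the submodules `(q) / (q r)` and `(r) / (q r)` have transition
  matrices to the monomial basis which are the Sylvester matrices of `(1, q)` and of `(1, r)`, and
  both determinants are `(-1) ^ (deg q * deg r)`.

As `1 - c t ^ (-j) = (t ^ j - c) / t ^ j`, bimultiplicativity now yields `{f, g}` in terms of the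
Witt parameters of `f` and `g` (`symbol_eq`), which is the formula defining the Contou-Carrère
symbol, up to inversion and a sign. Bimultiplicativity of the latter follows, since the winding
number is the order of the reduction of `f` modulo the maximal ideal `m`, hence additive.

*The presentation.* A power series with constant coefficient `1` is uniquely a product
`∏ (1 - a_i X ^ i)`. If it is a polynomial of degree `d` with further coefficients in `m`, then
`a_i ∈ m ^ ⌈i / (d + 1)⌉`, which vanishes for large `i`; applied to the reversed distinguished
polynomial this gives the factors `1 - a_{-i} t ^ (-i)`. Uniqueness holds because a polynomial in
`t⁻¹` which is a power series in `t` is constant.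

*Reparameterization.* If `w(τ) = 1`, then `τ ^ n` has order at least `n - D`, with `D` independent
of `n`, and the matrix of `∑ f_n t ^ n ↦ ∑ f_n τ ^ n` is triangular modulo `m`, with invertible
diagonal. As `m` is nilpotent, the map is bijective, and it belongs to the restricted general linear
group. It conjugates multiplication by `f` to multiplication by `f(τ)`, so it preserves the
commutator symbol; it also preserves winding numbers.
-/

namespace CommDet

/-! ### The sets of morphisms of the determinant groupoid -/

section Torsor

variable {k : Type*} [CommRing k] [IsArtinianRing k] [IsLocalRing k]
  {V : Type*} [AddCommGroup V] [Module k V] {W : Submodule k V}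

/-- Two isomorphisms between determinants of free modules differ by a unit. -/
theorem exists_unit_smul_eq {M N : Type*} [AddCommGroup M] [Module k M] [AddCommGroup N]
    [Module k N] [Module.Free k M] [Module.Finite k M] [Module.Free k N] [Module.Finite k N]
    (α β : DetModule k M ≃ₗ[k] DetModule k N) : ∃ x : kˣ, β = x • α := by
  let e := Module.finBasis k M
  let γ : k ≃ₗ[k] k := ((detEquiv e).symm.trans (β.trans α.symm)).trans (detEquiv e)
  have hγ : ∀ c, γ c = c * γ 1 := fun c => by
    rw [← smul_eq_mul, ← map_smul, smul_eq_mul, mul_one]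
  have hu : IsUnit (γ 1) := by
    obtain ⟨c, hc⟩ := γ.surjective 1
    rw [hγ] at hc
    exact IsUnit.of_mul_eq_one_right _ hc
  refine ⟨hu.unit, LinearEquiv.ext fun y => ?_⟩
  have h1 : (detEquiv e) (α.symm (β y)) = γ 1 * (detEquiv e) y := by
    have : γ ((detEquiv e) y) = (detEquiv e) (α.symm (β y)) := by simp [γ]
    rw [← this, hγ, mul_comm]
  have h2 : α.symm (β y) = γ 1 • y := by
    apply (detEquiv e).injective
    rw [h1, map_smul, smul_eq_mul]
  rw [LinearEquiv.symm_apply_eq, map_smul] at h2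
  exact h2

theorem unit_smul_injective {M N : Type*} [AddCommGroup M] [Module k M] [AddCommGroup N]
    [Module k N] [Module.Free k M] [Module.Finite k M] [Module.Free k N] [Module.Finite k N]
    {α : DetModule k M ≃ₗ[k] DetModule k N} {x y : kˣ} (h : x • α = y • α) : x = y := by
  let e := Module.finBasis k M
  have h1 : (x : k) • α (wedge e) = (y : k) • α (wedge e) :=
    congrArg (fun β : DetModule k M ≃ₗ[k] DetModule k N => β (wedge e)) h
  rw [← map_smul, ← map_smul] at h1
  have h2 := congrArg (detEquiv e) (α.injective h1)
  rw [map_smul, map_smul, detEquiv_wedge] at h2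
  exact Units.ext (by simpa using h2)

/-- `Det(A, B)` has at most one orbit under scalar multiplication. -/
theorem Det.exists_smul_eq {A B : Obj W} (α β : Det A.carrier B.carrier) :
    ∃ x : kˣ, β = x • α := by
  obtain ⟨P, hA, h⟩ := Obj.exists_cofree [B] A
  have hB := h B (by simp)
  have := hA.quot_free
  have := hA.quot_finite
  have := hB.quot_free
  have := hB.quot_finite
  obtain ⟨x, hx⟩ := exists_unit_smul_eq (α.app ⟨P, hA, hB⟩) (β.app ⟨P, hA, hB⟩)
  exact ⟨x, Det.eq_of_app ⟨P, hA, hB⟩ hx⟩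

theorem Det.smul_injective {A B : Obj W} {α : Det A.carrier B.carrier} {x y : kˣ}
    (h : x • α = y • α) : x = y := by
  obtain ⟨P, hA, h'⟩ := Obj.exists_cofree [B] A
  have hB := h' B (by simp)
  have := hA.quot_free
  have := hA.quot_finite
  have := hB.quot_free
  have := hB.quot_finite
  exact unit_smul_injective (congrArg (fun γ : Det A.carrier B.carrier => γ.app ⟨P, hA, hB⟩) h)

theorem Det.nonempty (A B : Obj W) : Nonempty (Det A.carrier B.carrier) := by
  obtain ⟨P, hA, h⟩ := Obj.exists_cofree [B] A
  have hB := h B (by simp)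
  have := hA.quot_free
  have := hA.quot_finite
  have := hB.quot_free
  have := hB.quot_finite
  obtain ⟨α, -⟩ := Det.exists_app ⟨P, hA, hB⟩
    ((detEquiv (Module.finBasis k (RelQuot A.carrier P))).trans
      (detEquiv (Module.finBasis k (RelQuot B.carrier P))).symm)
  exact ⟨α⟩

/-- Morphisms of the groupoid are invertible, hence cancel on the left. -/
theorem comp_left_cancel {A B C : Obj W} (α : Det A.carrier B.carrier)
    {β γ : Det B.carrier C.carrier} (h : comp α β = comp α γ) : β = γ := by
  rw [← id_comp β, ← id_comp γ, ← inv_comp α, comp_assoc, comp_assoc, h]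

/-- Transport of structure sends the identification of equal objects to such an identification. -/
theorem push_ofEq (σ : V ≃ₗ[k] V) {A B A' B' : Obj W} (h : A = B) (h' : A' = B')
    (hA : A'.carrier = A.carrier.map σ.toLinearMap)
    (hB : B'.carrier = B.carrier.map σ.toLinearMap) :
    push σ hA hB (ofEq h) = ofEq h' := by
  subst h
  exact CentralExt.push_id_eq_ofEq σ h' hA hB

end Torsor

/-! ### Exactness of the central extension -/

namespace CentralExt

variable {k : Type*} [CommRing k] [IsArtinianRing k] [IsLocalRing k]
  {V : Type*} [AddCommGroup V] [Module k V] {W : Submodule k V}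

/-- As the groupoid is connected, an element of the central extension is determined by its image in
the restricted general linear group and its value at one object. -/
theorem ext_at {s t : CentralExt W} (A : Obj W) (h : s.base = t.base)
    (h' : comp (s.app A) (ofEq (congrArg (· • A) h)) = t.app A) : s = t := by
  obtain ⟨σ, Φ, hΦ⟩ := s
  obtain ⟨τ, Ψ, hΨ⟩ := t
  obtain rfl : σ = τ := h
  have hA : Φ A = Ψ A := (comp_id _).symm.trans h'
  have : Φ = Ψ := by
    funext B
    obtain ⟨α⟩ := Det.nonempty A B
    apply comp_left_cancel α
    rw [← hΦ, ← hΨ, hA]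
  subst this
  rfl

theorem comp_app_ofEq {s t : CentralExt W} (h : s = t) (A : Obj W) :
    comp (s.app A) (ofEq (by rw [h])) = t.app A := by
  subst h
  exact comp_id _

theorem scalar_mul_app (x : kˣ) (s : CentralExt W) (A : Obj W)
    (h : (scalar W x * s).base • A = s.base • A) :
    comp ((scalar W x * s).app A) (ofEq h) = x • s.app A := by
  have h1 := comp_ofEq_push (1 : V ≃ₗ[k] V) rfl (one_smul (restrictedGL W) A).symm
    (h.symm : s.base • A = (scalar W x * s).base • A) (smul_carrier 1 A)
    (mul_smul_carrier 1 s.base A) (s.app A)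
  have h2 : (scalar W x * s).app A = x • comp (s.app A) (ofEq h.symm) := by
    rw [← h1, ← smul_comp]
    rfl
  rw [h2, smul_comp, comp_assoc, ofEq_comp_ofEq, ofEq_rfl, comp_id]

theorem scalar_injective [Nonempty (Obj W)] : Function.Injective (scalar W) := by
  intro x y h
  obtain ⟨A⟩ := ‹Nonempty (Obj W)›
  have h1 : comp (x • ofEq (one_smul (restrictedGL W) A).symm) (ofEq rfl) =
      y • ofEq (one_smul (restrictedGL W) A).symm := comp_app_ofEq h A
  rw [ofEq_rfl, comp_id] at h1
  exact Det.smul_injective h1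

/-- An identity `Φ'(A) = x Φ(A)` at one object `A` implies `(σ, Φ') = x (σ, Φ)`. -/
theorem eq_scalar_mul {s t : CentralExt W} (A : Obj W) (h : t.base = s.base) (x : kˣ)
    (h' : comp (t.app A) (ofEq (congrArg (· • A) h)) = x • s.app A) : t = scalar W x * s := by
  have h1 : t.base = (scalar W x * s).base := h.trans (one_mul s.base).symm
  refine ext_at A h1 ?_
  have h2 : s.base • A = (scalar W x * s).base • A := congrArg (· • A) (one_mul s.base).symm
  have h3 := scalar_mul_app x s A h2.symm
  rw [← h'] at h3
  have h4 := congrArg (fun β => comp β (ofEq h2)) h3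
  simp only [comp_assoc, ofEq_comp_ofEq, ofEq_rfl, comp_id] at h4
  exact h4.symm

theorem exists_eq_scalar_mul [Nonempty (Obj W)] {s t : CentralExt W} (h : t.base = s.base) :
    ∃ x : kˣ, t = scalar W x * s := by
  obtain ⟨A⟩ := ‹Nonempty (Obj W)›
  obtain ⟨x, hx⟩ := Det.exists_smul_eq (s.app A) (comp (t.app A) (ofEq (congrArg (· • A) h)))
  exact ⟨x, eq_scalar_mul A h x hx⟩

theorem range_scalar [Nonempty (Obj W)] : (scalar W).range = (proj W).ker := by
  ext s
  constructor
  · rintro ⟨x, rfl⟩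
    rfl
  · intro hs
    have hs' : s.base = (1 : CentralExt W).base := MonoidHom.mem_ker.1 hs
    obtain ⟨x, hx⟩ : ∃ x : kˣ, s = scalar W x * 1 := exists_eq_scalar_mul (s := 1) hs'
    exact ⟨x, (hx.trans (mul_one _)).symm⟩

theorem scalar_mul_comm [Nonempty (Obj W)] (x : kˣ) (s : CentralExt W) :
    s * scalar W x = scalar W x * s := by
  obtain ⟨A⟩ := ‹Nonempty (Obj W)›
  have h0 : (s * scalar W x).base = s.base := mul_one s.base
  refine eq_scalar_mul A h0 x ?_
  have h : s.base • A = (s.base * 1) • A := by rw [mul_one]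
  have h1 : (s * scalar W x).app A = x • comp (s.app A) (ofEq h) := by
    rw [← comp_smul, ← push_ofEq s.base.1 (one_smul (restrictedGL W) A).symm h
      (smul_carrier s.base A) (mul_smul_carrier s.base 1 A), ← push_smul]
    rfl
  rw [h1]
  refine (smul_comp x (comp (s.app A) (ofEq h)) (ofEq h.symm)).trans ?_
  rw [comp_assoc, ofEq_comp_ofEq, ofEq_rfl, comp_id]

theorem range_scalar_le_center [Nonempty (Obj W)] :
    (scalar W).range ≤ Subgroup.center (CentralExt W) := by
  rintro _ ⟨x, rfl⟩
  rw [Subgroup.mem_center_iff]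
  exact fun s => scalar_mul_comm x s

/-- Every morphism `φ : A → σA` extends to a lifting `(σ, Φ)` of `σ` with `Φ(A) = φ`: at another
object `B`, conjugate `φ` by any morphism `A → B`. The result does not depend on that morphism,
since two of them differ by a scalar. -/
theorem exists_lift (σ : restrictedGL W) (A : Obj W) (φ : Det A.carrier (σ • A).carrier) :
    ∃ s : CentralExt W, ∃ h : s.base = σ, comp (s.app A) (ofEq (congrArg (· • A) h)) = φ := by
  let α : ∀ B : Obj W, Det A.carrier B.carrier := fun B => (Det.nonempty A B).some
  let Φ : ∀ B : Obj W, Det B.carrier (σ • B).carrier := fun B =>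
    comp (α B).inv (comp φ (push σ.1 (smul_carrier σ A) (smul_carrier σ B) (α B)))
  have hΦ : ∀ B, comp (α B) (Φ B) =
      comp φ (push σ.1 (smul_carrier σ A) (smul_carrier σ B) (α B)) := by
    intro B
    rw [← comp_assoc, comp_inv, id_comp]
  -- any morphism out of `A`, not only the chosen one, computes `Φ`
  have key : ∀ (B : Obj W) (β : Det A.carrier B.carrier), comp β (Φ B) =
      comp φ (push σ.1 (smul_carrier σ A) (smul_carrier σ B) β) := by
    intro B β
    obtain ⟨x, rfl⟩ := Det.exists_smul_eq (α B) β
    rw [smul_comp, push_smul, comp_smul, hΦ]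
  refine ⟨⟨σ, Φ, fun B C β => ?_⟩, rfl, ?_⟩
  · apply comp_left_cancel (α B)
    rw [← comp_assoc, key, comp_assoc, ← push_comp, ← key, comp_assoc]
  · have := key A (Det.id _)
    rw [id_comp, push_id_eq_ofEq σ.1 rfl] at this
    exact (comp_id _).trans (this.trans (comp_id _))

theorem proj_surjective [Nonempty (Obj W)] : Function.Surjective (proj W) := by
  intro σ
  obtain ⟨A⟩ := ‹Nonempty (Obj W)›
  obtain ⟨φ⟩ := Det.nonempty A (σ • A)
  obtain ⟨s, h, -⟩ := exists_lift σ A φ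
  exact ⟨s, h⟩

end CentralExt

/-! ### Commutators modulo the centre -/

section Commutator

variable {E : Type*} [Group E]

theorem commutator_central_mul {y z : E} (hy : ∀ e, e * y = y * e) (hz : ∀ e, e * z = z * e)
    (s t : E) : y * s * (z * t) * (y * s)⁻¹ * (z * t)⁻¹ = s * t * s⁻¹ * t⁻¹ := by
  calc y * s * (z * t) * (y * s)⁻¹ * (z * t)⁻¹
      = y * (s * z) * t * s⁻¹ * (y⁻¹ * t⁻¹) * z⁻¹ := by group
    _ = (z * (y * s * t * s⁻¹ * t⁻¹ * y⁻¹)) * z⁻¹ := by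
      have h : y⁻¹ * t⁻¹ = t⁻¹ * y⁻¹ := by rw [← mul_inv_rev, ← mul_inv_rev, hy]
      rw [h, hz s, ← mul_assoc y, hz y]
      group
    _ = y * (s * t * s⁻¹ * t⁻¹) * y⁻¹ := by
      rw [← hz]
      group
    _ = s * t * s⁻¹ * t⁻¹ := by
      rw [← hy]
      group

theorem commutator_eq_iff {s t x : E} : s * t * s⁻¹ * t⁻¹ = x ↔ s * t = x * (t * s) := by
  rw [mul_inv_eq_iff_eq_mul, mul_inv_eq_iff_eq_mul, mul_assoc]

theorem conj_mul_conj_of_central {r s t x : E} (hx : r * x = x * r) (h : s * t = x * (t * s)) :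
    r * s * r⁻¹ * (r * t * r⁻¹) = x * (r * t * r⁻¹ * (r * s * r⁻¹)) := by
  calc r * s * r⁻¹ * (r * t * r⁻¹) = r * (s * t) * r⁻¹ := by group
    _ = r * x * (t * s) * r⁻¹ := by rw [h, mul_assoc r x]
    _ = _ := by rw [hx]; group

end Commutator

/-! ### The commutator symbol -/

section CommSymbol

open CentralExt

variable {k : Type*} [CommRing k] [IsArtinianRing k] [IsLocalRing k]
  {V : Type*} [AddCommGroup V] [Module k V] {W : Submodule k V} [Nonempty (Obj W)]

theorem commSymbol_spec {σ τ : restrictedGL W} (h : Commute σ τ) (s t : CentralExt W)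
    (hs : proj W s = σ) (ht : proj W t = τ) :
    s * t * s⁻¹ * t⁻¹ = scalar W (commSymbol W σ τ) := by
  have hex : ∃ x : kˣ, ∀ s t : CentralExt W, proj W s = σ → proj W t = τ →
      s * t * s⁻¹ * t⁻¹ = scalar W x := by
    obtain ⟨s, hs⟩ := proj_surjective σ
    obtain ⟨t, ht⟩ := proj_surjective τ
    have h1 : s * t * s⁻¹ * t⁻¹ ∈ (proj W).ker := by
      rw [MonoidHom.mem_ker, map_mul, map_mul, map_mul, map_inv, map_inv, hs, ht,
        commutator_eq_iff.2 (h.eq.trans (one_mul _).symm)]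
    rw [← range_scalar] at h1
    obtain ⟨x, hx⟩ := h1
    refine ⟨x, fun s' t' hs' ht' => ?_⟩
    obtain ⟨y, rfl⟩ := exists_eq_scalar_mul (s := s) (t := s') (hs'.trans hs.symm)
    obtain ⟨z, rfl⟩ := exists_eq_scalar_mul (s := t) (t := t') (ht'.trans ht.symm)
    rw [commutator_central_mul (scalar_mul_comm y) (scalar_mul_comm z), hx]
  exact Classical.epsilon_spec hex s t hs ht

theorem commSymbol_eq_of_mul_eq {s t : CentralExt W} {x : kˣ}
    (h : Commute (proj W s) (proj W t)) (hst : s * t = scalar W x * (t * s)) :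
    commSymbol W (proj W s) (proj W t) = x := by
  apply scalar_injective (W := W)
  rw [← commSymbol_spec h s t rfl rfl]
  exact commutator_eq_iff.2 hst

theorem mul_eq_commSymbol {s t : CentralExt W} (h : Commute (proj W s) (proj W t)) :
    s * t = scalar W (commSymbol W (proj W s) (proj W t)) * (t * s) :=
  commutator_eq_iff.1 (commSymbol_spec h s t rfl rfl)

theorem commSymbol_mul_left {σ σ' τ : restrictedGL W} (h : Commute σ τ) (h' : Commute σ' τ) :
    commSymbol W (σ * σ') τ = commSymbol W σ τ * commSymbol W σ' τ := by
  obtain ⟨s, rfl⟩ := proj_surjective σ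
  obtain ⟨s', rfl⟩ := proj_surjective σ'
  obtain ⟨t, rfl⟩ := proj_surjective τ
  rw [← map_mul]
  refine commSymbol_eq_of_mul_eq (by rw [map_mul]; exact h.mul_left h') ?_
  rw [mul_assoc, mul_eq_commSymbol h', ← mul_assoc s, scalar_mul_comm, mul_assoc, ← mul_assoc s,
    mul_eq_commSymbol h, ← mul_assoc, ← mul_assoc, ← mul_assoc, ← map_mul,
    mul_comm (commSymbol W (proj W s') _)]
  simp only [mul_assoc]

theorem commSymbol_swap {σ τ : restrictedGL W} (h : Commute σ τ) :
    commSymbol W τ σ = (commSymbol W σ τ)⁻¹ := by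
  obtain ⟨s, rfl⟩ := proj_surjective σ
  obtain ⟨t, rfl⟩ := proj_surjective τ
  refine commSymbol_eq_of_mul_eq h.symm ?_
  rw [mul_eq_commSymbol h, ← mul_assoc, ← map_mul, inv_mul_cancel, map_one, one_mul]

theorem commSymbol_self (σ : restrictedGL W) : commSymbol W σ σ = 1 := by
  obtain ⟨s, rfl⟩ := proj_surjective σ
  exact commSymbol_eq_of_mul_eq (Commute.refl _) (by rw [map_one, one_mul])

theorem commSymbol_mul_right {σ τ τ' : restrictedGL W} (h : Commute σ τ) (h' : Commute σ τ') :
    commSymbol W σ (τ * τ') = commSymbol W σ τ * commSymbol W σ τ' := by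
  rw [commSymbol_swap (h.mul_right h').symm, commSymbol_mul_left h.symm h'.symm, mul_inv,
    commSymbol_swap h.symm, commSymbol_swap h'.symm]

theorem commSymbol_conj (ρ : restrictedGL W) {σ τ : restrictedGL W} (h : Commute σ τ) :
    commSymbol W (ρ * σ * ρ⁻¹) (ρ * τ * ρ⁻¹) = commSymbol W σ τ := by
  obtain ⟨s, rfl⟩ := proj_surjective σ
  obtain ⟨t, rfl⟩ := proj_surjective τ
  obtain ⟨r, rfl⟩ := proj_surjective ρ
  have h1 : Commute (proj W r * proj W s * (proj W r)⁻¹) (proj W r * proj W t * (proj W r)⁻¹) :=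
    (SemiconjBy.conj_iff (a := proj W s) (x := proj W t) (y := proj W t) (b := proj W r)).2 h
  simp only [← map_inv, ← map_mul] at h1 ⊢
  exact commSymbol_eq_of_mul_eq h1
    (conj_mul_conj_of_central (scalar_mul_comm _ _) (mul_eq_commSymbol h))

/-- The commutator symbol compares the two composites `A → σA → στA` and `A → τA → τσA = στA`
obtained from arbitrary morphisms `A → σA` and `A → τA`. -/
theorem commSymbol_eq_of_comp {σ τ : restrictedGL W} (h : Commute σ τ) {A B C D : Obj W}
    (hB : B.carrier = A.carrier.map σ.1.toLinearMap)
    (hC : C.carrier = A.carrier.map τ.1.toLinearMap)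
    (hD : D.carrier = C.carrier.map σ.1.toLinearMap)
    (hD' : D.carrier = B.carrier.map τ.1.toLinearMap)
    (α : Det A.carrier B.carrier) (β : Det A.carrier C.carrier) {x : kˣ}
    (hx : comp α (push σ.1 hB hD β) = x • comp β (push τ.1 hC hD' α)) :
    commSymbol W σ τ = x := by
  obtain rfl : B = σ • A := Obj.ext hB
  obtain rfl : C = τ • A := Obj.ext hC
  have hD1 : D = (σ * τ) • A := by
    rw [mul_smul]
    exact Obj.ext hD
  subst hD1
  obtain ⟨s, rfl, hs⟩ := exists_lift σ A α
  obtain ⟨t, rfl, ht⟩ := exists_lift τ A β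
  have hs' : s.app A = α := (comp_id _).symm.trans hs
  have ht' : t.app A = β := (comp_id _).symm.trans ht
  refine commSymbol_eq_of_mul_eq h (eq_scalar_mul A h.eq x ?_)
  have e : (s.base * t.base) • A = (t.base * s.base) • A := by rw [h.eq]
  subst hs' ht'
  have h1 : (s * t).app A = x • comp (t.app A) (push t.base.1 hC hD' (s.app A)) := hx
  change comp ((s * t).app A) (ofEq e) = x • (t * s).app A
  rw [h1, smul_comp, comp_assoc, push_comp_ofEq t.base.1 hC hD' e (mul_smul_carrier _ _ _)]
  rfl

end CommSymbol

/-! ### Freeness of the module of power series -/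

section Free

/-- Over a noetherian ring, a power of the ring is flat: the syzygies of a finite family of scalars
are finitely generated, hence solve a linear relation in all coordinates simultaneously. -/
theorem flat_pi (k : Type*) [CommRing k] [IsNoetherianRing k] (X : Type*) :
    Module.Flat k (X → k) := by
  refine Module.Flat.of_forall_isTrivialRelation ?_
  intro l f x hx
  let S : Submodule k (Fin l → k) := LinearMap.ker (Fintype.linearCombination k f)
  have hS : S.FG := IsNoetherian.noetherian S
  obtain ⟨n, y, hy⟩ := Submodule.fg_iff_exists_fin_generating_family.1 hS
  have hx' : ∀ c : X, ∃ a : Fin n → k, ∑ j, a j • y j = fun i => x i c := by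
    intro c
    rw [← Submodule.mem_span_range_iff_exists_fun, hy, LinearMap.mem_ker,
      Fintype.linearCombination_apply]
    have := congrFun hx c
    simpa [mul_comm] using this
  choose a ha using hx'
  refine ⟨n, fun i j => y j i, fun j c => a c j, fun i => ?_, fun j => ?_⟩
  · funext c
    have := congrFun (ha c) i
    simp only [Finset.sum_apply, Pi.smul_apply, smul_eq_mul] at this
    simp [← this, mul_comm]
  · have h1 : y j ∈ S := hy ▸ Submodule.subset_span ⟨j, rfl⟩
    rw [LinearMap.mem_ker, Fintype.linearCombination_apply] at h1
    simpa [mul_comm] using h1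

theorem exists_maximalIdeal_pow_eq_bot (k : Type*) [CommRing k] [IsArtinianRing k]
    [IsLocalRing k] : ∃ n, IsLocalRing.maximalIdeal k ^ n = ⊥ := by
  rw [← IsLocalRing.jacobson_eq_maximalIdeal (⊥ : Ideal k) bot_ne_top]
  exact IsArtinianRing.isNilpotent_jacobson_bot

/-- Nakayama's lemma for a nilpotent ideal, without finiteness of the module. -/
theorem top_le_of_top_le_sup_smul {k M : Type*} [CommRing k] [AddCommGroup M] [Module k M]
    {I : Ideal k} {n : ℕ} (hI : I ^ n = ⊥) (N : Submodule k M)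
    (h : (⊤ : Submodule k M) ≤ N ⊔ I • (⊤ : Submodule k M)) : (⊤ : Submodule k M) ≤ N := by
  have key : ∀ j, (⊤ : Submodule k M) ≤ N ⊔ I ^ j • (⊤ : Submodule k M) := by
    intro j
    induction j with
    | zero => simp
    | succ j ih =>
      refine ih.trans (sup_le le_sup_left ?_)
      calc I ^ j • (⊤ : Submodule k M) ≤ I ^ j • (N ⊔ I • (⊤ : Submodule k M)) :=
            Submodule.smul_mono le_rfl h
        _ ≤ _ := by
          rw [Submodule.smul_sup, pow_succ, mul_smul]
          exact sup_le_sup_right Submodule.smul_le_right _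
  simpa [hI] using key n

/-- A flat module over an artinian local ring is free: a basis of its reduction lifts to a basis,
the maximal ideal being nilpotent. -/
theorem free_of_flat_of_isArtinian.{u} {k M : Type u} [CommRing k] [IsArtinianRing k]
    [IsLocalRing k] [AddCommGroup M] [Module k M] [Module.Flat k M] : Module.Free k M := by
  let w := Module.Free.chooseBasis (IsLocalRing.ResidueField k)
    (TensorProduct k (IsLocalRing.ResidueField k) M)
  obtain ⟨v, eq⟩ := (TensorProduct.mk_surjective k M (IsLocalRing.ResidueField k)
    Ideal.Quotient.mk_surjective).comp_left w
  have h3 : (TensorProduct.mk k (IsLocalRing.ResidueField k) M 1 : M → _) ∘ v = w := eq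
  have hv : LinearIndependent k v := by
    refine IsLocalRing.linearIndependent_of_flat v ?_
    have h := w.linearIndependent
    rw [← h3] at h
    exact h
  obtain ⟨n, hn⟩ := exists_maximalIdeal_pow_eq_bot k
  refine Module.Free.of_basis (Basis.mk hv (top_le_of_top_le_sup_smul hn _ fun x _ => ?_))
  have h1 : TensorProduct.mk k (IsLocalRing.ResidueField k) M 1 x ∈
      (Submodule.span k (Set.range v)).map
        (TensorProduct.mk k (IsLocalRing.ResidueField k) M 1) := by
    rw [Submodule.map_span, ← Set.range_comp]
    have h2 : Submodule.span k (Set.range w) = ⊤ := by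
      rw [← Submodule.restrictScalars_span k (IsLocalRing.ResidueField k)
        Ideal.Quotient.mk_surjective, Submodule.restrictScalars_eq_top_iff, w.span_eq]
    rw [h3, h2]
    trivial
  obtain ⟨y, hy, hyx⟩ := h1
  have h4 : x - y ∈ LinearMap.ker (TensorProduct.mk k (IsLocalRing.ResidueField k) M 1) := by
    rw [LinearMap.mem_ker, map_sub, hyx, sub_self]
  erw [LinearMap.ker_tensorProductMk] at h4
  rw [← add_sub_cancel y x]
  exact Submodule.add_mem_sup hy h4

/-- The `k`-linear isomorphism of the formal power series with the submodule `k[[t]]` of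
`k((t))`. -/
noncomputable def powerSeriesEquiv (k : Type*) [CommRing k] :
    (PowerSeries k) ≃ₗ[k] powerSeriesSubmodule k :=
  LinearEquiv.ofBijective
    (LinearMap.codRestrict (powerSeriesSubmodule k)
      { toFun := fun q => HahnSeries.ofPowerSeries ℤ k q
        map_add' := fun p q => map_add _ p q
        map_smul' := fun c q => by
          rw [PowerSeries.smul_eq_C_mul, map_mul, HahnSeries.ofPowerSeries_C,
            HahnSeries.C_mul_eq_smul, RingHom.id_apply] }
      (fun q n hn => by
        change HahnSeries.coeff (HahnSeries.ofPowerSeries ℤ k q) n = 0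
        rw [PowerSeries.coeff_coe, if_pos hn]))
    ⟨fun p q h => HahnSeries.ofPowerSeries_injective (congrArg Subtype.val h), fun x => by
      obtain ⟨q, hq⟩ := exists_powerSeries x.2
      exact ⟨q, Subtype.ext hq⟩⟩

theorem free_powerSeriesSubmodule (k : Type*) [CommRing k] [IsArtinianRing k] [IsLocalRing k] :
    Module.Free k (powerSeriesSubmodule k) := by
  have h : Module.Flat k (PowerSeries k) := flat_pi k (Unit →₀ ℕ)
  have : Module.Free k (PowerSeries k) := free_of_flat_of_isArtinian
  exact Module.Free.of_equiv (powerSeriesEquiv k)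

/-- The object `k[[t]]` of the determinant groupoid. -/
def stdObj (k : Type*) [CommRing k] [IsArtinianRing k] [IsLocalRing k] :
    Obj (powerSeriesSubmodule k) :=
  ⟨powerSeriesSubmodule k, free_powerSeriesSubmodule k, Commensurable.refl _⟩

instance (k : Type*) [CommRing k] [IsArtinianRing k] [IsLocalRing k] :
    Nonempty (Obj (powerSeriesSubmodule k)) :=
  ⟨stdObj k⟩

end Free

/-! ### Commutator symbols and determinants -/

section Criteria

variable {k : Type*} [CommRing k] [IsArtinianRing k] [IsLocalRing k]
  {V : Type*} [AddCommGroup V] [Module k V] {W : Submodule k V}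

theorem subsingleton_relQuot_self (B : Submodule k V) : Subsingleton (RelQuot B B) := by
  rw [Submodule.Quotient.subsingleton_iff, Submodule.submoduleOf_self]

/-- The empty basis of `B / B`. -/
noncomputable def zeroBasis (B : Submodule k V) : Basis (Fin 0) k (RelQuot B B) :=
  have := subsingleton_relQuot_self B
  Basis.empty _

theorem IsCofree.refl {B : Submodule k V} (h : Module.Free k B) : IsCofree B B :=
  have := subsingleton_relQuot_self B
  ⟨le_rfl, h, inferInstance, inferInstance⟩

theorem wedge_fin_zero {M : Type*} [AddCommGroup M] [Module k M] (e e' : Basis (Fin 0) k M) :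
    wedge e = wedge e' :=
  congrArg wedge (Basis.eq_of_apply_eq fun i => i.elim0)

theorem linearEquiv_ext_wedge {M N : Type*} [AddCommGroup M] [Module k M] [AddCommGroup N]
    [Module k N] {n : ℕ} (e : Basis (Fin n) k M) {α β : DetModule k M ≃ₗ[k] DetModule k N}
    (h : α (wedge e) = β (wedge e)) : α = β := by
  apply LinearEquiv.ext
  intro x
  rw [eq_smul_wedge e x, map_smul, map_smul, h]

theorem conj_wedge {M N M' N' : Type*} [AddCommGroup M] [Module k M] [AddCommGroup N]
    [Module k N] [AddCommGroup M'] [Module k M'] [AddCommGroup N'] [Module k N'] {m n : ℕ}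
    (f : M ≃ₗ[k] N) (g : M' ≃ₗ[k] N') (α : DetModule k M ≃ₗ[k] DetModule k M')
    (e : Basis (Fin m) k M) (e' : Basis (Fin n) k M') (h : α (wedge e) = wedge e') :
    conj f g α (wedge (e.map f)) = wedge (e'.map g) := by
  rw [← detCongr_wedge, ← detCongr_wedge, ← h]
  simp [conj]

/-- The morphism `A → B` attached to an ordered basis `e` of `A / B`, where `B ≤ A`: it sends
`e₀ ∧ ⋯ ∧ e_{n-1}` to `1`. -/
theorem exists_det_of_basis {A B : Obj W} (h : IsCofree B.carrier A.carrier) {n : ℕ}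
    (e : Basis (Fin n) k (RelQuot A.carrier B.carrier)) :
    ∃ α : Det A.carrier B.carrier, α.app ⟨B.carrier, h, IsCofree.refl B.free⟩ (wedge e) =
      wedge (zeroBasis B.carrier) := by
  obtain ⟨α, hα⟩ := Det.exists_app ⟨B.carrier, h, IsCofree.refl B.free⟩
    ((detEquiv e).trans (detEquiv (zeroBasis B.carrier)).symm)
  refine ⟨α, ?_⟩
  rw [hα, LinearEquiv.trans_apply, LinearEquiv.symm_apply_eq, detEquiv_wedge, detEquiv_wedge]

/-- The component at a smaller submodule `Q` of the morphism attached to a basis `a` of `A / B`, in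
terms of a basis of `A / Q` adapted to `B / Q`. -/
theorem app_wedge_of_isAdapted {A B : Obj W} {Q : Submodule k V}
    (h : IsCofree B.carrier A.carrier) (hQ : IsCofree Q B.carrier) {n r : ℕ}
    {a : Basis (Fin n) k (RelQuot A.carrier B.carrier)} {α : Det A.carrier B.carrier}
    (hα : α.app ⟨B.carrier, h, IsCofree.refl B.free⟩ (wedge a) = wedge (zeroBasis B.carrier))
    {p : Basis (Fin r) k (RelQuot B.carrier Q)}
    {e : Basis (Fin (r + n)) k (RelQuot A.carrier Q)}
    (he : IsAdapted (relIncl h.le Q) (relProj hQ.le A.carrier) p a e) :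
    α.app ⟨Q, hQ.trans h, hQ⟩ (wedge e) = wedge p := by
  have hp : IsAdapted (n := 0) (relIncl le_rfl Q) (relProj hQ.le B.carrier) p
      (zeroBasis B.carrier) p := by
    refine ⟨fun l => ?_, fun j => j.elim0⟩
    change p l = relIncl le_rfl Q (p l)
    obtain ⟨x, hx⟩ := Submodule.Quotient.mk_surjective _ (p l)
    rw [← hx]
    rfl
  obtain ⟨c, hc, hc'⟩ := α.compat ⟨B.carrier, h, IsCofree.refl B.free⟩ ⟨Q, hQ.trans h, hQ⟩ hQ.le
    r n 0 p a (zeroBasis B.carrier) e p he hp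
  rw [hα] at hc'
  have h1 := congrArg (detEquiv (zeroBasis B.carrier)) hc'
  rw [map_smul, detEquiv_wedge, smul_eq_mul, mul_one] at h1
  rw [hc, ← h1]
  exact one_smul k _

/-- Transport of structure sends the morphism attached to a basis to the one attached to the image
of the basis. -/
theorem push_app_wedge {A B A' B' : Obj W} (σ : V ≃ₗ[k] V) (h : IsCofree B.carrier A.carrier)
    (h' : IsCofree B'.carrier A'.carrier)
    (hA : A'.carrier = A.carrier.map σ.toLinearMap) (hB : B'.carrier = B.carrier.map σ.toLinearMap)
    {n : ℕ} {e : Basis (Fin n) k (RelQuot A.carrier B.carrier)} {α : Det A.carrier B.carrier}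
    (hα : α.app ⟨B.carrier, h, IsCofree.refl B.free⟩ (wedge e) = wedge (zeroBasis B.carrier)) :
    (push σ hA hB α).app ⟨B'.carrier, h', IsCofree.refl B'.free⟩
      (wedge (e.map (relEquiv σ hA hB))) = wedge (zeroBasis B'.carrier) := by
  rw [push_app σ hA hB α ⟨B.carrier, h, IsCofree.refl B.free⟩
    ⟨B'.carrier, h', IsCofree.refl B'.free⟩ hB, conj_wedge _ _ _ _ _ hα]
  exact wedge_fin_zero _ _

variable [Nonempty (Obj W)]

/-- If `σA ≤ A` and `τA = A`, then `{σ, τ}` is the determinant of `τ` on `A / σA`. -/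
theorem commSymbol_eq_det {σ τ : restrictedGL W} (h : Commute σ τ) {A B : Obj W}
    (hB : B.carrier = A.carrier.map σ.1.toLinearMap) (hBA : IsCofree B.carrier A.carrier)
    (hA : A.carrier = A.carrier.map τ.1.toLinearMap)
    (hB' : B.carrier = B.carrier.map τ.1.toLinearMap) :
    commSymbol W σ τ = LinearEquiv.det (relEquiv τ.1 hA hB') := by
  have := hBA.quot_free
  have := hBA.quot_finite
  let e := Module.finBasis k (RelQuot A.carrier B.carrier)
  obtain ⟨α, hα⟩ := exists_det_of_basis hBA e
  refine commSymbol_eq_of_comp h hB hA hB hB' α (Det.id _) ?_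
  rw [push_id, comp_id, id_comp]
  refine Det.eq_of_app ⟨B.carrier, hBA, IsCofree.refl B.free⟩ (linearEquiv_ext_wedge e ?_)
  have h1 := push_app_wedge τ.1 hBA hBA hA hB' hα
  rw [wedge_eq e, map_smul] at h1
  rw [hα, ← h1]
  refine Eq.trans ?_ (LinearEquiv.smul_apply _ _ _).symm
  refine congrArg (· • _) ?_
  have h2 : (e.map (relEquiv τ.1 hA hB') : Fin _ → _) = (relEquiv τ.1 hA hB').toLinearMap ∘ e := by
    ext i
    simp
  rw [h2, Basis.det_comp, Basis.det_self, mul_one]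
  exact (LinearEquiv.coe_det _).symm

/-- If `σA ≤ A` and `τA ≤ A`, then `{σ, τ}` compares two bases of `A / στA`, obtained from bases of
`A / σA` and `A / τA` by the filtrations `στA ≤ σA ≤ A` and `στA ≤ τA ≤ A`. It is trivial if these
bases have the same exterior product. -/
theorem commSymbol_eq_one_of_wedge_eq {σ τ : restrictedGL W} (h : Commute σ τ) {A B C D : Obj W}
    (hB : B.carrier = A.carrier.map σ.1.toLinearMap)
    (hC : C.carrier = A.carrier.map τ.1.toLinearMap)
    (hD : D.carrier = C.carrier.map σ.1.toLinearMap)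
    (hD' : D.carrier = B.carrier.map τ.1.toLinearMap)
    (hBA : IsCofree B.carrier A.carrier) (hCA : IsCofree C.carrier A.carrier) {m n : ℕ}
    (b : Basis (Fin n) k (RelQuot A.carrier B.carrier))
    (c : Basis (Fin m) k (RelQuot A.carrier C.carrier))
    (hDB : D.carrier ≤ B.carrier) (hDC : D.carrier ≤ C.carrier)
    {e : Basis (Fin (m + n)) k (RelQuot A.carrier D.carrier)}
    {e' : Basis (Fin (n + m)) k (RelQuot A.carrier D.carrier)}
    (he : IsAdapted (relIncl hBA.le D.carrier) (relProj hDB A.carrier)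
      (c.map (relEquiv σ.1 hB hD)) b e)
    (he' : IsAdapted (relIncl hCA.le D.carrier) (relProj hDC A.carrier)
      (b.map (relEquiv τ.1 hC hD')) c e')
    (hee : wedge e = wedge e') : commSymbol W σ τ = 1 := by
  have hDB' : IsCofree D.carrier B.carrier := hCA.map σ.1 hB hD
  have hDC' : IsCofree D.carrier C.carrier := hBA.map τ.1 hC hD'
  obtain ⟨α, hα⟩ := exists_det_of_basis hBA b
  obtain ⟨β, hβ⟩ := exists_det_of_basis hCA c
  refine commSymbol_eq_of_comp h hB hC hD hD' α β ?_
  rw [CentralExt.one_smul_det]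
  have hDA := hDB'.trans hBA
  refine Det.eq_of_app ⟨D.carrier, hDA, IsCofree.refl D.free⟩ (linearEquiv_ext_wedge e ?_)
  rw [comp_app _ _ D.carrier hDA hDB' (IsCofree.refl D.free),
    comp_app _ _ D.carrier hDA hDC' (IsCofree.refl D.free), LinearEquiv.trans_apply,
    LinearEquiv.trans_apply, app_wedge_of_isAdapted hBA hDB' hα he, hee,
    app_wedge_of_isAdapted hCA hDC' hβ he', push_app_wedge σ.1 hCA hDB' hB hD hβ,
    push_app_wedge τ.1 hBA hDC' hC hD' hα]

/-- Two automorphisms preserving a common object have trivial commutator symbol. -/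
theorem commSymbol_eq_one_of_fixed {σ τ : restrictedGL W} (h : Commute σ τ) {A : Obj W}
    (hσ : A.carrier = A.carrier.map σ.1.toLinearMap)
    (hτ : A.carrier = A.carrier.map τ.1.toLinearMap) : commSymbol W σ τ = 1 := by
  refine commSymbol_eq_of_comp h hσ hτ hσ hτ (Det.id _) (Det.id _) ?_
  rw [push_id, push_id, CentralExt.one_smul_det]

end Criteria

/-! ### Norms and resultants -/

section Resultant

open Polynomial

variable {k : Type*} [CommRing k]

theorem sylvester_apply_castAdd (f g : k[X]) {m n : ℕ} (hg : g.natDegree ≤ n) (i : Fin (m + n))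
    (j : Fin m) : sylvester f g m n i (Fin.castAdd n j) = (g * X ^ (j : ℕ)).coeff i := by
  rw [sylvester, Matrix.of_apply, Fin.addCases_left, coeff_mul_X_pow']
  by_cases h : (j : ℕ) ≤ i
  · by_cases h' : (i : ℕ) ≤ j + n
    · rw [if_pos ⟨h, h'⟩, if_pos h]
    · rw [if_neg fun h'' => h' h''.2, if_pos h, coeff_eq_zero_of_natDegree_lt (by omega)]
  · rw [if_neg fun h'' => h h''.1, if_neg h]

theorem sylvester_apply_natAdd (f g : k[X]) {m n : ℕ} (hf : f.natDegree ≤ m) (i : Fin (m + n))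
    (j : Fin n) : sylvester f g m n i (Fin.natAdd m j) = (f * X ^ (j : ℕ)).coeff i := by
  rw [sylvester, Matrix.of_apply, Fin.addCases_right, coeff_mul_X_pow']
  by_cases h : (j : ℕ) ≤ i
  · by_cases h' : (i : ℕ) ≤ j + m
    · rw [if_pos ⟨h, h'⟩, if_pos h]
    · rw [if_neg fun h'' => h' h''.2, if_pos h, coeff_eq_zero_of_natDegree_lt (by omega)]
  · rw [if_neg fun h'' => h h''.1, if_neg h]

theorem sum_fin_coeff_mul_X_pow {p : k[X]} {n : ℕ} (hp : p.degree < n) :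
    ∑ i : Fin n, C (p.coeff i) * X ^ (i : ℕ) = p := by
  ext l
  simp only [finsetSum_coeff, coeff_C_mul, coeff_X_pow, mul_ite, mul_one, mul_zero]
  by_cases hl : l < n
  · rw [Finset.sum_eq_single (⟨l, hl⟩ : Fin n)]
    · simp
    · intro i _ hi
      rw [if_neg fun h => hi (Fin.ext h.symm)]
    · simp
  · rw [coeff_eq_zero_of_degree_lt (hp.trans_le (by exact_mod_cast not_lt.1 hl))]
    exact Finset.sum_eq_zero fun i _ => if_neg (by have := i.2; omega)

/-- The norm of the class of `p` in `k[X] / (q)`, where `q` is monic, is the resultant of `q`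
and `p`: division by `q` factors the Sylvester matrix of `q` and `p` through that of `q` and `1`. -/
theorem norm_mk_eq_resultant [Nontrivial k] {q p : k[X]} (hq : q.Monic) {m : ℕ}
    (hp : p.natDegree ≤ m) :
    Algebra.norm k (AdjoinRoot.mk q p) = resultant q p q.natDegree m := by
  classical
  set n := q.natDegree with hn
  let B : Matrix (Fin n) (Fin n) k := Matrix.of fun i j => ((p * X ^ (j : ℕ)) %ₘ q).coeff i
  let Q : Matrix (Fin m) (Fin n) k := Matrix.of fun i j => ((p * X ^ (j : ℕ)) /ₘ q).coeff i
  have h1 : Algebra.norm k (AdjoinRoot.mk q p) = B.det := by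
    rw [Algebra.norm_eq_matrix_det (AdjoinRoot.powerBasis' hq).basis]
    congr 1
    ext i j
    rw [Algebra.leftMulMatrix_eq_repr_mul, PowerBasis.basis_eq_pow]
    change (AdjoinRoot.powerBasisAux' hq).repr (AdjoinRoot.mk q p * AdjoinRoot.root q ^ (j : ℕ)) i
      = _
    rw [← AdjoinRoot.mk_X, ← map_pow, ← map_mul]
    rfl
  have h2 : sylvester q p n m = sylvester q 1 n m *
      (Matrix.fromBlocks B 0 Q 1).reindex finSumFinEquiv finSumFinEquiv := by
    ext x y
    rw [Matrix.mul_apply, Fin.sum_univ_add]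
    simp only [sylvester_apply_castAdd q 1 (natDegree_one.le.trans (Nat.zero_le m)),
      sylvester_apply_natAdd q 1 hn.ge, one_mul]
    refine Fin.addCases (fun j => ?_) (fun j => ?_) y
    · rw [sylvester_apply_castAdd _ _ hp]
      simp only [Matrix.reindex_apply, Matrix.submatrix_apply, finSumFinEquiv_symm_apply_castAdd,
        finSumFinEquiv_symm_apply_natAdd, Matrix.fromBlocks_apply₁₁, Matrix.fromBlocks_apply₂₁]
      have h3 : ((p * X ^ (j : ℕ)) %ₘ q).degree < n :=
        (degree_modByMonic_lt _ hq).trans_eq (degree_eq_natDegree hq.ne_zero)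
      have h4 : ((p * X ^ (j : ℕ)) /ₘ q).degree < m := by
        have h5 : (p * X ^ (j : ℕ)).natDegree ≤ m + j :=
          natDegree_mul_le.trans (Nat.add_le_add hp (natDegree_X_pow_le _))
        rcases Nat.eq_zero_or_pos m with hm | hm
        · rw [(divByMonic_eq_zero_iff hq).2]
          · simp
          · rw [degree_eq_natDegree hq.ne_zero]
            refine degree_le_natDegree.trans_lt (Nat.cast_lt.2 ?_)
            omega
        · refine degree_le_natDegree.trans_lt (Nat.cast_lt.2 ?_)
          rw [natDegree_divByMonic _ hq]
          omega
      conv_lhs => rw [← modByMonic_add_div (p * X ^ (j : ℕ)) q, ← sum_fin_coeff_mul_X_pow h3,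
        ← sum_fin_coeff_mul_X_pow h4]
      simp only [Finset.mul_sum, coeff_add, finsetSum_coeff, B, Q, Matrix.of_apply, coeff_C_mul]
      congr 1
      · exact Finset.sum_congr rfl fun i _ => mul_comm _ _
      · refine Finset.sum_congr rfl fun i _ => ?_
        rw [mul_left_comm, coeff_C_mul, mul_comm]
    · rw [sylvester_apply_natAdd _ _ hn.ge]
      simp [Matrix.one_apply]
  rw [resultant, h2, Matrix.det_mul, Matrix.det_reindex_self, Matrix.det_fromBlocks_zero₁₂,
    Matrix.det_one, mul_one, h1]
  have h5 : (sylvester q 1 n m).det = 1 := by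
    change resultant q 1 n m = 1
    rw [resultant_one_right, hn, hq.coeff_natDegree, one_pow]
  rw [h5, one_mul]

/-- The resultant of `X ^ j - c` and `1 - a X ^ i`, by the euclidean algorithm on the pair of
exponents. -/
theorem resultant_X_pow_sub_C_of_isDomain [IsDomain k] (N : ℕ) : ∀ (i j : ℕ) (a c : k),
    i + j ≤ N → a ≠ 0 → c ≠ 0 → resultant (X ^ j - C c) (1 - C a * X ^ i) j i =
      (1 - a ^ (j / Nat.gcd i j) * c ^ (i / Nat.gcd i j)) ^ Nat.gcd i j := by
  induction N with
  | zero =>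
    intro i j a c h _ _
    obtain ⟨rfl, rfl⟩ : i = 0 ∧ j = 0 := by omega
    simp
  | succ N ih =>
    intro i j a c h ha hc
    rcases Nat.eq_zero_or_pos i with rfl | hi
    · rcases Nat.eq_zero_or_pos j with rfl | hj
      · simp
      · simp [Nat.div_self hj]
    rcases Nat.eq_zero_or_pos j with rfl | hj
    · simp [Nat.div_self hi]
    have hdeg1 : (X ^ j - C c).natDegree = j := natDegree_X_pow_sub_C
    have hdeg2 : ∀ (b : k) (l : ℕ), (1 - C b * X ^ l).natDegree ≤ l := by
      intro b l
      refine (natDegree_sub_le _ _).trans (max_le (by simp) (natDegree_C_mul_X_pow_le b l))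
    have hg1 := Nat.gcd_dvd_left i j
    have hg2 := Nat.gcd_dvd_right i j
    have hg0 : 0 < Nat.gcd i j := Nat.gcd_pos_of_pos_left _ hi
    rcases le_or_gt j i with hij | hij
    · obtain ⟨l, rfl⟩ := Nat.exists_eq_add_of_le hij
      -- modulo `X ^ j - c`, the power `X ^ (j + l)` is `c X ^ l`
      have e1 : (1 - C a * X ^ (j + l) : k[X]) =
          (1 - C (a * c) * X ^ l) + (X ^ j - C c) * (-(C a * X ^ l)) := by
        rw [C_mul]; ring
      have hgcd : Nat.gcd (j + l) j = Nat.gcd l j := by simp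
      rw [e1, resultant_add_mul_right _ _ _ _ _ (by
        rw [natDegree_neg]
        have := natDegree_C_mul_X_pow_le a l
        omega) hdeg1.le, add_comm j l, resultant_add_right_deg _ _ _ _ _ (hdeg2 _ _),
        ih l j (a * c) c (by omega) (mul_ne_zero ha hc) hc]
      rw [add_comm l j, hgcd]
      rw [hgcd] at hg1 hg2 hg0
      have h1 : (X ^ j - C c).coeff j = 1 := by
        rw [coeff_sub, coeff_X_pow, if_pos rfl, coeff_C_of_ne_zero hj.ne', sub_zero]
      rw [h1, one_pow, one_mul, mul_pow, mul_assoc, ← pow_add,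
        Nat.add_div_of_dvd_right hg2]
    · obtain ⟨l, rfl⟩ := Nat.exists_eq_add_of_le hij.le
      -- modulo `1 - a X ^ i`, the power `a X ^ (i + l)` is `X ^ l`
      have e1 : C a * (X ^ (i + l) - C c : k[X]) =
          (X ^ l - C (a * c)) + (1 - C a * X ^ i) * (-X ^ l) := by
        rw [C_mul]; ring
      have hgcd : Nat.gcd i (i + l) = Nat.gcd i l := by simp
      have h1 : (1 - C a * X ^ i : k[X]).coeff i = -a := by
        rw [coeff_sub, coeff_C_mul_X_pow, if_pos rfl, coeff_one, if_neg hi.ne', zero_sub]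
      have hlast : (X ^ l - C (a * c)).natDegree ≤ l :=
        natDegree_X_pow_sub_C.le
      have h2 := resultant_C_mul_left (X ^ (i + l) - C c) (1 - C a * X ^ i) (i + l) i a
      rw [e1, resultant_add_mul_left _ _ _ _ _ (by
        rw [natDegree_neg, natDegree_X_pow, add_comm]) (hdeg2 _ _), add_comm i l,
        resultant_add_left_deg _ _ _ _ _ hlast, h1, ih i l a (a * c) (by omega) ha
        (mul_ne_zero ha hc)] at h2
      -- the sign of the exchange cancels that of `-a`, as `i * i + i` is even
      have h3 : (-1 : k) ^ (i * i) * (-a) ^ i = a ^ i := by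
        rw [neg_pow a, ← mul_assoc, ← pow_add, ← Nat.mul_succ,
          (Nat.even_mul_succ_self i).neg_one_pow, one_mul]
      rw [h3] at h2
      rw [add_comm i l, ← mul_left_cancel₀ (pow_ne_zero i ha) h2, add_comm l i, hgcd]
      rw [hgcd] at hg1
      rw [mul_pow, ← mul_assoc, ← pow_add, Nat.add_div_of_dvd_right hg1, add_comm (l / _)]

/-- The formula of `resultant_X_pow_sub_C_of_isDomain` over an arbitrary commutative ring. -/
theorem resultant_X_pow_sub_C (i j : ℕ) (a c : k) :
    resultant (X ^ j - C c) (1 - C a * X ^ i) j i =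
      (1 - a ^ (j / Nat.gcd i j) * c ^ (i / Nat.gcd i j)) ^ Nat.gcd i j := by
  -- the identity holds universally, with `a` and `c` variables
  have h := resultant_X_pow_sub_C_of_isDomain (k := MvPolynomial (Fin 2) ℤ) (i + j) i j
    (MvPolynomial.X 0) (MvPolynomial.X 1) le_rfl (MvPolynomial.X_ne_zero _)
    (MvPolynomial.X_ne_zero _)
  let φ : MvPolynomial (Fin 2) ℤ →+* k := (MvPolynomial.aeval ![a, c]).toRingHom
  have h0 : φ (MvPolynomial.X 0) = a := by simp [φ]
  have h1 : φ (MvPolynomial.X 1) = c := by simp [φ]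
  have h2 := congrArg φ h
  rw [← resultant_map_map] at h2
  have h3 : (X ^ j - C (MvPolynomial.X 1) : (MvPolynomial (Fin 2) ℤ)[X]).map φ = X ^ j - C c := by
    rw [Polynomial.map_sub, Polynomial.map_pow, map_X, map_C, h1]
  have h4 : (1 - C (MvPolynomial.X 0) * X ^ i : (MvPolynomial (Fin 2) ℤ)[X]).map φ =
      1 - C a * X ^ i := by
    rw [Polynomial.map_sub, Polynomial.map_mul, Polynomial.map_pow, map_X, map_C,
      Polynomial.map_one, h0]
  rw [h3, h4] at h2
  rw [h2, map_pow, map_sub, map_mul, map_pow, map_pow, map_one, h0, h1]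

theorem norm_one_sub_mul_X_pow [Nontrivial k] (i : ℕ) {j : ℕ} (hj : j ≠ 0) (a c : k) :
    Algebra.norm k (AdjoinRoot.mk (X ^ j - C c) (1 - C a * X ^ i)) =
      (1 - a ^ (j / Nat.gcd i j) * c ^ (i / Nat.gcd i j)) ^ Nat.gcd i j := by
  rw [norm_mk_eq_resultant (m := i) (monic_X_pow_sub_C c hj), natDegree_X_pow_sub_C,
    resultant_X_pow_sub_C]
  exact (natDegree_sub_le _ _).trans (max_le (by simp) (natDegree_C_mul_X_pow_le a i))

end Resultant

/-! ### The commutator symbol on `k((t))ˣ` -/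

section LaurentSymbol

open IsLocalRing (maximalIdeal)

variable (k : Type*) [CommRing k] [IsArtinianRing k] [IsLocalRing k]

/-- The commutator symbol on `k((t))ˣ`, as a bimultiplicative map. -/
noncomputable def symbol : (LaurentSeries k)ˣ →* (LaurentSeries k)ˣ →* kˣ :=
  MonoidHom.mk' (fun f => MonoidHom.mk' (fun g =>
      commSymbol (powerSeriesSubmodule k) (laurentGL k f) (laurentGL k g))
    (fun g g' => by
      rw [map_mul]
      exact commSymbol_mul_right ((Commute.all f g).map _) ((Commute.all f g').map _)))
    (fun f f' => by
      ext g : 1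
      simp only [MonoidHom.mk'_apply, MonoidHom.mul_apply, map_mul]
      exact commSymbol_mul_left ((Commute.all f g).map _) ((Commute.all f' g).map _))

variable {k}

theorem symbol_apply (f g : (LaurentSeries k)ˣ) : symbol k f g =
    commSymbol (powerSeriesSubmodule k) (laurentGL k f) (laurentGL k g) :=
  rfl

theorem symbol_swap (f g : (LaurentSeries k)ˣ) : symbol k g f = (symbol k f g)⁻¹ :=
  commSymbol_swap ((Commute.all f g).map _)

theorem symbol_self (f : (LaurentSeries k)ˣ) : symbol k f f = 1 :=
  commSymbol_self _

/-- The unit of `k((t))` defined by a unit of `k[[t]]`. -/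
noncomputable def psUnit : (PowerSeries k)ˣ →* (LaurentSeries k)ˣ :=
  Units.map (HahnSeries.ofPowerSeries ℤ k)

theorem coe_psUnit (u : (PowerSeries k)ˣ) :
    (psUnit u : LaurentSeries k) = HahnSeries.ofPowerSeries ℤ k u :=
  rfl

theorem mem_powerSeriesSubmodule {x : LaurentSeries k} :
    x ∈ powerSeriesSubmodule k ↔ ∃ p : PowerSeries k, HahnSeries.ofPowerSeries ℤ k p = x := by
  refine ⟨exists_powerSeries, ?_⟩
  rintro ⟨p, rfl⟩
  exact (powerSeriesEquiv k p).2

theorem ofPowerSeries_mul_mem (p : PowerSeries k) {x : LaurentSeries k}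
    (hx : x ∈ powerSeriesSubmodule k) :
    HahnSeries.ofPowerSeries ℤ k p * x ∈ powerSeriesSubmodule k := by
  rw [mem_powerSeriesSubmodule] at hx ⊢
  obtain ⟨q, rfl⟩ := hx
  exact ⟨p * q, map_mul _ _ _⟩

theorem map_mulAut_le {f : (LaurentSeries k)ˣ} {h : PowerSeries k}
    (hf : (f : LaurentSeries k) = HahnSeries.ofPowerSeries ℤ k h) :
    (powerSeriesSubmodule k).map (mulAut k f).toLinearMap ≤ powerSeriesSubmodule k := by
  rintro _ ⟨x, hx, rfl⟩
  change (f : LaurentSeries k) * x ∈ _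
  rw [hf]
  exact ofPowerSeries_mul_mem h hx

/-- Units of `k[[t]]` preserve the object `k[[t]]`. -/
theorem map_mulAut_psUnit (u : (PowerSeries k)ˣ) :
    powerSeriesSubmodule k = (powerSeriesSubmodule k).map (mulAut k (psUnit u)).toLinearMap := by
  refine le_antisymm (fun x hx => ?_) (map_mulAut_le (coe_psUnit u))
  refine ⟨((psUnit u⁻¹ : (LaurentSeries k)ˣ) : LaurentSeries k) * x,
    ofPowerSeries_mul_mem _ hx, ?_⟩
  change (psUnit u : LaurentSeries k) * (((psUnit u⁻¹ : (LaurentSeries k)ˣ) : LaurentSeries k) * x)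
    = x
  rw [map_inv, Units.mul_inv_cancel_left]

theorem map_mulAut_mul (f g : (LaurentSeries k)ˣ) (A : Submodule k (LaurentSeries k)) :
    (A.map (mulAut k g).toLinearMap).map (mulAut k f).toLinearMap =
      A.map (mulAut k (f * g)).toLinearMap := by
  rw [← Submodule.map_comp, map_mul]
  rfl

theorem map_mulAut_comm (f g : (LaurentSeries k)ˣ) (A : Submodule k (LaurentSeries k)) :
    (A.map (mulAut k g).toLinearMap).map (mulAut k f).toLinearMap =
      (A.map (mulAut k f).toLinearMap).map (mulAut k g).toLinearMap := by
  rw [map_mulAut_mul, map_mulAut_mul, mul_comm]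

theorem symbol_psUnit_psUnit (u v : (PowerSeries k)ˣ) : symbol k (psUnit u) (psUnit v) = 1 :=
  commSymbol_eq_one_of_fixed ((Commute.all _ _).map (laurentGL k)) (A := stdObj k)
    (map_mulAut_psUnit u) (map_mulAut_psUnit v)

/-- The maximal ideal being nilpotent, `k` is complete, as Weierstrass preparation requires. -/
theorem isAdicComplete_maximalIdeal (k : Type*) [CommRing k] [IsArtinianRing k] [IsLocalRing k] :
    IsAdicComplete (maximalIdeal k) k := by
  obtain ⟨N, hN⟩ := exists_maximalIdeal_pow_eq_bot k
  have key : ∀ x y : k, x ≡ y [SMOD (maximalIdeal k ^ N • ⊤ : Submodule k k)] → x = y := by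
    intro x y h
    rw [hN, Submodule.bot_smul, SModEq.bot] at h
    exact h
  have h1 : IsHausdorff (maximalIdeal k) k := ⟨fun x hx => key x 0 (hx N)⟩
  have h2 : IsPrecomplete (maximalIdeal k) k := by
    refine ⟨fun f hf => ⟨f N, fun n => ?_⟩⟩
    rcases le_total n N with h | h
    · exact hf h
    · rw [key _ _ (hf h)]
  exact { }

/-- The ideal generated by `h` corresponds to the lattice `f k[[t]]`, for `f = h(t)`. -/
theorem map_powerSeriesEquiv_span {f : (LaurentSeries k)ˣ} {h : PowerSeries k}
    (hf : (f : LaurentSeries k) = HahnSeries.ofPowerSeries ℤ k h)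
    {D : Submodule k (LaurentSeries k)}
    (hD : D = (powerSeriesSubmodule k).map (mulAut k f).toLinearMap) :
    ((Ideal.span {h}).restrictScalars k).map (powerSeriesEquiv k).toLinearMap =
      D.submoduleOf (powerSeriesSubmodule k) := by
  subst hD
  ext x
  constructor
  · rintro ⟨p, hp, rfl⟩
    obtain ⟨q, rfl⟩ := Ideal.mem_span_singleton'.1 hp
    refine ⟨powerSeriesEquiv k q, (powerSeriesEquiv k q).2, ?_⟩
    change (f : LaurentSeries k) * HahnSeries.ofPowerSeries ℤ k q =
      HahnSeries.ofPowerSeries ℤ k (q * h)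
    rw [map_mul, hf, mul_comm]
  · rintro ⟨y, hy, hyx⟩
    obtain ⟨q, rfl⟩ := exists_powerSeries hy
    refine ⟨q * h, Ideal.mem_span_singleton'.2 ⟨q, rfl⟩, Subtype.ext ?_⟩
    refine Eq.trans ?_ hyx
    change HahnSeries.ofPowerSeries ℤ k (q * h) =
      (f : LaurentSeries k) * HahnSeries.ofPowerSeries ℤ k q
    rw [map_mul, hf, mul_comm]

/-- The isomorphism `k[[t]] / f k[[t]] ≅ k[[X]] / (h)`, for `f = h(t)`. -/
noncomputable def relQuotEquiv {f : (LaurentSeries k)ˣ} {h : PowerSeries k}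
    (hf : (f : LaurentSeries k) = HahnSeries.ofPowerSeries ℤ k h)
    {D : Submodule k (LaurentSeries k)}
    (hD : D = (powerSeriesSubmodule k).map (mulAut k f).toLinearMap) :
    RelQuot (powerSeriesSubmodule k) D ≃ₗ[k] PowerSeries k ⧸ Ideal.span {h} :=
  ((Submodule.Quotient.equiv ((Ideal.span {h}).restrictScalars k)
    (D.submoduleOf (powerSeriesSubmodule k)) (powerSeriesEquiv k)
    (map_powerSeriesEquiv_span hf hD)).symm).trans
    (Submodule.Quotient.restrictScalarsEquiv k (Ideal.span {h}))

theorem relQuotEquiv_mk {f : (LaurentSeries k)ˣ} {h : PowerSeries k}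
    (hf : (f : LaurentSeries k) = HahnSeries.ofPowerSeries ℤ k h)
    {D : Submodule k (LaurentSeries k)}
    (hD : D = (powerSeriesSubmodule k).map (mulAut k f).toLinearMap) (p : PowerSeries k) :
    relQuotEquiv hf hD (Submodule.Quotient.mk (powerSeriesEquiv k p)) =
      Ideal.Quotient.mk (Ideal.span {h}) p := by
  have h1 : (Submodule.Quotient.equiv ((Ideal.span {h}).restrictScalars k)
      (D.submoduleOf (powerSeriesSubmodule k)) (powerSeriesEquiv k)
      (map_powerSeriesEquiv_span hf hD)).symm (Submodule.Quotient.mk (powerSeriesEquiv k p)) =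
      Submodule.Quotient.mk p := by
    rw [LinearEquiv.symm_apply_eq]
    rfl
  simp only [relQuotEquiv, LinearEquiv.trans_apply]
  rw [h1]
  rfl

/-- For a distinguished polynomial `q`, the isomorphism `k[[t]] / q k[[t]] ≅ k[X] / (q)`. -/
noncomputable def relQuotEquivAdjoinRoot {f : (LaurentSeries k)ˣ} {q : Polynomial k}
    (hq : q.IsDistinguishedAt (maximalIdeal k))
    (hf : (f : LaurentSeries k) = HahnSeries.ofPowerSeries ℤ k q)
    {D : Submodule k (LaurentSeries k)}
    (hD : D = (powerSeriesSubmodule k).map (mulAut k f).toLinearMap) :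
    RelQuot (powerSeriesSubmodule k) D ≃ₗ[k] AdjoinRoot q :=
  have := isAdicComplete_maximalIdeal k
  (relQuotEquiv hf hD).trans hq.algEquivQuotient.symm.toLinearEquiv

theorem relQuotEquivAdjoinRoot_mk {f : (LaurentSeries k)ˣ} {q : Polynomial k}
    (hq : q.IsDistinguishedAt (maximalIdeal k))
    (hf : (f : LaurentSeries k) = HahnSeries.ofPowerSeries ℤ k q)
    {D : Submodule k (LaurentSeries k)}
    (hD : D = (powerSeriesSubmodule k).map (mulAut k f).toLinearMap) (p : Polynomial k) :
    relQuotEquivAdjoinRoot hq hf hD (Submodule.Quotient.mk (powerSeriesEquiv k p)) =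
      AdjoinRoot.mk q p := by
  have := isAdicComplete_maximalIdeal k
  change hq.algEquivQuotient.symm
    (relQuotEquiv hf hD (Submodule.Quotient.mk (powerSeriesEquiv k p))) = _
  rw [relQuotEquiv_mk]
  exact (AlgEquiv.symm_apply_eq _).2 rfl

theorem isCofree_map_mulAut {f : (LaurentSeries k)ˣ} {q : Polynomial k}
    (hq : q.IsDistinguishedAt (maximalIdeal k))
    (hf : (f : LaurentSeries k) = HahnSeries.ofPowerSeries ℤ k q) :
    IsCofree (laurentGL k f • stdObj k).carrier (stdObj k).carrier := by
  have := hq.monic.free_adjoinRoot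
  have := hq.monic.finite_adjoinRoot
  exact ⟨map_mulAut_le hf, (laurentGL k f • stdObj k).free,
    Module.Free.of_equiv (relQuotEquivAdjoinRoot hq hf rfl).symm,
    Module.Finite.equiv (relQuotEquivAdjoinRoot hq hf rfl).symm⟩

/-- The symbol of a distinguished polynomial `q` and a unit `u` of `k[[t]]` is the norm of the
class of `u` in `k[[t]] / (q)`. -/
theorem symbol_psUnit_right {f : (LaurentSeries k)ˣ} {q : Polynomial k}
    (hq : q.IsDistinguishedAt (maximalIdeal k))
    (hf : (f : LaurentSeries k) = HahnSeries.ofPowerSeries ℤ k q) (u : (PowerSeries k)ˣ) :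
    (symbol k f (psUnit u) : k) =
      Algebra.norm k (Ideal.Quotient.mk (Ideal.span {(q : PowerSeries k)}) u) := by
  have hA := map_mulAut_psUnit u
  have hB : (powerSeriesSubmodule k).map (mulAut k f).toLinearMap =
      ((powerSeriesSubmodule k).map (mulAut k f).toLinearMap).map
        (mulAut k (psUnit u)).toLinearMap := by
    rw [map_mulAut_comm, ← hA]
  have h0 : symbol k f (psUnit u) = LinearEquiv.det (relEquiv (mulAut k (psUnit u)) hA hB) :=
    commSymbol_eq_det (A := stdObj k) (B := laurentGL k f • stdObj k)
      ((Commute.all f (psUnit u)).map (laurentGL k)) rfl (isCofree_map_mulAut hq hf) hA hB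
  rw [h0, LinearEquiv.coe_det, Algebra.norm_apply, ← LinearMap.det_conj _ (relQuotEquiv hf rfl)]
  congr 1
  refine LinearMap.ext fun x => ?_
  obtain ⟨x, rfl⟩ := (relQuotEquiv hf rfl).surjective x
  obtain ⟨x, rfl⟩ := Submodule.Quotient.mk_surjective _ x
  obtain ⟨p, rfl⟩ := (powerSeriesEquiv k).surjective x
  rw [LinearMap.comp_apply, LinearMap.comp_apply, LinearEquiv.coe_coe, LinearEquiv.coe_coe,
    LinearEquiv.coe_coe, LinearEquiv.symm_apply_apply]
  have h1 : relEquiv (mulAut k (psUnit u)) hA hB (Submodule.Quotient.mk (powerSeriesEquiv k p)) =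
      Submodule.Quotient.mk (powerSeriesEquiv k ((u : PowerSeries k) * p)) := by
    rw [relEquiv_mk]
    congr 1
    apply Subtype.ext
    exact (map_mul (HahnSeries.ofPowerSeries ℤ k) (u : PowerSeries k) p).symm
  rw [h1, relQuotEquiv_mk, relQuotEquiv_mk, map_mul]
  rfl

end LaurentSymbol

/-! ### The symbol of two distinguished polynomials -/

section Distinguished

open IsLocalRing (maximalIdeal)

variable {k : Type*} [CommRing k] [IsArtinianRing k] [IsLocalRing k]

/-- The class of a power series in `k[[t]] / D`. -/
noncomputable def psClass (D : Submodule k (LaurentSeries k)) (p : PowerSeries k) :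
    RelQuot (powerSeriesSubmodule k) D :=
  Submodule.Quotient.mk (powerSeriesEquiv k p)

/-- The basis `1, t, …, t^(n-1)` of `k[[t]] / q k[[t]]`, for a distinguished polynomial `q` of
degree `n`. -/
noncomputable def monomialBasis {f : (LaurentSeries k)ˣ} {q : Polynomial k}
    (hq : q.IsDistinguishedAt (maximalIdeal k))
    (hf : (f : LaurentSeries k) = HahnSeries.ofPowerSeries ℤ k q)
    {D : Submodule k (LaurentSeries k)}
    (hD : D = (powerSeriesSubmodule k).map (mulAut k f).toLinearMap) :
    Basis (Fin q.natDegree) k (RelQuot (powerSeriesSubmodule k) D) :=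
  (AdjoinRoot.powerBasisAux' hq.monic).map (relQuotEquivAdjoinRoot hq hf hD).symm

variable {f : (LaurentSeries k)ˣ} {q : Polynomial k}
  (hq : q.IsDistinguishedAt (maximalIdeal k))
  (hf : (f : LaurentSeries k) = HahnSeries.ofPowerSeries ℤ k q)
  {D : Submodule k (LaurentSeries k)}
  (hD : D = (powerSeriesSubmodule k).map (mulAut k f).toLinearMap)

theorem monomialBasis_repr (p : Polynomial k) (i : Fin q.natDegree) :
    (monomialBasis hq hf hD).repr (psClass D p) i = (p.modByMonic q).coeff i := by
  rw [monomialBasis, Basis.map_repr, LinearEquiv.trans_apply, LinearEquiv.symm_symm, psClass,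
    relQuotEquivAdjoinRoot_mk]
  rfl

theorem monomialBasis_apply (i : Fin q.natDegree) :
    monomialBasis hq hf hD i =
      psClass D ((Polynomial.X ^ (i : ℕ) : Polynomial k) : PowerSeries k) := by
  rw [monomialBasis, Basis.map_apply, LinearEquiv.symm_apply_eq, psClass,
    relQuotEquivAdjoinRoot_mk, map_pow, AdjoinRoot.mk_X]
  exact (AdjoinRoot.powerBasis' hq.monic).basis_eq_pow i

theorem wedge_eq_det_smul_monomialBasis {n : ℕ} (hn : q.natDegree = n)
    (e : Basis (Fin n) k (RelQuot (powerSeriesSubmodule k) D)) (p : Fin n → Polynomial k)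
    (hp : ∀ j, (p j).degree < n) (he : ∀ j, e j = psClass D (p j)) :
    wedge e =
      (Matrix.of fun i j : Fin n => (p j).coeff i).det • wedge (monomialBasis hq hf hD) := by
  subst hn
  rw [wedge_eq (monomialBasis hq hf hD) e, Basis.det_apply]
  congr 2
  ext i j
  rw [Basis.toMatrix_apply, he, monomialBasis_repr, Matrix.of_apply,
    (Polynomial.modByMonic_eq_self_iff hq.monic).2]
  rw [Polynomial.degree_eq_natDegree hq.monic.ne_zero]
  exact hp j

/-- Multiplication by `f = q(t)` and the inclusion `f k[[t]] ⊆ k[[t]]` send the class of `p` in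
`k[[t]] / C` to the class of `q p` in `k[[t]] / f C`. -/
theorem relEquiv_psClass {f : (LaurentSeries k)ˣ} {q : PowerSeries k}
    (hf : (f : LaurentSeries k) = HahnSeries.ofPowerSeries ℤ k q)
    {B C D : Submodule k (LaurentSeries k)}
    (hB : B = (powerSeriesSubmodule k).map (mulAut k f).toLinearMap)
    (hD : D = C.map (mulAut k f).toLinearMap) (hBA : B ≤ powerSeriesSubmodule k)
    (p : PowerSeries k) :
    relIncl hBA D (relEquiv (mulAut k f) hB hD (psClass C p)) = psClass D (q * p) := by
  rw [psClass, psClass, relEquiv_mk, relIncl_mk]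
  congr 1
  apply Subtype.ext
  change (f : LaurentSeries k) * HahnSeries.ofPowerSeries ℤ k p =
    HahnSeries.ofPowerSeries ℤ k (q * p)
  rw [hf, map_mul]

/-- The basis of `k[[t]] / qr k[[t]]` consisting of the `q t^l`, `l < deg r`, and of the `t^j`,
`j < deg q`. In the coordinates of the monomial basis it is the Sylvester matrix of `1` and `q`,
which accounts for the sign. -/
theorem exists_adapted_basis {g : (LaurentSeries k)ˣ} {r : Polynomial k}
    (hr : r.IsDistinguishedAt (maximalIdeal k))
    (hg : (g : LaurentSeries k) = HahnSeries.ofPowerSeries ℤ k r)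
    {B C : Submodule k (LaurentSeries k)}
    (hB : B = (powerSeriesSubmodule k).map (mulAut k f).toLinearMap)
    (hC : C = (powerSeriesSubmodule k).map (mulAut k g).toLinearMap)
    (hD : D = C.map (mulAut k f).toLinearMap) (hBA : B ≤ powerSeriesSubmodule k) (hDB : D ≤ B) :
    ∃ e : Basis (Fin (r.natDegree + q.natDegree)) k (RelQuot (powerSeriesSubmodule k) D),
      IsAdapted (relIncl hBA D) (relProj hDB (powerSeriesSubmodule k))
        ((monomialBasis hr hg hC).map (relEquiv (mulAut k f) hB hD)) (monomialBasis hq hf hB) e ∧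
      ∀ (fg : (LaurentSeries k)ˣ) (h : Polynomial k) (hh : h.IsDistinguishedAt (maximalIdeal k))
        (hfg : (fg : LaurentSeries k) = HahnSeries.ofPowerSeries ℤ k h)
        (hD' : D = (powerSeriesSubmodule k).map (mulAut k fg).toLinearMap)
        (_ : h.natDegree = r.natDegree + q.natDegree),
        wedge e = (-1 : k) ^ (r.natDegree * q.natDegree) • wedge (monomialBasis hh hfg hD') := by
  obtain ⟨e, he, he'⟩ := exists_adapted (isShortExact_rel hDB hBA)
    ((monomialBasis hr hg hC).map (relEquiv (mulAut k f) hB hD)) (monomialBasis hq hf hB)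
    (fun j => psClass D ((Polynomial.X ^ (j : ℕ) : Polynomial k) : PowerSeries k)) (fun j => by
      rw [monomialBasis_apply]
      rfl)
  refine ⟨e, he, fun fg h hh hfg hD' hn => ?_⟩
  let p : Fin (r.natDegree + q.natDegree) → Polynomial k :=
    Fin.addCases (fun l => q * Polynomial.X ^ (l : ℕ)) (fun j => Polynomial.X ^ (j : ℕ))
  rw [wedge_eq_det_smul_monomialBasis hh hfg hD' hn e p]
  · congr 1
    have h1 : (Matrix.of fun i j : Fin (r.natDegree + q.natDegree) => (p j).coeff i) =
        Polynomial.sylvester 1 q r.natDegree q.natDegree := by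
      ext i j
      refine Fin.addCases (fun l => ?_) (fun l => ?_) j
      · rw [sylvester_apply_castAdd _ _ le_rfl]
        simp [p]
      · rw [sylvester_apply_natAdd _ _ (Polynomial.natDegree_one.le.trans (Nat.zero_le _))]
        simp [p]
    rw [h1]
    change Polynomial.resultant 1 q r.natDegree q.natDegree = _
    rw [Polynomial.resultant_one_left, hq.monic.coeff_natDegree, one_pow, mul_one]
  · intro j
    refine Fin.addCases (fun l => ?_) (fun l => ?_) j
    · simp only [p, Fin.addCases_left]
      refine Polynomial.degree_le_natDegree.trans_lt (Nat.cast_lt.2 ?_)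
      have := l.2
      have h2 := Polynomial.natDegree_mul_le (p := q) (q := Polynomial.X ^ (l : ℕ))
      rw [Polynomial.natDegree_X_pow] at h2
      omega
    · simp only [p, Fin.addCases_right]
      refine (Polynomial.degree_X_pow_le _).trans_lt (Nat.cast_lt.2 ?_)
      have := l.2
      omega
  · intro j
    refine Fin.addCases (fun l => ?_) (fun l => ?_) j
    · rw [he.left, Basis.map_apply, monomialBasis_apply, relEquiv_psClass hf]
      simp [p]
    · rw [he']
      simp [p]

/-- Distinguished polynomials have trivial commutator symbols: both filtrations of
`k[[t]] / qr k[[t]]` lead to bases with Sylvester matrices of the same determinant `(-1)^{mn}`. -/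
theorem symbol_distinguished {f g : (LaurentSeries k)ˣ} {q r : Polynomial k}
    (hq : q.IsDistinguishedAt (maximalIdeal k))
    (hf : (f : LaurentSeries k) = HahnSeries.ofPowerSeries ℤ k q)
    (hr : r.IsDistinguishedAt (maximalIdeal k))
    (hg : (g : LaurentSeries k) = HahnSeries.ofPowerSeries ℤ k r) : symbol k f g = 1 := by
  have hDB : (laurentGL k (f * g) • stdObj k).carrier ≤ (laurentGL k f • stdObj k).carrier := by
    change (powerSeriesSubmodule k).map (mulAut k (f * g)).toLinearMap ≤
      (powerSeriesSubmodule k).map (mulAut k f).toLinearMap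
    rw [← map_mulAut_mul]
    exact Submodule.map_mono (map_mulAut_le hg)
  have hDC : (laurentGL k (f * g) • stdObj k).carrier ≤ (laurentGL k g • stdObj k).carrier := by
    change (powerSeriesSubmodule k).map (mulAut k (f * g)).toLinearMap ≤
      (powerSeriesSubmodule k).map (mulAut k g).toLinearMap
    rw [← map_mulAut_mul, map_mulAut_comm]
    exact Submodule.map_mono (map_mulAut_le hf)
  have hD : (powerSeriesSubmodule k).map (mulAut k (f * g)).toLinearMap =
      ((powerSeriesSubmodule k).map (mulAut k g).toLinearMap).map (mulAut k f).toLinearMap :=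
    (map_mulAut_mul _ _ _).symm
  have hD' : (powerSeriesSubmodule k).map (mulAut k (f * g)).toLinearMap =
      ((powerSeriesSubmodule k).map (mulAut k f).toLinearMap).map (mulAut k g).toLinearMap := by
    rw [map_mulAut_mul, mul_comm]
  obtain ⟨e, he, hwe⟩ := exists_adapted_basis hq hf hr hg rfl rfl hD (map_mulAut_le hf) hDB
  obtain ⟨e', he', hwe'⟩ := exists_adapted_basis hr hg hq hf rfl rfl hD' (map_mulAut_le hg) hDC
  have hfg : ((f * g : (LaurentSeries k)ˣ) : LaurentSeries k) =
      HahnSeries.ofPowerSeries ℤ k ((q * r : Polynomial k) : PowerSeries k) := by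
    rw [Units.val_mul, hf, hg, Polynomial.coe_mul, map_mul]
  have hdeg := hq.monic.natDegree_mul hr.monic
  have hee : wedge e = wedge e' :=
    (hwe (f * g) (q * r) (hq.mul hr) hfg rfl (hdeg.trans (add_comm _ _))).trans (by
      rw [mul_comm r.natDegree]
      exact (hwe' (f * g) (q * r) (hq.mul hr) hfg rfl hdeg).symm)
  exact commSymbol_eq_one_of_wedge_eq (A := stdObj k) (B := laurentGL k f • stdObj k)
    (C := laurentGL k g • stdObj k) (D := laurentGL k (f * g) • stdObj k)
    ((Commute.all f g).map (laurentGL k)) rfl rfl hD hD' (isCofree_map_mulAut hq hf)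
    (isCofree_map_mulAut hr hg) (monomialBasis hq hf rfl) (monomialBasis hr hg rfl) hDB hDC
    he he' hee

end Distinguished

/-! ### Products `∏ (1 - a_i X^i)` in the ring of power series -/

section WittProduct

variable {k : Type*} [CommRing k]

/-- The partial product `∏_{i ≤ n} (1 - a_i X^i)`. -/
noncomputable def posPartial (a : ℕ+ → k) (n : ℕ) : PowerSeries k :=
  ∏ i ∈ Finset.range n, (1 - PowerSeries.C (a i.succPNat) * PowerSeries.X ^ (i + 1))

theorem posPartial_succ (a : ℕ+ → k) (n : ℕ) : posPartial a (n + 1) =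
    posPartial a n * (1 - PowerSeries.C (a n.succPNat) * PowerSeries.X ^ (n + 1)) :=
  Finset.prod_range_succ _ _

theorem coeff_posPartial_succ (a : ℕ+ → k) (n m : ℕ) :
    PowerSeries.coeff m (posPartial a (n + 1)) = PowerSeries.coeff m (posPartial a n) -
      if n + 1 ≤ m then PowerSeries.coeff (m - (n + 1)) (posPartial a n) * a n.succPNat else 0 := by
  rw [posPartial_succ, mul_sub, mul_one, map_sub, ← mul_assoc, PowerSeries.coeff_mul_X_pow',
    PowerSeries.coeff_mul_C]

theorem coeff_zero_posPartial (a : ℕ+ → k) (n : ℕ) : PowerSeries.coeff 0 (posPartial a n) = 1 := by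
  induction n with
  | zero => simp [posPartial]
  | succ n ih => rw [coeff_posPartial_succ, ih, if_neg (by omega), sub_zero]

theorem coeff_posPartial_of_le (a : ℕ+ → k) {n N : ℕ} (h : n ≤ N) :
    PowerSeries.coeff n (posPartial a N) = PowerSeries.coeff n (posProduct a) := by
  induction N, h using Nat.le_induction with
  | base =>
    rw [posProduct, PowerSeries.coeff_mk]
    rfl
  | succ N hN ih => rw [coeff_posPartial_succ, ih, if_neg (by omega), sub_zero]

theorem coeff_zero_posProduct (a : ℕ+ → k) : PowerSeries.coeff 0 (posProduct a) = 1 := by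
  rw [← coeff_posPartial_of_le a le_rfl, coeff_zero_posPartial]

theorem constantCoeff_posProduct (a : ℕ+ → k) : PowerSeries.constantCoeff (posProduct a) = 1 := by
  rw [← PowerSeries.coeff_zero_eq_constantCoeff_apply, coeff_zero_posProduct]

/-- The coefficient of `X^(n+1)` is `-a_{n+1}` up to a function of the `a_i` with `i ≤ n`: this is
the recursion by which the product determines the `a_i`. -/
theorem coeff_succ_posProduct (a : ℕ+ → k) (n : ℕ) : PowerSeries.coeff (n + 1) (posProduct a) =
    PowerSeries.coeff (n + 1) (posPartial a n) - a n.succPNat := by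
  rw [← coeff_posPartial_of_le a le_rfl, coeff_posPartial_succ, if_pos le_rfl, Nat.sub_self,
    coeff_zero_posPartial, one_mul]

theorem posProduct_injective : Function.Injective (posProduct : (ℕ+ → k) → PowerSeries k) := by
  intro a b h
  have key : ∀ n, posPartial a n = posPartial b n := by
    intro n
    induction n with
    | zero => rfl
    | succ n ih =>
      have h1 := coeff_succ_posProduct a n
      rw [h, coeff_succ_posProduct, ih, sub_right_inj] at h1
      rw [posPartial_succ, posPartial_succ, ih, h1]
  funext i
  have h1 := coeff_succ_posProduct a i.natPred
  rw [h, coeff_succ_posProduct, key, sub_right_inj, PNat.succPNat_natPred] at h1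
  exact h1.symm

/-- Every power series with constant coefficient `1` is a product `∏ (1 - a_i X^i)`. If its
coefficients lie in the members of a multiplicative filtration by ideals, then so do the `a_i`. -/
theorem exists_posProduct_eq (p : PowerSeries k) (hp : PowerSeries.coeff 0 p = 1) (I : ℕ → Ideal k)
    (hI0 : I 0 = ⊤) (hI : ∀ i j, I i * I j ≤ I (i + j)) (hpI : ∀ j, PowerSeries.coeff j p ∈ I j) :
    ∃ a : ℕ+ → k, posProduct a = p ∧ ∀ i : ℕ+, a i ∈ I i := by
  -- the partial products, by recursion
  let P : ℕ → PowerSeries k := fun n => Nat.rec 1 (fun n Q =>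
    Q * (1 - PowerSeries.C (PowerSeries.coeff (n + 1) Q - PowerSeries.coeff (n + 1) p) *
      PowerSeries.X ^ (n + 1))) n
  let a : ℕ+ → k := fun i =>
    PowerSeries.coeff i (P i.natPred) - PowerSeries.coeff i p
  have hP : ∀ n, posPartial a n = P n := by
    intro n
    induction n with
    | zero => rfl
    | succ n ih =>
      rw [posPartial_succ, ih]
      rfl
  have hPI : ∀ n j, PowerSeries.coeff j (posPartial a n) ∈ I j := by
    intro n
    induction n with
    | zero =>
      intro j
      rcases eq_or_ne j 0 with rfl | hj
      · rw [hI0]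
        trivial
      · simp [posPartial, PowerSeries.coeff_one, hj]
    | succ n ih =>
      intro j
      rw [coeff_posPartial_succ]
      refine sub_mem (ih j) ?_
      split_ifs with h
      · have h1 : a n.succPNat ∈ I (n + 1) := by
          change PowerSeries.coeff (n + 1) (P n) - PowerSeries.coeff (n + 1) p ∈ I (n + 1)
          rw [← hP]
          exact sub_mem (ih _) (hpI _)
        have h2 := hI _ _ (Ideal.mul_mem_mul (ih (j - (n + 1))) h1)
        rwa [Nat.sub_add_cancel h] at h2
      · exact zero_mem _
  refine ⟨a, ?_, fun i => ?_⟩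
  · ext n
    rcases n with _ | n
    · rw [coeff_zero_posProduct, hp]
    · rw [coeff_succ_posProduct, hP]
      change _ - (PowerSeries.coeff (n + 1) (P n) - PowerSeries.coeff (n + 1) p) = _
      rw [sub_sub_cancel]
  · change PowerSeries.coeff i (P i.natPred) - PowerSeries.coeff i p ∈ I i
    rw [← hP]
    exact sub_mem (hPI _ _) (hpI _)

end WittProduct

/-! ### Reduction of Laurent series -/

section Reduction

variable {k : Type*} [CommRing k] {l : Type*} [CommRing l]

/-- The ring homomorphism `k((t)) → l((t))` induced by a ring homomorphism `k → l`. -/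
noncomputable def laurentMap (φ : k →+* l) : LaurentSeries k →+* LaurentSeries l where
  toFun x := x.map φ
  map_one' := HahnSeries.map_one φ.toMonoidWithZeroHom
  map_mul' _ _ := HahnSeries.map_mul (φ : k →ₙ+* l)
  map_zero' := HahnSeries.map_zero φ.toAddMonoidHom.toZeroHom
  map_add' _ _ := HahnSeries.map_add (φ : k →+ l)

theorem coeff_laurentMap (φ : k →+* l) (x : LaurentSeries k) (n : ℤ) :
    (laurentMap φ x).coeff n = φ (x.coeff n) :=
  rfl

theorem laurentMap_single (φ : k →+* l) (n : ℤ) (a : k) :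
    laurentMap φ (HahnSeries.single n a) = HahnSeries.single n (φ a) :=
  HahnSeries.map_single φ.toAddMonoidHom.toZeroHom

end Reduction

/-! ### Winding number and Witt parameters -/

section Presentation

open IsLocalRing (maximalIdeal residue ResidueField)

variable {k : Type*} [CommRing k] [IsArtinianRing k] [IsLocalRing k]

/-- The polynomial `∏ (1 - a_i X^i)`, for a finitely supported family `(a_i)` in the maximal
ideal. -/
noncomputable def negPoly (a : ℕ+ →₀ maximalIdeal k) : Polynomial k :=
  a.prod fun i c => 1 - Polynomial.C (c : k) * Polynomial.X ^ (i : ℕ)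

theorem coe_negPoly (a : ℕ+ →₀ maximalIdeal k) :
    (negPoly a : PowerSeries k) = posProduct fun i => (a i : k) := by
  have h1 : ∀ N, (∀ i ∈ a.support, (i : ℕ) ≤ N) →
      (negPoly a : PowerSeries k) = posPartial (fun i => (a i : k)) N := by
    intro N hN
    have hs : a.support ⊆ (Finset.range N).map ⟨Nat.succPNat, Nat.succPNat_injective⟩ := by
      intro i hi
      rw [Finset.mem_map]
      refine ⟨i.natPred, Finset.mem_range.2 ?_, PNat.succPNat_natPred i⟩
      have := hN i hi
      have := i.natPred_add_one
      omega
    rw [negPoly, Finsupp.prod_of_support_subset a hs _ (by simp), Finset.prod_map, posPartial,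
      ← Polynomial.coeToPowerSeries.ringHom_apply, map_prod]
    simp
  ext n
  rw [h1 (max n (a.support.sup fun i => (i : ℕ)))
    (fun i hi => (Finset.le_sup (f := fun i : ℕ+ => (i : ℕ)) hi).trans (le_max_right _ _)),
    coeff_posPartial_of_le _ (le_max_left _ _)]

theorem algebraMap_laurentSeries (c : k) :
    algebraMap k (LaurentSeries k) c = HahnSeries.single 0 c := by
  simp [RingHom.algebraMap_toAlgebra, HahnSeries.C_apply]

theorem algebraMap_mul_single_neg_one_pow (c : k) (i : ℕ) :
    algebraMap k (LaurentSeries k) c * HahnSeries.single (-1 : ℤ) (1 : k) ^ i =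
      HahnSeries.single (-(i : ℤ)) c := by
  rw [algebraMap_laurentSeries, HahnSeries.single_pow, one_pow, smul_neg, nsmul_one,
    HahnSeries.single_mul_single, zero_add, mul_one]

theorem aeval_negPoly (a : ℕ+ →₀ maximalIdeal k) :
    Polynomial.aeval (HahnSeries.single (-1 : ℤ) (1 : k)) (negPoly a) =
      a.prod fun i c => 1 - HahnSeries.single (-(i : ℤ)) (c : k) := by
  rw [negPoly, Finsupp.prod, Finsupp.prod, map_prod]
  refine Finset.prod_congr rfl fun i _ => ?_
  rw [map_sub, map_one, map_mul, map_pow, Polynomial.aeval_X, Polynomial.aeval_C,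
    algebraMap_mul_single_neg_one_pow]

theorem toLaurent_eq (p : WittParams k) : p.toLaurent =
    HahnSeries.single p.winding (p.const : k) *
      Polynomial.aeval (HahnSeries.single (-1 : ℤ) (1 : k)) (negPoly p.neg) *
      HahnSeries.ofPowerSeries ℤ k (posProduct p.pos) := by
  rw [aeval_negPoly]
  rfl

theorem laurentMap_ofPowerSeries {l : Type*} [CommRing l] (φ : k →+* l) (p : PowerSeries k) :
    laurentMap φ (HahnSeries.ofPowerSeries ℤ k p) =
      HahnSeries.ofPowerSeries ℤ l (PowerSeries.map φ p) := by
  ext n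
  rw [coeff_laurentMap, PowerSeries.coeff_coe, PowerSeries.coeff_coe]
  split_ifs <;> simp

theorem order_ofPowerSeries_eq_zero {l : Type*} [CommRing l] {p : PowerSeries l}
    (hp : PowerSeries.coeff 0 p ≠ 0) : (HahnSeries.ofPowerSeries ℤ l p).order = 0 := by
  refine le_antisymm (HahnSeries.order_le_of_coeff_ne_zero ?_) ?_
  · rw [PowerSeries.coeff_coe]
    simpa using hp
  · by_contra! h
    have h1 : (HahnSeries.ofPowerSeries ℤ l p) ≠ 0 := by
      intro h0
      rw [h0, HahnSeries.order_zero] at h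
      exact lt_irrefl _ h
    refine h1 (HahnSeries.coeff_order_eq_zero.1 ?_)
    rw [PowerSeries.coeff_coe, if_pos h]

/-- The winding number is the order of the reduction modulo the maximal ideal. -/
theorem order_laurentMap_toLaurent (p : WittParams k) :
    (laurentMap (residue k) p.toLaurent).order = p.winding := by
  have h1 : laurentMap (residue k) (p.neg.prod fun i a => 1 - HahnSeries.single (-(i : ℤ)) (a : k))
      = 1 := by
    rw [Finsupp.prod, map_prod]
    refine Finset.prod_eq_one fun i _ => ?_
    rw [map_sub, map_one, laurentMap_single, (IsLocalRing.residue_eq_zero_iff _).2 (p.neg i).2,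
      map_zero, sub_zero]
  have h2 : PowerSeries.coeff 0 (PowerSeries.map (residue k) (posProduct p.pos)) ≠ 0 := by
    rw [PowerSeries.coeff_map, coeff_zero_posProduct, map_one]
    exact one_ne_zero
  have h3 : residue k (p.const : k) ≠ 0 :=
    (IsLocalRing.residue_ne_zero_iff_isUnit _).2 p.const.isUnit
  rw [WittParams.toLaurent, map_mul, map_mul, h1, mul_one, laurentMap_single,
    laurentMap_ofPowerSeries, HahnSeries.order_mul, HahnSeries.order_single h3,
    order_ofPowerSeries_eq_zero h2, add_zero]
  · exact HahnSeries.single_ne_zero h3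
  · intro h
    have h4 := congrArg (fun x => HahnSeries.coeff x 0) h
    simp only [PowerSeries.coeff_coe] at h4
    exact h2 (by simpa using h4)

theorem coeff_zero_negPoly (a : ℕ+ →₀ maximalIdeal k) : (negPoly a).coeff 0 = 1 := by
  rw [← Polynomial.coeff_coe, coe_negPoly, coeff_zero_posProduct]

theorem isUnit_negPoly (a : ℕ+ →₀ maximalIdeal k) : IsUnit (negPoly a) := by
  rw [negPoly, Finsupp.prod, IsUnit.prod_iff]
  intro i _
  refine IsNilpotent.isUnit_one_sub ?_
  obtain ⟨N, hN⟩ := exists_maximalIdeal_pow_eq_bot k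
  refine ⟨N, ?_⟩
  have h1 := Ideal.pow_mem_pow (a i).2 N
  rw [hN] at h1
  rw [mul_pow, ← map_pow, (show ((a i : k)) ^ N = 0 from h1), map_zero, zero_mul]

theorem negPoly_injective :
    Function.Injective (negPoly : (ℕ+ →₀ maximalIdeal k) → Polynomial k) := by
  intro a b h
  have h1 := congrArg (fun p : Polynomial k => (p : PowerSeries k)) h
  simp only [coe_negPoly] at h1
  ext i
  exact congrFun (posProduct_injective h1) i

theorem coeff_aeval_single_neg_one (r : Polynomial k) (n : ℕ) :
    (Polynomial.aeval (HahnSeries.single (-1 : ℤ) (1 : k)) r).coeff (-(n : ℤ)) = r.coeff n := by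
  rw [Polynomial.aeval_def, Polynomial.eval₂_eq_sum_range, HahnSeries.coeff_sum]
  have h1 : ∀ i : ℕ, (algebraMap k (LaurentSeries k) (r.coeff i) *
      HahnSeries.single (-1 : ℤ) (1 : k) ^ i).coeff (-(n : ℤ)) =
      if i = n then r.coeff i else 0 := by
    intro i
    rw [algebraMap_mul_single_neg_one_pow, HahnSeries.coeff_single]
    simp [eq_comm]
  simp only [h1, Finset.sum_ite_eq', Finset.mem_range]
  rw [ite_eq_left_iff]
  intro h
  exact (Polynomial.coeff_eq_zero_of_natDegree_lt (by omega)).symm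

/-- A polynomial in `t⁻¹` that is a power series in `t` is constant. -/
theorem eq_C_of_aeval_eq {r : Polynomial k} {u : PowerSeries k}
    (h : Polynomial.aeval (HahnSeries.single (-1 : ℤ) (1 : k)) r = HahnSeries.ofPowerSeries ℤ k u) :
    r = Polynomial.C (r.coeff 0) := by
  ext n
  rcases Nat.eq_zero_or_pos n with rfl | hn
  · simp
  · rw [Polynomial.coeff_C_of_ne_zero hn.ne', ← coeff_aeval_single_neg_one, h,
      PowerSeries.coeff_coe, if_pos (by omega)]

theorem toLaurent_injective : Function.Injective (WittParams.toLaurent : WittParams k → _) := by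
  intro p p' h
  have hw : p.winding = p'.winding := by
    rw [← order_laurentMap_toLaurent, h, order_laurentMap_toLaurent]
  rw [toLaurent_eq, toLaurent_eq, hw] at h
  obtain ⟨w, c, a, b⟩ := p
  obtain ⟨w', c', a', b'⟩ := p'
  simp only at h hw
  subst hw
  obtain ⟨v, hv⟩ := isUnit_negPoly b'
  obtain ⟨x, hx⟩ : IsUnit (posProduct a) := by
    rw [PowerSeries.isUnit_iff_constantCoeff, constantCoeff_posProduct]
    exact isUnit_one
  have hs : ∀ (c : kˣ) (y z : LaurentSeries k), HahnSeries.single w (c : k) * y * z =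
      HahnSeries.single w 1 * (y * (HahnSeries.ofPowerSeries ℤ k (PowerSeries.C (c : k)) * z)) := by
    intro c y z
    rw [HahnSeries.ofPowerSeries_C, HahnSeries.C_apply, mul_left_comm y, ← mul_assoc,
      ← mul_assoc, HahnSeries.single_mul_single, add_zero, one_mul, mul_assoc]
  rw [hs, hs] at h
  have hsu : IsUnit (HahnSeries.single w (1 : k)) :=
    IsUnit.of_mul_eq_one (HahnSeries.single (-w) 1) (by simp)
  replace h := hsu.mul_left_cancel h
  -- the quotient of the two products in `t⁻¹` is a power series in `t`
  have h1 : Polynomial.aeval (HahnSeries.single (-1 : ℤ) (1 : k))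
      (negPoly b * ((v⁻¹ : _ˣ) : Polynomial k)) =
      HahnSeries.ofPowerSeries ℤ k
        (PowerSeries.C ((c⁻¹ : kˣ) : k) * ((x⁻¹ : _ˣ) : PowerSeries k) *
          (PowerSeries.C (c' : k) * posProduct a')) := by
    have h2 : (1 : LaurentSeries k) =
        Polynomial.aeval (HahnSeries.single (-1 : ℤ) (1 : k)) (negPoly b') *
        Polynomial.aeval (HahnSeries.single (-1 : ℤ) (1 : k)) ((v⁻¹ : _ˣ) : Polynomial k) := by
      rw [← map_mul, ← hv, Units.mul_inv, map_one]
    have h3 : (1 : PowerSeries k) = PowerSeries.C ((c⁻¹ : kˣ) : k) * ((x⁻¹ : _ˣ) : PowerSeries k) *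
        (PowerSeries.C (c : k) * posProduct a) := by
      rw [← hx, mul_mul_mul_comm, Units.inv_mul, mul_one, ← map_mul, Units.inv_mul, map_one]
    have h3' := congrArg (HahnSeries.ofPowerSeries ℤ k) h3
    simp only [map_mul, map_one] at h h3' ⊢
    linear_combination Polynomial.aeval (HahnSeries.single (-1 : ℤ) (1 : k)) (negPoly b) *
        Polynomial.aeval (HahnSeries.single (-1 : ℤ) (1 : k)) ((v⁻¹ : _ˣ) : Polynomial k) * h3' +
      Polynomial.aeval (HahnSeries.single (-1 : ℤ) (1 : k)) ((v⁻¹ : _ˣ) : Polynomial k) *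
        HahnSeries.ofPowerSeries ℤ k (PowerSeries.C ((c⁻¹ : kˣ) : k)) *
        HahnSeries.ofPowerSeries ℤ k ((x⁻¹ : _ˣ) : PowerSeries k) * h -
      HahnSeries.ofPowerSeries ℤ k (PowerSeries.C ((c⁻¹ : kˣ) : k)) *
        HahnSeries.ofPowerSeries ℤ k ((x⁻¹ : _ˣ) : PowerSeries k) *
        HahnSeries.ofPowerSeries ℤ k (PowerSeries.C (c' : k)) *
        HahnSeries.ofPowerSeries ℤ k (posProduct a') * h2
  have h2 := eq_C_of_aeval_eq h1
  have h3 : negPoly b * ((v⁻¹ : _ˣ) : Polynomial k) * negPoly b' = negPoly b := by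
    rw [← hv, Units.inv_mul_cancel_right]
  have h4 : (negPoly b * ((v⁻¹ : _ˣ) : Polynomial k)).coeff 0 = 1 := by
    have h5 := congrArg (fun r => Polynomial.coeff r 0) h3
    simpa only [Polynomial.mul_coeff_zero, coeff_zero_negPoly, mul_one, one_mul] using h5
  rw [h2, h4, map_one, one_mul] at h3
  obtain rfl := negPoly_injective h3
  have hν : IsUnit (Polynomial.aeval (HahnSeries.single (-1 : ℤ) (1 : k)) (negPoly b')) :=
    (isUnit_negPoly b').map _
  replace h := hν.mul_left_cancel h
  rw [← map_mul, ← map_mul] at h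
  replace h := HahnSeries.ofPowerSeries_injective h
  have hc : (c : k) = c' := by
    have h5 := congrArg PowerSeries.constantCoeff h
    simpa [constantCoeff_posProduct] using h5
  obtain rfl := Units.ext hc
  have hcu : IsUnit (PowerSeries.C (c : k)) := c.isUnit.map _
  rw [posProduct_injective (hcu.mul_left_cancel h)]

/-- Subadditivity of `i ↦ ⌈i / (d + 1)⌉`. -/
theorem ceil_div_add_le (d i j : ℕ) :
    (i + j + d) / (d + 1) ≤ (i + d) / (d + 1) + (j + d) / (d + 1) := by
  have h1 := Nat.lt_div_mul_add (a := i + d) (Nat.succ_pos d)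
  have h2 := Nat.lt_div_mul_add (a := j + d) (Nat.succ_pos d)
  rw [← Nat.lt_succ_iff, Nat.div_lt_iff_lt_mul (Nat.succ_pos d)]
  simp only [Nat.succ_eq_add_one, add_mul] at *
  omega

/-- A polynomial with constant coefficient `1` and further coefficients in the maximal ideal `m` is
a finite product `∏ (1 - a_i X^i)` with `a_i ∈ m`: if it has degree at most `d`, then `a_i` belongs
to `m^⌈i/(d+1)⌉`, which vanishes for large `i`. -/
theorem exists_negPoly_eq (p : Polynomial k) (hp : p.coeff 0 = 1)
    (hpm : ∀ i, i ≠ 0 → p.coeff i ∈ maximalIdeal k) : ∃ a, negPoly a = p := by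
  obtain ⟨N, hN⟩ := exists_maximalIdeal_pow_eq_bot k
  obtain ⟨a, ha, haI⟩ := exists_posProduct_eq (p : PowerSeries k) (by simpa using hp)
    (fun i => maximalIdeal k ^ ((i + p.natDegree) / (p.natDegree + 1)))
    (by simp) (fun i j => by
      rw [← pow_add]
      exact Ideal.pow_le_pow_right (ceil_div_add_le _ _ _)) (fun j => by
      rw [Polynomial.coeff_coe]
      rcases Nat.eq_zero_or_pos j with rfl | hj
      · rw [zero_add, Nat.div_eq_of_lt (Nat.lt_succ_self _), pow_zero, Ideal.one_eq_top]
        trivial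
      rcases lt_or_ge p.natDegree j with hj' | hj'
      · rw [Polynomial.coeff_eq_zero_of_natDegree_lt hj']
        exact zero_mem _
      · have h1 : (j + p.natDegree) / (p.natDegree + 1) = 1 :=
          Nat.div_eq_of_lt_le (by omega) (by omega)
        rw [h1, pow_one]
        exact hpm j hj.ne')
  have ham : ∀ i, a i ∈ maximalIdeal k := by
    intro i
    refine Ideal.pow_le_self ?_ (haI i)
    have := i.pos
    exact (Nat.div_pos (by omega) (Nat.succ_pos _)).ne'
  have hfin : (Function.support fun i => (⟨a i, ham i⟩ : maximalIdeal k)).Finite := by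
    refine Set.Finite.subset (Set.Finite.preimage (PNat.coe_injective.injOn)
      (Set.finite_lt_nat (N * (p.natDegree + 1)))) fun i hi => ?_
    by_contra h
    apply hi
    apply Subtype.ext
    have h1 : N ≤ (i + p.natDegree) / (p.natDegree + 1) := by
      rw [Nat.le_div_iff_mul_le (Nat.succ_pos _)]
      exact (not_lt.1 h).trans (Nat.le_add_right _ _)
    have h2 := Ideal.pow_le_pow_right h1 (haI i)
    rw [hN] at h2
    simpa using h2
  refine ⟨Finsupp.ofSupportFinite _ hfin, Polynomial.coe_injective k ?_⟩
  rw [← ha]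
  exact coe_negPoly _

/-- Weierstrass preparation gives `f = t^n q(t) u(t)`, and `q(t) = t^d p(t⁻¹)` for the reversed
polynomial `p`, of which the negative Witt parameters are those of a product. -/
theorem exists_toLaurent_eq (f : (LaurentSeries k)ˣ) : ∃ p : WittParams k, p.toLaurent = f := by
  have := isAdicComplete_maximalIdeal k
  set n := (f : LaurentSeries k).order with hn
  set g := (f : LaurentSeries k).powerSeriesPart with hg
  have hfg : HahnSeries.single n (1 : k) * HahnSeries.ofPowerSeries ℤ k g = f :=
    LaurentSeries.single_order_mul_powerSeriesPart _
  have hg0 : g.map (residue k) ≠ 0 := by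
    intro h
    have h1 : IsUnit (laurentMap (residue k) (f : LaurentSeries k)) := f.isUnit.map _
    rw [← hfg, map_mul, laurentMap_ofPowerSeries, h, map_zero, mul_zero] at h1
    exact not_isUnit_zero h1
  obtain ⟨q, u, hqu⟩ := PowerSeries.exists_isWeierstrassFactorization hg0
  have hq := hqu.isDistinguishedAt
  obtain ⟨b, hb⟩ := exists_negPoly_eq q.reverse
    (by rw [Polynomial.coeff_zero_reverse, hq.monic.leadingCoeff]) (fun i hi => by
      rw [Polynomial.coeff_reverse]
      rcases le_or_gt i q.natDegree with h | h
      · rw [Polynomial.revAt_le h]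
        exact hq.mem (by omega)
      · rw [← Polynomial.revAtFun_eq, Polynomial.revAtFun, if_neg (by omega),
          Polynomial.coeff_eq_zero_of_natDegree_lt h]
        exact zero_mem _)
  obtain ⟨c, hc⟩ := (PowerSeries.isUnit_iff_constantCoeff.1 hqu.isUnit)
  obtain ⟨a, ha, -⟩ := exists_posProduct_eq (PowerSeries.C ((c⁻¹ : kˣ) : k) * u) (by
    simp [← hc]) (fun _ => ⊤) rfl (fun _ _ => le_top) (fun _ => trivial)
  refine ⟨⟨n + q.natDegree, c, a, b⟩, ?_⟩
  have h1 : HahnSeries.single (n + q.natDegree) (c : k) = HahnSeries.single n 1 *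
      HahnSeries.single (1 : ℤ) (1 : k) ^ q.natDegree *
        HahnSeries.ofPowerSeries ℤ k (PowerSeries.C (c : k)) := by
    simp [HahnSeries.ofPowerSeries_C, HahnSeries.C_apply]
  have h2 : HahnSeries.ofPowerSeries ℤ k u = HahnSeries.ofPowerSeries ℤ k (PowerSeries.C (c : k)) *
      HahnSeries.ofPowerSeries ℤ k (posProduct a) := by
    rw [ha, ← map_mul, ← mul_assoc, ← map_mul, Units.mul_inv, map_one, one_mul]
  let : Invertible (HahnSeries.single (1 : ℤ) (1 : k)) :=
    ⟨HahnSeries.single (-1) 1, by simp, by simp⟩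
  have h3 : Polynomial.aeval (HahnSeries.single (-1 : ℤ) (1 : k)) q.reverse *
      HahnSeries.single (1 : ℤ) (1 : k) ^ q.natDegree =
        HahnSeries.ofPowerSeries ℤ k (q : PowerSeries k) := by
    refine (Polynomial.eval₂_reverse_mul_pow (algebraMap k (LaurentSeries k))
      (HahnSeries.single (1 : ℤ) (1 : k)) q).trans ?_
    rw [← Polynomial.coeToPowerSeries.ringHom_apply, ← Polynomial.coe_eval₂RingHom,
      ← RingHom.comp_apply]
    congr 1
    refine Polynomial.ringHom_ext (fun c => ?_) ?_
    · simp [algebraMap_laurentSeries, HahnSeries.C_apply]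
    · simp
  rw [toLaurent_eq]
  simp only
  rw [← hfg, hqu.eq_mul, map_mul, h1, h2, ← h3, hb]
  ring

theorem existsUnique_toLaurent_eq (f : (LaurentSeries k)ˣ) :
    ∃! p : WittParams k, p.toLaurent = f := by
  obtain ⟨p, hp⟩ := exists_toLaurent_eq f
  exact ⟨p, hp, fun p' hp' => toLaurent_injective (hp'.trans hp.symm)⟩

theorem toLaurent_wittParams (f : (LaurentSeries k)ˣ) : (wittParams f).toLaurent = f :=
  Classical.epsilon_spec (exists_toLaurent_eq f)

theorem winding_eq_order (f : (LaurentSeries k)ˣ) :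
    winding f = (laurentMap (residue k) (f : LaurentSeries k)).order := by
  rw [← toLaurent_wittParams f, order_laurentMap_toLaurent]
  rfl

theorem laurentMap_coe_ne_zero (f : (LaurentSeries k)ˣ) :
    laurentMap (residue k) (f : LaurentSeries k) ≠ 0 :=
  (f.isUnit.map (laurentMap (residue k))).ne_zero

theorem winding_mul (f g : (LaurentSeries k)ˣ) : winding (f * g) = winding f + winding g := by
  rw [winding_eq_order, winding_eq_order, winding_eq_order, Units.val_mul, map_mul,
    HahnSeries.order_mul (laurentMap_coe_ne_zero f) (laurentMap_coe_ne_zero g)]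

end Presentation

/-! ### The Contou-Carrère symbol as a commutator -/

section MainFormula

open IsLocalRing (maximalIdeal)

variable {k : Type*} [CommRing k] [IsArtinianRing k] [IsLocalRing k]

theorem isDistinguishedAt_X_pow_sub_C (j : ℕ+) (c : maximalIdeal k) :
    (Polynomial.X ^ (j : ℕ) - Polynomial.C (c : k)).IsDistinguishedAt (maximalIdeal k) := by
  refine ⟨⟨fun {n} hn => ?_⟩, Polynomial.monic_X_pow_sub_C _ j.ne_zero⟩
  rw [Polynomial.natDegree_X_pow_sub_C] at hn
  rw [Polynomial.coeff_sub, Polynomial.coeff_X_pow, if_neg hn.ne, zero_sub, Polynomial.coeff_C]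
  split_ifs
  · exact neg_mem c.2
  · simp

/-- The norm, from `k[[X]] / (q)` to `k`, of the class of a polynomial. -/
theorem norm_quotient_mk_coe {q : Polynomial k} (hq : q.IsDistinguishedAt (maximalIdeal k))
    (p : Polynomial k) :
    Algebra.norm k (Ideal.Quotient.mk (Ideal.span {(q : PowerSeries k)}) (p : PowerSeries k)) =
      Algebra.norm k (AdjoinRoot.mk q p) := by
  have := isAdicComplete_maximalIdeal k
  exact Algebra.norm_eq_of_algEquiv hq.algEquivQuotient (AdjoinRoot.mk q p)

theorem coe_ccUnit (a : k) (b : maximalIdeal k) (i j : ℕ+) : (ccUnit a b i j : k) =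
    1 - a ^ ((j : ℕ) / Nat.gcd i j) * (b : k) ^ ((i : ℕ) / Nat.gcd i j) :=
  rfl

theorem ccUnit_zero (a : k) (i j : ℕ+) : ccUnit a 0 i j = 1 := by
  ext
  have h : (i : ℕ) / Nat.gcd i j ≠ 0 :=
    (Nat.div_pos (Nat.gcd_le_left _ i.pos) (Nat.gcd_pos_of_pos_left _ i.pos)).ne'
  simp [coe_ccUnit, h]

/-- The norm of `∏ (1 - b_i X^i)` from `k[[X]] / (X^j - c)`: as `c^e = 0` for some `e`, the power
`X^(je)` vanishes in this ring, so that only the factors with `i ≤ je` matter. -/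
theorem norm_posProduct (b : ℕ+ → k) (j : ℕ+) (c : maximalIdeal k) :
    Algebra.norm k (Ideal.Quotient.mk (Ideal.span
      {((Polynomial.X ^ (j : ℕ) - Polynomial.C (c : k) : Polynomial k) : PowerSeries k)})
        (posProduct b)) = ((∏ᶠ i : ℕ+, ccUnit (b i) c i j ^ Nat.gcd i j : kˣ) : k) := by
  obtain ⟨e, he⟩ := exists_maximalIdeal_pow_eq_bot k
  have hc : (c : k) ^ e = 0 := by
    have := Ideal.pow_mem_pow c.2 e
    rwa [he] at this
  set q : Polynomial k := Polynomial.X ^ (j : ℕ) - Polynomial.C (c : k) with hq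
  have h1 : Ideal.Quotient.mk (Ideal.span {(q : PowerSeries k)}) (PowerSeries.X ^ (j * e : ℕ)) =
      0 := by
    have h2 : Ideal.Quotient.mk (Ideal.span {(q : PowerSeries k)}) (PowerSeries.X ^ (j : ℕ)) =
        Ideal.Quotient.mk _ (PowerSeries.C (c : k)) := by
      rw [Ideal.Quotient.eq, Ideal.mem_span_singleton]
      simp [hq]
    rw [pow_mul, map_pow, h2, ← map_pow, ← map_pow, hc, map_zero, map_zero]
  have h3 : Ideal.Quotient.mk (Ideal.span {(q : PowerSeries k)}) (posProduct b) =
      Ideal.Quotient.mk _ (posPartial b (j * e)) := by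
    rw [← sub_eq_zero, ← map_sub]
    obtain ⟨r, hr⟩ : (PowerSeries.X : PowerSeries k) ^ (j * e : ℕ) ∣
        posProduct b - posPartial b (j * e) := by
      rw [PowerSeries.X_pow_dvd_iff]
      intro m hm
      rw [map_sub, coeff_posPartial_of_le b hm.le, sub_self]
    rw [hr, map_mul, h1, zero_mul]
  have h4 : (Function.mulSupport fun i : ℕ+ => ccUnit (b i) c i j ^ Nat.gcd i j) ⊆
      ((Finset.range (j * e)).map ⟨Nat.succPNat, Nat.succPNat_injective⟩ : Finset ℕ+) := by
    intro i hi
    rw [Finset.mem_coe, Finset.mem_map]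
    refine ⟨i.natPred, Finset.mem_range.2 ?_, PNat.succPNat_natPred i⟩
    by_contra h5
    apply hi
    have h6 : e ≤ (i : ℕ) / Nat.gcd i j := by
      rw [Nat.le_div_iff_mul_le (Nat.gcd_pos_of_pos_left _ i.pos), mul_comm]
      have := i.natPred_add_one
      exact (Nat.mul_le_mul_right e (Nat.gcd_le_right _ j.pos)).trans (by omega)
    have h7 : ccUnit (b i) c i j = 1 := by
      ext
      rw [coe_ccUnit, pow_eq_zero_of_le h6 hc, mul_zero, sub_zero, Units.val_one]
    simp only [h7, one_pow]
  rw [h3, posPartial, map_prod, map_prod, finprod_eq_prod_of_mulSupport_subset _ h4,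
    Finset.prod_map, Units.coe_prod]
  refine Finset.prod_congr rfl fun i _ => ?_
  have h8 : (1 - PowerSeries.C (b i.succPNat) * PowerSeries.X ^ (i + 1) : PowerSeries k) =
      ((1 - Polynomial.C (b i.succPNat) * Polynomial.X ^ (i + 1) : Polynomial k) :
        PowerSeries k) := by
    simp
  rw [h8, norm_quotient_mk_coe (isDistinguishedAt_X_pow_sub_C j c),
    norm_one_sub_mul_X_pow _ j.ne_zero]
  rfl

theorem norm_C (a : k) (j : ℕ+) (c : maximalIdeal k) :
    Algebra.norm k (Ideal.Quotient.mk (Ideal.span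
      {((Polynomial.X ^ (j : ℕ) - Polynomial.C (c : k) : Polynomial k) : PowerSeries k)})
        (PowerSeries.C a)) = a ^ (j : ℕ) := by
  have h1 : (PowerSeries.C a : PowerSeries k) =
      ((Polynomial.C a : Polynomial k) : PowerSeries k) := by
    simp
  have hq := isDistinguishedAt_X_pow_sub_C j c
  rw [h1, norm_quotient_mk_coe hq]
  have := hq.monic.free_adjoinRoot
  change Algebra.norm k (algebraMap k (AdjoinRoot _) a) = _
  rw [Algebra.norm_algebraMap_of_basis (AdjoinRoot.powerBasisAux' hq.monic), Fintype.card_fin,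
    Polynomial.natDegree_X_pow_sub_C]

variable (k) in
/-- The variable `t`, as a unit of `k((t))`. -/
noncomputable def tUnit : (LaurentSeries k)ˣ :=
  ⟨HahnSeries.single 1 1, HahnSeries.single (-1) 1, by simp, by simp⟩

theorem coe_tUnit_zpow (n : ℤ) :
    ((tUnit k ^ n : (LaurentSeries k)ˣ) : LaurentSeries k) = HahnSeries.single n 1 := by
  obtain ⟨n, rfl | rfl⟩ := n.eq_nat_or_neg
  · simp [tUnit]
  · rw [zpow_neg, ← inv_zpow, zpow_natCast]
    simp [tUnit]

theorem isUnit_negFactor (i : ℕ+) (c : maximalIdeal k) :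
    IsUnit (1 - HahnSeries.single (-(i : ℤ)) (c : k) : LaurentSeries k) := by
  refine IsNilpotent.isUnit_one_sub ?_
  obtain ⟨N, hN⟩ := exists_maximalIdeal_pow_eq_bot k
  refine ⟨N, ?_⟩
  have h1 := Ideal.pow_mem_pow c.2 N
  rw [hN] at h1
  rw [HahnSeries.single_pow, (show (c : k) ^ N = 0 from h1), map_zero]

/-- The unit `1 - c t^{-i}` of `k((t))`. -/
noncomputable def negFactor (i : ℕ+) (c : maximalIdeal k) : (LaurentSeries k)ˣ :=
  (isUnit_negFactor i c).unit

theorem coe_negFactor_mul_tUnit_pow (i : ℕ+) (c : maximalIdeal k) :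
    ((negFactor i c * tUnit k ^ (i : ℕ) : (LaurentSeries k)ˣ) : LaurentSeries k) =
      HahnSeries.ofPowerSeries ℤ k
        ((Polynomial.X ^ (i : ℕ) - Polynomial.C (c : k) : Polynomial k) : PowerSeries k) := by
  rw [Units.val_mul, ← zpow_natCast, coe_tUnit_zpow]
  change (1 - HahnSeries.single (-(i : ℤ)) (c : k) : LaurentSeries k) * _ = _
  rw [sub_mul, one_mul, HahnSeries.single_mul_single]
  simp [HahnSeries.ofPowerSeries_C, HahnSeries.C_apply]

/-- The variable is the case `j = 1`, `c = 0` of `X^j - c`, so that its symbols need no separate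
computation. -/
theorem coe_tUnit_eq : (tUnit k : LaurentSeries k) = HahnSeries.ofPowerSeries ℤ k
    ((Polynomial.X ^ ((1 : ℕ+) : ℕ) - Polynomial.C ((0 : maximalIdeal k) : k) : Polynomial k) :
      PowerSeries k) := by
  simp [tUnit]

/-- The unit `c ∏ (1 - a_i X^i)` of `k[[X]]`. -/
noncomputable def posUnit (c : kˣ) (a : ℕ+ → k) : (PowerSeries k)ˣ :=
  (show IsUnit (PowerSeries.C (c : k) * posProduct a) by
    rw [PowerSeries.isUnit_iff_constantCoeff, map_mul, PowerSeries.constantCoeff_C,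
      constantCoeff_posProduct, mul_one]
    exact c.isUnit).unit

theorem coe_posUnit (c : kˣ) (a : ℕ+ → k) :
    (posUnit c a : PowerSeries k) = PowerSeries.C (c : k) * posProduct a :=
  rfl

theorem symbol_posUnit_of_coe_eq {f : (LaurentSeries k)ˣ} {j : ℕ+} {c : maximalIdeal k}
    (hf : (f : LaurentSeries k) = HahnSeries.ofPowerSeries ℤ k
      ((Polynomial.X ^ (j : ℕ) - Polynomial.C (c : k) : Polynomial k) : PowerSeries k))
    (b₀ : kˣ) (b : ℕ+ → k) : symbol k f (psUnit (posUnit b₀ b)) =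
      b₀ ^ (j : ℕ) * ∏ᶠ i : ℕ+, ccUnit (b i) c i j ^ Nat.gcd i j := by
  ext
  rw [symbol_psUnit_right (isDistinguishedAt_X_pow_sub_C j c) hf, coe_posUnit, map_mul, map_mul,
    norm_C, norm_posProduct, Units.val_mul, Units.val_pow_eq_pow_val]

theorem symbol_tUnit_posUnit (b₀ : kˣ) (b : ℕ+ → k) :
    symbol k (tUnit k) (psUnit (posUnit b₀ b)) = b₀ := by
  rw [symbol_posUnit_of_coe_eq coe_tUnit_eq]
  simp [ccUnit_zero]

theorem symbol_negFactor_posUnit (j : ℕ+) (c : maximalIdeal k) (b₀ : kˣ) (b : ℕ+ → k) :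
    symbol k (negFactor j c) (psUnit (posUnit b₀ b)) =
      ∏ᶠ i : ℕ+, ccUnit (b i) c i j ^ Nat.gcd i j := by
  have h := symbol_posUnit_of_coe_eq (coe_negFactor_mul_tUnit_pow j c) b₀ b
  rw [map_mul, MonoidHom.mul_apply, map_pow, MonoidHom.pow_apply, symbol_tUnit_posUnit,
    mul_comm] at h
  exact mul_left_cancel h

theorem symbol_negFactor_tUnit (i : ℕ+) (c : maximalIdeal k) :
    symbol k (negFactor i c) (tUnit k) = 1 := by
  have h := symbol_distinguished (isDistinguishedAt_X_pow_sub_C i c)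
    (coe_negFactor_mul_tUnit_pow i c) (isDistinguishedAt_X_pow_sub_C 1 0) coe_tUnit_eq
  rwa [map_mul, MonoidHom.mul_apply, map_pow, MonoidHom.pow_apply, symbol_self, one_pow,
    mul_one] at h

theorem symbol_negFactor_negFactor (i j : ℕ+) (c d : maximalIdeal k) :
    symbol k (negFactor i c) (negFactor j d) = 1 := by
  have h := symbol_distinguished (isDistinguishedAt_X_pow_sub_C i c)
    (coe_negFactor_mul_tUnit_pow i c) (isDistinguishedAt_X_pow_sub_C j d)
    (coe_negFactor_mul_tUnit_pow j d)
  simpa only [map_mul, MonoidHom.mul_apply, map_pow, MonoidHom.pow_apply, symbol_self,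
    symbol_negFactor_tUnit, symbol_swap (negFactor j d) (tUnit k), inv_one, one_pow,
    mul_one] using h

/-- The unit `∏ (1 - a_i t^{-i})` of `k((t))`. -/
noncomputable def negUnit (a : ℕ+ →₀ maximalIdeal k) : (LaurentSeries k)ˣ :=
  ∏ i ∈ a.support, negFactor i (a i)

theorem symbol_negUnit_tUnit (a : ℕ+ →₀ maximalIdeal k) :
    symbol k (negUnit a) (tUnit k) = 1 := by
  rw [negUnit, map_prod, MonoidHom.finsetProd_apply]
  exact Finset.prod_eq_one fun i _ => symbol_negFactor_tUnit _ _

theorem symbol_negUnit_negUnit (a b : ℕ+ →₀ maximalIdeal k) :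
    symbol k (negUnit a) (negUnit b) = 1 := by
  rw [negUnit, map_prod, MonoidHom.finsetProd_apply]
  refine Finset.prod_eq_one fun i _ => ?_
  rw [negUnit, map_prod]
  exact Finset.prod_eq_one fun j _ => symbol_negFactor_negFactor _ _ _ _

theorem symbol_negUnit_posUnit (a : ℕ+ →₀ maximalIdeal k) (b₀ : kˣ) (b : ℕ+ → k) :
    symbol k (negUnit a) (psUnit (posUnit b₀ b)) = ccProduct b a := by
  rw [negUnit, map_prod, MonoidHom.finsetProd_apply, ccProduct,
    ← finprod_comp_equiv (Equiv.prodComm ℕ+ ℕ+), finprod_curry]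
  · simp only [symbol_negFactor_posUnit]
    rw [finprod_eq_prod_of_mulSupport_subset]
    · rfl
    · intro j hj
      rw [Finset.mem_coe, Finsupp.mem_support_iff]
      intro h
      apply hj
      refine finprod_eq_one_of_forall_eq_one fun i => ?_
      change ccUnit (b i) (a j) i j ^ Nat.gcd i j = 1
      rw [h, ccUnit_zero, one_pow]
  · exact (ccProduct_finite b a).preimage (Equiv.prodComm ℕ+ ℕ+).injective.injOn

theorem eq_mul_of_toLaurent_eq {f : (LaurentSeries k)ˣ} {p : WittParams k} (h : p.toLaurent = f) :
    f = tUnit k ^ p.winding * negUnit p.neg * psUnit (posUnit p.const p.pos) := by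
  ext1
  rw [← h, WittParams.toLaurent, Units.val_mul, Units.val_mul, coe_tUnit_zpow, coe_psUnit,
    coe_posUnit, map_mul, negUnit, Units.coe_prod, HahnSeries.ofPowerSeries_C, HahnSeries.C_apply,
    ← mul_assoc, mul_right_comm _ _ (HahnSeries.single 0 (p.const : k)),
    HahnSeries.single_mul_single, add_zero, one_mul]
  rfl

/-- The commutator symbol in terms of winding numbers and Witt parameters. -/
theorem symbol_eq (f g : (LaurentSeries k)ˣ) : symbol k f g =
    (wittParams g).const ^ winding f / (wittParams f).const ^ winding g *
      (ccProduct (wittParams g).pos (wittParams f).neg /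
        ccProduct (wittParams f).pos (wittParams g).neg) := by
  conv_lhs => rw [eq_mul_of_toLaurent_eq (toLaurent_wittParams f),
    eq_mul_of_toLaurent_eq (toLaurent_wittParams g)]
  simp only [map_mul, MonoidHom.mul_apply, map_zpow, MonoidHom.zpow_apply]
  rw [symbol_swap (tUnit k) (psUnit _), symbol_swap (negUnit _) (psUnit _),
    symbol_swap (negUnit _) (tUnit k), symbol_psUnit_psUnit, symbol_negUnit_negUnit,
    symbol_negUnit_tUnit, symbol_negUnit_tUnit, symbol_self, symbol_tUnit_posUnit,
    symbol_tUnit_posUnit, symbol_negUnit_posUnit, symbol_negUnit_posUnit]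
  simp only [winding, one_zpow, inv_one, one_mul, mul_one, inv_zpow]
  rw [div_eq_mul_inv, div_eq_mul_inv, mul_comm, mul_mul_mul_comm]

theorem inv_neg_one_zpow (n : ℤ) : ((-1 : kˣ) ^ n)⁻¹ = (-1) ^ n := by
  rw [← inv_zpow, inv_neg_one]

/-- The Contou-Carrère symbol is, up to sign, the inverse of the commutator symbol. -/
theorem contouCarrere_inv (f g : (LaurentSeries k)ˣ) :
    (contouCarrere f g)⁻¹ = (-1) ^ (winding f * winding g) * symbol k f g := by
  rw [contouCarrere, symbol_eq, mul_inv, mul_inv, inv_neg_one_zpow, inv_div, inv_div,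
    mul_assoc]

theorem contouCarrere_mul_left (f f' g : (LaurentSeries k)ˣ) :
    contouCarrere (f * f') g = contouCarrere f g * contouCarrere f' g := by
  rw [← inv_inj, mul_inv, contouCarrere_inv, contouCarrere_inv, contouCarrere_inv, winding_mul,
    map_mul, MonoidHom.mul_apply, add_mul, zpow_add, mul_mul_mul_comm]

theorem contouCarrere_mul_right (f g g' : (LaurentSeries k)ˣ) :
    contouCarrere f (g * g') = contouCarrere f g * contouCarrere f g' := by
  rw [← inv_inj, mul_inv, contouCarrere_inv, contouCarrere_inv, contouCarrere_inv, winding_mul,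
    map_mul, mul_add, zpow_add, mul_mul_mul_comm]

end MainFormula

/-! ### The filtration of `k((t))` by order -/

section OrderFiltration

variable {k : Type*} [CommRing k]

variable (k) in
/-- The submodule `t^n k[[t]]` of `k((t))`. -/
def ordGE (n : ℤ) : Submodule k (LaurentSeries k) where
  carrier := {x | ∀ d < n, x.coeff d = 0}
  add_mem' := by
    intro f g hf hg d hd
    rw [HahnSeries.coeff_add, hf d hd, hg d hd, add_zero]
  zero_mem' := fun _ _ => rfl
  smul_mem' := by
    intro c f hf d hd
    simp [hf d hd]

theorem ordGE_anti {m n : ℤ} (h : m ≤ n) : ordGE k n ≤ ordGE k m :=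
  fun _ hx d hd => hx d (hd.trans_le h)

theorem exists_mem_ordGE (x : LaurentSeries k) : ∃ n, x ∈ ordGE k n :=
  ⟨x.order, fun _ hd => HahnSeries.coeff_eq_zero_of_lt_order hd⟩

theorem mul_mem_ordGE {m n : ℤ} {x y : LaurentSeries k} (hx : x ∈ ordGE k m) (hy : y ∈ ordGE k n) :
    x * y ∈ ordGE k (m + n) := by
  intro d hd
  rw [HahnSeries.coeff_mul]
  refine Finset.sum_eq_zero fun p hp => ?_
  rw [Finset.mem_antidiagonal] at hp
  rcases lt_or_ge p.1 m with h | h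
  · rw [hx _ h, zero_mul]
  · rw [hy _ (by omega), mul_zero]

theorem single_mem_ordGE (n : ℤ) (a : k) : HahnSeries.single n a ∈ ordGE k n :=
  fun _ hd => HahnSeries.coeff_single_of_ne hd.ne

/-- An additive map of `k((t))` that lowers the order by at most a constant is determined by its
values at the monomials. -/
theorem eq_zero_of_single {F : LaurentSeries k →+ LaurentSeries k} {E : ℤ}
    (hF : ∀ n, ∀ x ∈ ordGE k n, F x ∈ ordGE k (n - E))
    (hs : ∀ n a, F (HahnSeries.single n a) = 0) (x : LaurentSeries k) : F x = 0 := by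
  obtain ⟨n₀, hx⟩ := exists_mem_ordGE x
  have key : ∀ N : ℕ, ∃ r ∈ ordGE k (n₀ + N), F x = F r := by
    intro N
    induction N with
    | zero => exact ⟨x, by simpa using hx, rfl⟩
    | succ N ih =>
      obtain ⟨r, hr, h⟩ := ih
      refine ⟨r - HahnSeries.single (n₀ + N : ℤ) (r.coeff (n₀ + N)), fun d hd => ?_, ?_⟩
      · rw [HahnSeries.coeff_sub]
        rcases (show d < n₀ + N ∨ d = n₀ + N by push_cast at hd; omega) with h' | rfl
        · rw [hr d h', HahnSeries.coeff_single_of_ne h'.ne, sub_zero]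
        · rw [HahnSeries.coeff_single_same, sub_self]
      · rw [map_sub, hs, sub_zero, h]
  ext d
  obtain ⟨r, hr, h⟩ := key (d + E + 1 - n₀).toNat
  rw [h, hF _ r hr d (by have := Int.self_le_toNat (d + E + 1 - n₀); omega)]
  rfl

end OrderFiltration

/-! ### Powers of a unit of winding number one -/

section Powers

open IsLocalRing (maximalIdeal residue)

variable {k : Type*} [CommRing k]

/-- The Laurent series with coefficients of `t^{-j}` in the `j`-th member of a multiplicative
filtration by ideals, for `j ≥ 0`. -/
def filtrationSubmonoid (I : ℕ → Ideal k) (hI0 : I 0 = ⊤) (hanti : Antitone I)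
    (hI : ∀ i j, I i * I j ≤ I (i + j)) : Submonoid (LaurentSeries k) where
  carrier := {x | ∀ n : ℤ, x.coeff n ∈ I (-n).toNat}
  one_mem' := by
    intro n
    rw [HahnSeries.coeff_one]
    split_ifs with h
    · subst h
      rw [neg_zero, Int.toNat_zero, hI0]
      trivial
    · exact zero_mem _
  mul_mem' := by
    intro x y hx hy n
    rw [HahnSeries.coeff_mul]
    refine sum_mem fun p hp => ?_
    rw [Finset.mem_antidiagonal] at hp
    have h := hI _ _ (Ideal.mul_mem_mul (hx p.1) (hy p.2))
    exact hanti (by omega) h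

variable [IsArtinianRing k] [IsLocalRing k]

theorem coe_negUnit (b : ℕ+ →₀ maximalIdeal k) : (negUnit b : LaurentSeries k) =
    Polynomial.aeval (HahnSeries.single (-1 : ℤ) (1 : k)) (negPoly b) := by
  rw [aeval_negPoly, negUnit, Units.coe_prod]
  rfl

/-- The powers `τ^n`, `n ∈ ℤ`, of a unit of winding number one have order at least `n - D`, for
some `D` that does not depend on `n`: both `τ / t` and its inverse lie in a submonoid of Laurent
series with coefficients of `t^{-j}` in `m^⌈j/(δ+1)⌉`, which vanishes for large `j`. -/
theorem exists_zpow_mem_ordGE {τ : (LaurentSeries k)ˣ} (hτ : winding τ = 1) :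
    ∃ D : ℕ, ∀ n : ℤ, ((τ ^ n : (LaurentSeries k)ˣ) : LaurentSeries k) ∈ ordGE k (n - D) := by
  obtain ⟨e, he⟩ := exists_maximalIdeal_pow_eq_bot k
  have h1 := eq_mul_of_toLaurent_eq (toLaurent_wittParams τ)
  obtain ⟨V, hV⟩ := isUnit_negPoly (wittParams τ).neg
  set u := posUnit (wittParams τ).const (wittParams τ).pos
  set s := negUnit (wittParams τ).neg * psUnit u with hs
  have h2 : τ = tUnit k * s := by
    conv_lhs => rw [h1]
    rw [show (wittParams τ).winding = 1 from hτ, zpow_one, mul_assoc]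
  set δ := max (V : Polynomial k).natDegree ((V⁻¹ : _ˣ) : Polynomial k).natDegree with hδ
  let I : ℕ → Ideal k := fun j => maximalIdeal k ^ ((j + δ) / (δ + 1))
  have hI0 : I 0 = ⊤ := by
    change maximalIdeal k ^ ((0 + δ) / (δ + 1)) = ⊤
    rw [zero_add, Nat.div_eq_of_lt (Nat.lt_succ_self _), pow_zero, Ideal.one_eq_top]
  have htop : ∀ x : k, x ∈ I 0 := fun x => by
    rw [hI0]
    trivial
  let R := filtrationSubmonoid I hI0
    (fun i j hij => Ideal.pow_le_pow_right (Nat.div_le_div_right (by omega)))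
    (fun i j => by
      rw [← pow_add]
      exact Ideal.pow_le_pow_right (ceil_div_add_le _ _ _))
  have hps : ∀ p : PowerSeries k, HahnSeries.ofPowerSeries ℤ k p ∈ R := by
    intro p n
    rw [PowerSeries.coeff_coe]
    split_ifs with h
    · exact zero_mem _
    · rw [Int.toNat_of_nonpos (by omega)]
      exact htop _
  have hpoly : ∀ v : (Polynomial k)ˣ, (v : Polynomial k).natDegree ≤ δ →
      Polynomial.aeval (HahnSeries.single (-1 : ℤ) (1 : k)) (v : Polynomial k) ∈ R := by
    intro v hv n
    rcases lt_or_ge 0 n with hn | hn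
    · rw [Int.toNat_of_nonpos (by omega)]
      exact htop _
    · obtain ⟨j, rfl⟩ : ∃ j : ℕ, n = -(j : ℤ) := ⟨(-n).toNat, by omega⟩
      rw [coeff_aeval_single_neg_one, neg_neg, Int.toNat_natCast]
      rcases Nat.eq_zero_or_pos j with rfl | hj
      · exact htop _
      rcases lt_or_ge (v : Polynomial k).natDegree j with hj' | hj'
      · rw [Polynomial.coeff_eq_zero_of_natDegree_lt hj']
        exact zero_mem _
      · have h1 : (j + δ) / (δ + 1) = 1 := Nat.div_eq_of_lt_le (by omega) (by omega)
        change _ ∈ maximalIdeal k ^ ((j + δ) / (δ + 1))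
        rw [h1, pow_one]
        have h3 := (Polynomial.isUnit_iff_coeff_isUnit_isNilpotent.1 v.isUnit).2 j hj.ne'
        exact (IsLocalRing.mem_maximalIdeal _).2 fun h => h3.not_isUnit h
  have hsR : (s : LaurentSeries k) ∈ R := by
    rw [hs, Units.val_mul, coe_negUnit, ← hV]
    exact R.mul_mem (hpoly V (le_max_left _ _)) (hps _)
  have hsR' : ((s⁻¹ : (LaurentSeries k)ˣ) : LaurentSeries k) ∈ R := by
    have h3 : (negUnit (wittParams τ).neg)⁻¹ =
        Units.map (Polynomial.aeval (HahnSeries.single (-1 : ℤ) (1 : k))).toRingHom.toMonoidHom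
          V⁻¹ := by
      rw [map_inv, inv_inj]
      ext1
      rw [coe_negUnit, ← hV]
      rfl
    rw [hs, mul_inv, Units.val_mul, ← map_inv, h3]
    exact R.mul_mem (hpoly V⁻¹ (le_max_right _ _)) (hps _)
  have hpow : ∀ n : ℤ, ((s ^ n : (LaurentSeries k)ˣ) : LaurentSeries k) ∈ R := by
    intro n
    obtain ⟨n, rfl | rfl⟩ := n.eq_nat_or_neg
    · rw [zpow_natCast, Units.val_pow_eq_pow_val]
      exact R.pow_mem hsR n
    · rw [zpow_neg, ← inv_zpow, zpow_natCast, Units.val_pow_eq_pow_val]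
      exact R.pow_mem hsR' n
  refine ⟨e * (δ + 1), fun n d hd => ?_⟩
  rw [h2, mul_zpow, Units.val_mul, coe_tUnit_zpow, HahnSeries.coeff_single_mul, one_mul]
  have h4 := hpow n (d - n)
  have h5 : e ≤ ((-(d - n)).toNat + δ) / (δ + 1) := by
    rw [Nat.le_div_iff_mul_le (Nat.succ_pos _), Nat.succ_eq_add_one]
    omega
  have h6 := Ideal.pow_le_pow_right h5 h4
  rwa [he] at h6

theorem winding_zpow (f : (LaurentSeries k)ˣ) (n : ℤ) : winding (f ^ n) = n * winding f := by
  have h := map_zpow (MonoidHom.mk' (fun f : (LaurentSeries k)ˣ => Multiplicative.ofAdd (winding f))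
    (fun f g => by rw [winding_mul, ofAdd_add])) f n
  have h' := congrArg Multiplicative.toAdd h
  simpa using h'

theorem residue_coeff_of_lt {f : (LaurentSeries k)ˣ} {n : ℤ} (h : n < winding f) :
    residue k ((f : LaurentSeries k).coeff n) = 0 := by
  rw [winding_eq_order] at h
  exact HahnSeries.coeff_eq_zero_of_lt_order h

theorem residue_coeff_winding (f : (LaurentSeries k)ˣ) :
    residue k ((f : LaurentSeries k).coeff (winding f)) ≠ 0 := by
  rw [winding_eq_order]
  intro h
  exact laurentMap_coe_ne_zero f (HahnSeries.coeff_order_eq_zero.1 h)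

theorem winding_eq_of_residue {f : (LaurentSeries k)ˣ} {w : ℤ}
    (h : ∀ n < w, residue k ((f : LaurentSeries k).coeff n) = 0)
    (hw : residue k ((f : LaurentSeries k).coeff w) ≠ 0) : winding f = w := by
  refine le_antisymm (not_lt.1 fun h' => hw (residue_coeff_of_lt h'))
    (not_lt.1 fun h' => residue_coeff_winding f (h _ h'))

end Powers

/-! ### Linear maps `∑ f_n t^n ↦ ∑ f_n T_n` -/

section Subst

variable {k : Type*} [CommRing k] {T : ℤ → LaurentSeries k} {D : ℕ}

theorem support_mul_coeff_finite (hT : ∀ n, T n ∈ ordGE k (n - D)) (f : LaurentSeries k) (d : ℤ) :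
    (Function.support fun n : ℤ => f.coeff n * (T n).coeff d).Finite := by
  obtain ⟨n₀, hf⟩ := exists_mem_ordGE f
  refine (Set.finite_Icc n₀ (d + D)).subset fun n hn => ?_
  by_contra h
  rw [Set.mem_Icc, not_and_or, not_le, not_le] at h
  apply hn
  rcases h with h | h
  · simp only [hf n h, zero_mul]
  · simp only [hT n d (by omega), mul_zero]

theorem finsum_mul_coeff_eq_zero (hT : ∀ n, T n ∈ ordGE k (n - D)) {f : LaurentSeries k} {n₀ : ℤ}
    (hf : f ∈ ordGE k n₀) {d : ℤ} (hd : d < n₀ - D) : ∑ᶠ n : ℤ, f.coeff n * (T n).coeff d = 0 := by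
  refine finsum_eq_zero_of_forall_eq_zero fun n => ?_
  rcases lt_or_ge n n₀ with h | h
  · rw [hf n h, zero_mul]
  · rw [hT n d (by omega), mul_zero]

/-- The linear map `∑ f_n t^n ↦ ∑ f_n T_n`, for a family `(T_n)` of Laurent series such that the
order of `T_n` is at least `n - D`. -/
noncomputable def seriesMap (T : ℤ → LaurentSeries k) (hT : ∀ n, T n ∈ ordGE k (n - D)) :
    LaurentSeries k →ₗ[k] LaurentSeries k where
  toFun f := HahnSeries.ofSuppBddBelow (fun d => ∑ᶠ n : ℤ, f.coeff n * (T n).coeff d) (by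
    obtain ⟨n₀, hf⟩ := exists_mem_ordGE f
    refine ⟨n₀ - D, fun d hd => ?_⟩
    by_contra h
    exact hd (finsum_mul_coeff_eq_zero hT hf (not_le.1 h)))
  map_add' f g := by
    ext d
    simp only [HahnSeries.coeff_add, HahnSeries.coeff_ofSuppBddBelow, add_mul]
    exact finsum_add_distrib (support_mul_coeff_finite hT f d) (support_mul_coeff_finite hT g d)
  map_smul' c f := by
    ext d
    simp only [RingHom.id_apply, HahnSeries.coeff_smul, HahnSeries.coeff_ofSuppBddBelow,
      smul_eq_mul, mul_assoc]
    exact (mul_finsum' _ _ (support_mul_coeff_finite hT f d)).symm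

variable (hT : ∀ n, T n ∈ ordGE k (n - D))

theorem coeff_seriesMap (f : LaurentSeries k) (d : ℤ) :
    (seriesMap T hT f).coeff d = ∑ᶠ n : ℤ, f.coeff n * (T n).coeff d :=
  rfl

theorem seriesMap_mem_ordGE {n : ℤ} {x : LaurentSeries k} (hx : x ∈ ordGE k n) :
    seriesMap T hT x ∈ ordGE k (n - D) :=
  fun _ hd => finsum_mul_coeff_eq_zero hT hx hd

theorem seriesMap_single (n : ℤ) (a : k) :
    seriesMap T hT (HahnSeries.single n a) = HahnSeries.single 0 a * T n := by
  ext d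
  rw [coeff_seriesMap, finsum_eq_single _ n, HahnSeries.coeff_single_same,
    HahnSeries.coeff_single_zero_mul]
  intro m hm
  rw [HahnSeries.coeff_single_of_ne hm, zero_mul]

/-- If `T_{m+n} = T_m T_n`, then `∑ f_n t^n ↦ ∑ f_n T_n` is multiplicative: by continuity, it
suffices to compare products of monomials. -/
theorem seriesMap_mul (hmul : ∀ m n, T (m + n) = T m * T n) (f g : LaurentSeries k) :
    seriesMap T hT (f * g) = seriesMap T hT f * seriesMap T hT g := by
  have h1 : ∀ (n : ℤ) (a : k) (f : LaurentSeries k),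
      seriesMap T hT (f * HahnSeries.single n a) =
        seriesMap T hT f * seriesMap T hT (HahnSeries.single n a) := by
    intro n a f
    rw [← sub_eq_zero]
    refine eq_zero_of_single (F := (seriesMap T hT).toAddMonoidHom.comp
      (AddMonoidHom.mulRight (HahnSeries.single n a)) - (AddMonoidHom.mulRight
        (seriesMap T hT (HahnSeries.single n a))).comp (seriesMap T hT).toAddMonoidHom)
      (E := 2 * D - n) (fun m x hx => ?_) (fun m b => ?_) f
    · refine sub_mem (ordGE_anti ?_ (seriesMap_mem_ordGE hT
        (mul_mem_ordGE hx (single_mem_ordGE n a)))) (ordGE_anti ?_ (mul_mem_ordGE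
          (seriesMap_mem_ordGE hT hx) (seriesMap_mem_ordGE hT (single_mem_ordGE n a))))
      · omega
      · omega
    · change seriesMap T hT (HahnSeries.single m b * HahnSeries.single n a) -
        seriesMap T hT (HahnSeries.single m b) * seriesMap T hT (HahnSeries.single n a) = 0
      rw [HahnSeries.single_mul_single, seriesMap_single, seriesMap_single, seriesMap_single, hmul,
        mul_mul_mul_comm, HahnSeries.single_mul_single, zero_add, sub_self]
  obtain ⟨n₀, hf⟩ := exists_mem_ordGE f
  rw [← sub_eq_zero]
  refine eq_zero_of_single (F := (seriesMap T hT).toAddMonoidHom.comp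
    (AddMonoidHom.mulLeft f) - (AddMonoidHom.mulLeft
      (seriesMap T hT f)).comp (seriesMap T hT).toAddMonoidHom)
    (E := 2 * D - n₀) (fun m x hx => ?_) (fun m b => ?_) g
  · refine sub_mem (ordGE_anti ?_ (seriesMap_mem_ordGE hT
      (mul_mem_ordGE hf hx))) (ordGE_anti ?_ (mul_mem_ordGE
        (seriesMap_mem_ordGE hT hf) (seriesMap_mem_ordGE hT hx)))
    · omega
    · omega
  · exact sub_eq_zero.2 (h1 m b f)

theorem map_coeff_seriesMap {l : Type*} [CommRing l] (θ : k →+* l) (f : LaurentSeries k) (d : ℤ) :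
    θ ((seriesMap T hT f).coeff d) = ∑ᶠ n : ℤ, θ (f.coeff n) * θ ((T n).coeff d) := by
  simp only [← map_mul]
  exact θ.toAddMonoidHom.map_finsum (support_mul_coeff_finite hT f d)

variable {m : Ideal k} (hlow : ∀ n j : ℤ, n < j → (T j).coeff n ∈ m)
  (hdiag : ∀ n : ℤ, IsUnit ((T n).coeff n))

include hlow in
theorem mk_mul_coeff_eq_zero {I : Ideal k} {a : k} (ha : a ∈ I) {n j : ℤ} (h : n < j) :
    Ideal.Quotient.mk (m * I) a * Ideal.Quotient.mk (m * I) ((T j).coeff n) = 0 := by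
  rw [← map_mul, Ideal.Quotient.eq_zero_iff_mem, mul_comm a]
  exact Ideal.mul_mem_mul (hlow n j h) ha

include hlow hdiag in
/-- The family `(T_n)` being lower triangular with invertible diagonal modulo a nilpotent ideal,
the map `∑ f_n t^n ↦ ∑ f_n T_n` is injective. -/
theorem seriesMap_injective {N : ℕ} (hm : m ^ N = ⊥) : Function.Injective (seriesMap T hT) := by
  rw [injective_iff_map_eq_zero]
  intro f hf
  obtain ⟨n₀, hf₀⟩ := exists_mem_ordGE f
  -- if the coefficients of `f` lie in `m ^ i`, then by induction on `n` they lie in `m ^ (i + 1)`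
  have key : ∀ i : ℕ, ∀ n, f.coeff n ∈ m ^ i := by
    intro i
    induction i with
    | zero => simp
    | succ i ih =>
      rw [pow_succ']
      have h1 : ∀ j : ℕ, ∀ n < n₀ + j, f.coeff n ∈ m * m ^ i := by
        intro j
        induction j with
        | zero =>
          intro n hn
          rw [hf₀ n (by simpa using hn)]
          exact zero_mem _
        | succ j hj =>
          intro n hn
          rcases (show n < n₀ + j ∨ n = n₀ + j by push_cast at hn; omega) with h | h
          · exact hj n h
          · have h2 := map_coeff_seriesMap hT (Ideal.Quotient.mk (m * m ^ i)) f n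
            rw [hf, HahnSeries.coeff_zero, map_zero, finsum_eq_single _ n, ← map_mul] at h2
            · have h3 := Ideal.Quotient.eq_zero_iff_mem.1 h2.symm
              obtain ⟨u, hu⟩ := hdiag n
              rw [← hu] at h3
              exact (Ideal.mul_unit_mem_iff_mem _ u.isUnit).1 h3
            · intro p hp
              rcases lt_or_gt_of_ne hp with hp | hp
              · rw [Ideal.Quotient.eq_zero_iff_mem.2 (hj p (h ▸ hp)), zero_mul]
              · exact mk_mul_coeff_eq_zero hlow (ih p) hp
      exact fun n => h1 (n - n₀ + 1).toNat n (by omega)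
  ext n
  have h4 := key N n
  rw [hm] at h4
  simpa using h4

/-- The solution of a triangular system of linear equations, by recursion. -/
noncomputable def triangularSolution (c g : ℕ → k) (A : ℕ → ℕ → k) : ℕ → k
  | n => c n * (g n - ∑ j : Fin n, triangularSolution c g A j * A j n)
decreasing_by exact j.2

include hlow hdiag in
/-- One step of the inversion of `∑ f_n t^n ↦ ∑ f_n T_n`: modulo `m`, the system of equations for
the `f_n` is triangular. -/
theorem exists_sub_seriesMap_mem {I : Ideal k} {n₀ : ℤ} {g : LaurentSeries k}
    (hg : g ∈ ordGE k n₀) (hgI : ∀ n, g.coeff n ∈ I) :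
    ∃ f ∈ ordGE k n₀, ∀ n, (g - seriesMap T hT f).coeff n ∈ m * I := by
  choose c hc using fun n => (hdiag n).exists_left_inv
  let a : ℕ → k := triangularSolution (fun n => c (n₀ + n)) (fun n => g.coeff (n₀ + n))
    (fun j n => (T (n₀ + j)).coeff (n₀ + n))
  have ha : ∀ n : ℕ, a n = c (n₀ + n) * (g.coeff (n₀ + n) -
      ∑ j ∈ Finset.range n, a j * (T (n₀ + j)).coeff (n₀ + n)) := by
    intro n
    rw [Finset.sum_range]
    exact triangularSolution.eq_1 _ _ _ n
  have haI : ∀ n, a n ∈ I := by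
    intro n
    induction n using Nat.strong_induction_on with
    | _ n ih =>
      rw [ha]
      refine I.mul_mem_left _ (sub_mem (hgI _) (sum_mem fun j hj => ?_))
      exact I.mul_mem_right _ (ih j (Finset.mem_range.1 hj))
  let f : LaurentSeries k :=
    HahnSeries.single n₀ 1 * HahnSeries.ofPowerSeries ℤ k (PowerSeries.mk a)
  have hf : ∀ n : ℤ, f.coeff n = if n < n₀ then 0 else a (n - n₀).toNat := by
    intro n
    rw [HahnSeries.coeff_single_mul, one_mul, PowerSeries.coeff_coe, PowerSeries.coeff_mk]
    by_cases h : n < n₀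
    · rw [if_pos h, if_pos (by omega)]
    · rw [if_neg h, if_neg (by omega)]
      congr 1
      omega
  have hf' : f ∈ ordGE k n₀ := fun d hd => by rw [hf, if_pos hd]
  have hfI : ∀ n, f.coeff n ∈ I := by
    intro n
    rw [hf]
    split_ifs
    · exact zero_mem _
    · exact haI _
  refine ⟨f, hf', fun n => ?_⟩
  rw [← Ideal.Quotient.eq_zero_iff_mem, HahnSeries.coeff_sub, map_sub, map_coeff_seriesMap,
    sub_eq_zero]
  rcases lt_or_ge n n₀ with hn | hn
  · rw [hg n hn, map_zero, finsum_eq_zero_of_forall_eq_zero]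
    intro j
    rcases lt_or_ge j n₀ with hj | hj
    · rw [hf' j hj, map_zero, zero_mul]
    · exact mk_mul_coeff_eq_zero hlow (hfI j) (hn.trans_le hj)
  · obtain ⟨i, rfl⟩ : ∃ i : ℕ, n = n₀ + i := ⟨(n - n₀).toNat, by omega⟩
    rw [finsum_eq_sum_of_support_subset (s := (Finset.range (i + 1)).map
      (Nat.castEmbedding.trans (addLeftEmbedding n₀))), Finset.sum_map, Finset.sum_range_succ]
    · have hfa : ∀ j : ℕ, f.coeff (n₀ + j) = a j := by
        intro j
        rw [hf, if_neg (by omega)]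
        congr 1
        omega
      simp only [Function.Embedding.trans_apply, Nat.castEmbedding_apply, addLeftEmbedding_apply,
        hfa]
      simp only [← map_mul, ← map_sum, ← map_add]
      congr 1
      rw [ha i]
      linear_combination (∑ j ∈ Finset.range i, a j * (T (n₀ + j)).coeff (n₀ + i) -
        g.coeff (n₀ + i)) * hc (n₀ + i)
    · intro j hj
      by_contra h
      apply hj
      rcases lt_or_ge j n₀ with hj' | hj'
      · simp only [hf' j hj', map_zero, zero_mul]
      · refine mk_mul_coeff_eq_zero hlow (hfI j) (not_le.1 fun h' => h ?_)
        simp only [Finset.coe_map, Set.mem_image, Finset.mem_coe, Finset.mem_range]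
        exact ⟨(j - n₀).toNat, by omega, by
          simp only [Function.Embedding.trans_apply, Nat.castEmbedding_apply,
            addLeftEmbedding_apply]
          omega⟩

include hlow hdiag in
/-- The map `∑ f_n t^n ↦ ∑ f_n T_n` is surjective, and the order of a preimage is at least that of
the image, up to a constant. -/
theorem exists_seriesMap_eq {N : ℕ} (hm : m ^ N = ⊥) {n₀ : ℤ} {g : LaurentSeries k}
    (hg : g ∈ ordGE k n₀) : ∃ f ∈ ordGE k (n₀ - N * D), seriesMap T hT f = g := by
  have key : ∀ i j : ℕ, i + j = N → ∀ (n : ℤ) (g : LaurentSeries k), g ∈ ordGE k n →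
      (∀ d, g.coeff d ∈ m ^ j) → ∃ f ∈ ordGE k (n - i * D), seriesMap T hT f = g := by
    intro i
    induction i with
    | zero =>
      intro j hj n g _ hgm
      refine ⟨0, zero_mem _, ?_⟩
      rw [map_zero]
      ext d
      have h := hgm d
      rw [show j = N by omega, hm] at h
      simpa using h.symm
    | succ i ih =>
      intro j hj n g hg hgm
      obtain ⟨f, hf, h⟩ := exists_sub_seriesMap_mem hT hlow hdiag hg hgm
      obtain ⟨f', hf', h'⟩ := ih (j + 1) (by omega) (n - D) (g - seriesMap T hT f)
        (sub_mem (ordGE_anti (by omega) hg) (seriesMap_mem_ordGE hT hf)) (by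
          rw [pow_succ']
          exact h)
      refine ⟨f + f', add_mem (ordGE_anti ?_ hf) (ordGE_anti ?_ hf'), ?_⟩
      · have : (0 : ℤ) ≤ ((i + 1 : ℕ) : ℤ) * D := by positivity
        omega
      · push_cast
        linarith
      · rw [map_add, h', add_sub_cancel]
  exact key N 0 rfl n₀ g hg (by simp)

end Subst

/-! ### Reparameterization -/

section Reparameterization

open IsLocalRing (maximalIdeal residue)

variable {k : Type*} [CommRing k] [IsArtinianRing k] [IsLocalRing k]

theorem coeff_zpow_mem_of_lt {τ : (LaurentSeries k)ˣ} (hτ : winding τ = 1) (n j : ℤ) (h : n < j) :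
    ((τ ^ j : (LaurentSeries k)ˣ) : LaurentSeries k).coeff n ∈ maximalIdeal k := by
  rw [← IsLocalRing.residue_eq_zero_iff]
  refine residue_coeff_of_lt ?_
  rwa [winding_zpow, hτ, mul_one]

theorem isUnit_coeff_zpow {τ : (LaurentSeries k)ˣ} (hτ : winding τ = 1) (n : ℤ) :
    IsUnit (((τ ^ n : (LaurentSeries k)ˣ) : LaurentSeries k).coeff n) := by
  rw [← IsLocalRing.residue_ne_zero_iff_isUnit]
  have h := residue_coeff_winding (τ ^ n)
  rwa [winding_zpow, hτ, mul_one] at h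

theorem exists_fg_ordGE_le (n : ℤ) :
    ∃ F : Submodule k (LaurentSeries k), F.FG ∧ ordGE k n ≤ powerSeriesSubmodule k ⊔ F := by
  obtain ⟨F, hF, h⟩ := exists_fg_map_le (HahnSeries.single n (1 : k))
  refine ⟨F, hF, fun x hx => ?_⟩
  have h1 : HahnSeries.single (-n) (1 : k) * x ∈ powerSeriesSubmodule k := by
    have h2 := mul_mem_ordGE (single_mem_ordGE (-n) (1 : k)) hx
    rwa [neg_add_cancel] at h2
  have h3 := h _ h1
  rwa [← mul_assoc, HahnSeries.single_mul_single, add_neg_cancel, one_mul,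
    HahnSeries.single_zero_one, one_mul] at h3

/-- A ring automorphism that is `k`-linear and belongs to the restricted general linear group
preserves the commutator symbol on `k((t))ˣ`: it conjugates multiplication by `f` to multiplication
by the image of `f`. -/
theorem symbol_map_ringEquiv (φ : LaurentSeries k ≃+* LaurentSeries k)
    (ρ : restrictedGL (powerSeriesSubmodule k)) (hρ : ∀ x, (ρ : LaurentSeries k ≃ₗ[k] _) x = φ x)
    (f g : (LaurentSeries k)ˣ) :
    symbol k (Units.map (φ : LaurentSeries k →* LaurentSeries k) f)
      (Units.map (φ : LaurentSeries k →* LaurentSeries k) g) = symbol k f g := by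
  have key : ∀ f : (LaurentSeries k)ˣ, laurentGL k (Units.map (φ : LaurentSeries k →* _) f) =
      ρ * laurentGL k f * ρ⁻¹ := by
    intro f
    rw [eq_mul_inv_iff_mul_eq]
    apply Subtype.ext
    refine LinearEquiv.ext fun x => ?_
    change φ (f : LaurentSeries k) * (ρ : LaurentSeries k ≃ₗ[k] _) x =
      (ρ : LaurentSeries k ≃ₗ[k] _) ((f : LaurentSeries k) * x)
    rw [hρ, hρ, map_mul]
  rw [symbol_apply, symbol_apply, key, key]
  exact commSymbol_conj ρ ((Commute.all f g).map (laurentGL k))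

/-- Substitution of a unit `τ` of winding number one for `t` is an automorphism of the ring
`k((t))` that preserves the Contou-Carrère symbol. -/
theorem exists_substitution {τ : (LaurentSeries k)ˣ} (hτ : winding τ = 1) :
    ∃ φ : LaurentSeries k ≃+* LaurentSeries k, (∀ f, IsSubstitution τ f (φ f)) ∧
      ∀ f g : (LaurentSeries k)ˣ,
        contouCarrere (Units.map (φ : LaurentSeries k →* LaurentSeries k) f)
          (Units.map (φ : LaurentSeries k →* LaurentSeries k) g) = contouCarrere f g := by
  obtain ⟨N, hN⟩ := exists_maximalIdeal_pow_eq_bot k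
  obtain ⟨D, hT⟩ := exists_zpow_mem_ordGE hτ
  set T : ℤ → LaurentSeries k :=
    fun n => ((τ ^ n : (LaurentSeries k)ˣ) : LaurentSeries k) with hTdef
  have hlow : ∀ n j : ℤ, n < j → (T j).coeff n ∈ maximalIdeal k := coeff_zpow_mem_of_lt hτ
  have hdiag : ∀ n : ℤ, IsUnit ((T n).coeff n) := isUnit_coeff_zpow hτ
  have hmul : ∀ m n, T (m + n) = T m * T n := fun m n => by
    simp only [hTdef, zpow_add, Units.val_mul]
  have hinj := seriesMap_injective hT hlow hdiag hN
  have hsurj : Function.Surjective (seriesMap T hT) := fun g => by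
    obtain ⟨n₀, hg⟩ := exists_mem_ordGE g
    obtain ⟨f, -, hf⟩ := exists_seriesMap_eq hT hlow hdiag hN hg
    exact ⟨f, hf⟩
  let L : LaurentSeries k ≃ₗ[k] LaurentSeries k :=
    LinearEquiv.ofBijective (seriesMap T hT) ⟨hinj, hsurj⟩
  let φ : LaurentSeries k ≃+* LaurentSeries k :=
    { L with map_mul' := seriesMap_mul hT hmul }
  have hL : L ∈ restrictedGL (powerSeriesSubmodule k) := by
    change Commensurable _ _
    rw [commensurable_iff]
    constructor
    · obtain ⟨F, hF, h⟩ := exists_fg_ordGE_le (k := k) (0 - N * D)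
      refine ⟨F.map L.toLinearMap, hF.map _, fun x hx => ?_⟩
      obtain ⟨y, hy, rfl⟩ := exists_seriesMap_eq hT hlow hdiag hN (n₀ := 0) hx
      rw [← Submodule.map_sup]
      exact ⟨y, h hy, rfl⟩
    · obtain ⟨F, hF, h⟩ := exists_fg_ordGE_le (k := k) (0 - D)
      refine ⟨F, hF, ?_⟩
      rintro _ ⟨x, hx, rfl⟩
      exact h (seriesMap_mem_ordGE hT (n := 0) hx)
  have hw : ∀ f : (LaurentSeries k)ˣ,
      winding (Units.map (φ : LaurentSeries k →* LaurentSeries k) f) = winding f := by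
    intro f
    have h1 : ∀ d ≤ winding f, residue k ((seriesMap T hT f).coeff d) =
        residue k ((f : LaurentSeries k).coeff d) * residue k ((T d).coeff d) := by
      intro d hd
      rw [map_coeff_seriesMap, finsum_eq_single _ d]
      intro n hn
      rcases lt_or_gt_of_ne hn with hn | hn
      · rw [residue_coeff_of_lt (hn.trans_le hd), zero_mul]
      · rw [(IsLocalRing.residue_eq_zero_iff _).2 (hlow d n hn), mul_zero]
    refine winding_eq_of_residue (fun d hd => (h1 d hd.le).trans ?_) ?_
    · rw [residue_coeff_of_lt hd, zero_mul]
    · change residue k ((seriesMap T hT f).coeff _) ≠ 0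
      rw [h1 _ le_rfl]
      exact mul_ne_zero (residue_coeff_winding f)
        ((IsLocalRing.residue_ne_zero_iff_isUnit _).2 (hdiag _))
  refine ⟨φ, fun f d => ⟨support_mul_coeff_finite hT f d, rfl⟩, fun f g => ?_⟩
  rw [← inv_inj, contouCarrere_inv, contouCarrere_inv, hw, hw,
    symbol_map_ringEquiv φ ⟨L, hL⟩ (fun _ => rfl)]

end Reparameterization

end CommDet

theorem mainTheorem1 (k : Type*) [CommRing k] [IsArtinianRing k] [IsLocalRing k] :
    -- every unit of `k((t))` has a winding number and Witt parameters, and these are unique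
    (∀ f : (LaurentSeries k)ˣ, ∃! p : CommDet.WittParams k, p.toLaurent = f) ∧
    -- the determinant groupoid yields a central extension of the restricted general linear group
    -- of `k((t))` and `k[[t]]` by `kˣ`
    (Function.Injective (CommDet.CentralExt.scalar (CommDet.powerSeriesSubmodule k)) ∧
      (CommDet.CentralExt.scalar (CommDet.powerSeriesSubmodule k)).range =
        (CommDet.CentralExt.proj (CommDet.powerSeriesSubmodule k)).ker ∧
      (CommDet.CentralExt.scalar (CommDet.powerSeriesSubmodule k)).range ≤
        Subgroup.center (CommDet.CentralExt (CommDet.powerSeriesSubmodule k)) ∧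
      Function.Surjective (CommDet.CentralExt.proj (CommDet.powerSeriesSubmodule k))) ∧
    -- the symbol of commuting elements is the commutator of any liftings to the central extension
    (∀ σ τ : CommDet.restrictedGL (CommDet.powerSeriesSubmodule k), Commute σ τ →
      ∀ s t : CommDet.CentralExt (CommDet.powerSeriesSubmodule k),
        CommDet.CentralExt.proj _ s = σ → CommDet.CentralExt.proj _ t = τ →
        s * t * s⁻¹ * t⁻¹ = CommDet.CentralExt.scalar _ (CommDet.commSymbol _ σ τ)) ∧
    -- the Contou-Carrère symbol is, up to sign, the inverse of the commutator symbol
    (∀ f g : (LaurentSeries k)ˣ, (CommDet.contouCarrere f g)⁻¹ =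
      (-1) ^ (CommDet.winding f * CommDet.winding g) *
        CommDet.commSymbol (CommDet.powerSeriesSubmodule k)
          (CommDet.laurentGL k f) (CommDet.laurentGL k g)) ∧
    -- bimultiplicativity
    (∀ f f' g : (LaurentSeries k)ˣ, CommDet.contouCarrere (f * f') g =
      CommDet.contouCarrere f g * CommDet.contouCarrere f' g) ∧
    (∀ f g g' : (LaurentSeries k)ˣ, CommDet.contouCarrere f (g * g') =
      CommDet.contouCarrere f g * CommDet.contouCarrere f g') ∧
    -- invariance under reparameterization: for each `τ` of winding number one, substituting `τ`
    -- for `t` is an automorphism of the ring `k((t))` that preserves the symbol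
    (∀ τ : (LaurentSeries k)ˣ, CommDet.winding τ = 1 →
      ∃ φ : LaurentSeries k ≃+* LaurentSeries k,
        (∀ f : LaurentSeries k, CommDet.IsSubstitution τ f (φ f)) ∧
        ∀ f g : (LaurentSeries k)ˣ,
          CommDet.contouCarrere (Units.map (φ : LaurentSeries k →* LaurentSeries k) f)
            (Units.map (φ : LaurentSeries k →* LaurentSeries k) g) = CommDet.contouCarrere f g) := by
  refine ⟨CommDet.existsUnique_toLaurent_eq, ⟨CommDet.CentralExt.scalar_injective,
    CommDet.CentralExt.range_scalar, CommDet.CentralExt.range_scalar_le_center,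
    CommDet.CentralExt.proj_surjective⟩, fun σ τ h s t hs ht => CommDet.commSymbol_spec h s t hs ht,
    CommDet.contouCarrere_inv, CommDet.contouCarrere_mul_left, CommDet.contouCarrere_mul_right,
    fun τ hτ => CommDet.exists_substitution hτ⟩
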